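/- Let $\Bbbk$ be a field; all vector spaces, tensor products and maps are over $\Bbbk$, and no finite-dimensionality is assumed. **Dual quasi-bialgebras.** A dual quasi-bialgebra $(H,m,u,\Delta,\varepsilon,\omega)$ is a coassociative counital coalgebra $(H,\Delta,\varepsilon)$ with coalgebra maps $m:H\otimes H\to H$, $u:\Bbbk\to H$ ($1_H:=u(1)$, $hk:=m(h\otimes k)$) and a convolution invertible linear map $\omega:H\otimes H\otimes H\to\Bbbk$ (with inverse $\omega^{-1}$) such that $$\omega(H\otimes H\otimes m)*\omega(m\otimes H\otimes H)=(\varepsilon\otimes\omega)*\omega(H\otimes m\otimes H)*(\omega\otimes\varepsilon),\qquad m(H\otimes m)*\omega=\omega*m(m\otimes H),$$ $\omega(h\otimes k\otimes l)=\varepsilon(h)\varepsilon(k)\varepsilon(l)$ whenever $1_H\in\{h,k,l\}$, and $1_Hh=h=h1_H$. A morphism of dual quasi-bialgebras is a coalgebra map $\alpha:H\to H'$ with $\alpha m=m'(\alpha\otimes\alpha)$, $\alpha u=u'$, $\omega'(\alpha\otimes\alpha\otimes\alpha)=\omega$. A dual quasi-bialgebra with projection onto $H$ is a triple $(A,\sigma,\pi)$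 with $A$ a dual quasi-bialgebra and $\sigma:H\to A$, $\pi:A\to H$ morphisms of dual quasi-bialgebras such that $\pi\sigma=\mathrm{Id}_H$. **Yetter–Drinfeld modules.** A Yetter–Drinfeld module over $H$ is a left $H$-comodule $V$ (coassociative and counital, $\rho(v)=v_{-1}\otimes v_0$) with a linear map $\vartriangleright:H\otimes V\to V$ such that $1_H\vartriangleright v=v$, $(h_1\vartriangleright v)_{-1}h_2\otimes(h_1\vartriangleright v)_0=h_1v_{-1}\otimes(h_2\vartriangleright v_0)$ and $$(hl)\vartriangleright v=\omega^{-1}(h_1\otimes l_1\otimes v_{-1})\,\omega(h_2\otimes(l_2\vartriangleright v_0)_{-1}\otimes l_3)\,\omega^{-1}\big((h_3\vartriangleright(l_2\vartriangleright v_0)_0)_{-1}\otimes h_4\otimes l_4\big)\,(h_3\vartriangleright(l_2\vartriangleright v_0)_0)_0 .$$ Morphisms are the linear maps that are compatible with $\rho$ and $\vartriangleright$. These modules form a pre-braided monoidal category ${}_H^H\mathcal{YD}$: the unit is $\Bbbk$ with $\rho(c)=1_H\otimes c$ and $h\vartriangleright c=\varepsilon(h)c$; on $V\otimes W$ one has $\rho(v\otimes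 w)=v_{-1}w_{-1}\otimes v_0\otimes w_0$ and $$h\vartriangleright(v\otimes w)=\omega(h_1\otimes v_{-1}\otimes w_{-2})\,\omega^{-1}((h_2\vartriangleright v_0)_{-2}\otimes h_3\otimes w_{-1})\,\omega((h_2\vartriangleright v_0)_{-1}\otimes(h_4\vartriangleright w_0)_{-1}\otimes h_5)\,(h_2\vartriangleright v_0)_0\otimes(h_4\vartriangleright w_0)_0;$$ the associativity constraint is $a((x\otimes y)\otimes z)=\omega^{-1}(x_{-1}\otimes y_{-1}\otimes z_{-1})\,x_0\otimes(y_0\otimes z_0)$, the unit constraints are the usual ones, and the pre-braiding is $c(v\otimes w)=(v_{-1}\vartriangleright w)\otimes v_0$. A bialgebra in ${}_H^H\mathcal{YD}$ is an object $R$ with morphisms $m_R,u_R,\Delta_R,\varepsilon_R$ of ${}_H^H\mathcal{YD}$ such that $(R,m_R,u_R)$ is an algebra and $(R,\Delta_R,\varepsilon_R)$ a coalgebra in this monoidal category, and such that $\Delta_Rm_R=(m_R\otimes m_R)\Delta_{R\otimes R}$, $\varepsilon_Rm_R=\varepsilon_R\otimes\varepsilon_R$, $\Delta_R u_R=u_R\otimes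 u_R$, $\varepsilon_Ru_R=\mathrm{Id}_\Bbbk$, where $$\Delta_{R\otimes R}=a^{-1}_{R,R,R\otimes R}\,(R\otimes a_{R,R,R})\,(R\otimes(c_{R,R}\otimes R))\,(R\otimes a^{-1}_{R,R,R})\,a_{R,R,R\otimes R}\,(\Delta_R\otimes\Delta_R).$$ **Theorem.** Let $(H,m_H,u_H,\Delta_H,\varepsilon_H,\omega_H)$ be a dual quasi-bialgebra and let $R$ be a bialgebra in ${}_H^H\mathcal{YD}$; write $r\cdot_Rs=m_R(r\otimes s)$, $1_R=u_R(1_\Bbbk)$, $\Delta_R(r)=r^1\otimes r^2$. Then the vector space $B=R\otimes H$ is a dual quasi-bialgebra (the bosonization $R\#H$) with the structure $$\begin{aligned} m_B[(r\otimes h)\otimes(s\otimes k)]={}&\omega_H^{-1}(r_{-2}\otimes h_1\otimes s_{-2}k_1)\,\omega_H(h_2\otimes s_{-1}\otimes k_2)\,\omega_H^{-1}((h_3\vartriangleright s_0)_{-2}\otimes h_4\otimes k_3)\\ &\omega_H(r_{-1}\otimes(h_3\vartriangleright s_0)_{-1}\otimes h_5k_4)\;r_0\cdot_R(h_3\vartriangleright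 s_0)_0\otimes h_6k_5,\\ u_B(c)={}&c\,1_R\otimes1_H,\\ \Delta_B(r\otimes h)={}&\omega_H^{-1}(r^1_{-1}\otimes r^2_{-2}\otimes h_1)\,(r^1_0\otimes r^2_{-1}h_2)\otimes(r^2_0\otimes h_3),\\ \varepsilon_B(r\otimes h)={}&\varepsilon_R(r)\varepsilon_H(h),\\ \omega_B((r\otimes h)\otimes(s\otimes k)\otimes(t\otimes l))={}&\varepsilon_R(r)\varepsilon_R(s)\varepsilon_R(t)\,\omega_H(h\otimes k\otimes l). \end{aligned}$$ Moreover, the maps $\sigma:H\to R\#H$, $\sigma(h)=1_R\otimes h$, and $\pi:R\#H\to H$, $\pi(r\otimes h)=\varepsilon_R(r)h$, are morphisms of dual quasi-bialgebras with $\pi\sigma=\mathrm{Id}_H$; that is, $(R\#H,\sigma,\pi)$ is a dual quasi-bialgebra with projection onto $H$. -/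

import Mathlib

open scoped TensorProduct

universe u v w

namespace DQB

/-! ### Sweedler sums

`sw t f` is `∑ f aᵢ bᵢ`, where `t = ∑ aᵢ ⊗ bᵢ`.  It is used only for bodies `f` that are linear in
each variable, and then it does not depend on the presentation of `t`: see `sw_eq_lift`. -/

section Sweedler

variable {k : Type*} [Field k] {A B C D : Type*}
  [AddCommGroup A] [Module k A] [AddCommGroup B] [Module k B]
  [AddCommGroup C] [Module k C] [AddCommGroup D] [Module k D]

/-- The Sweedler sum `∑ f t₁ t₂` for `t = ∑ t₁ ⊗ t₂`. -/
noncomputable def sw (t : A ⊗[k] B) (f : A → B → C) : C :=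
  ∑ p ∈ (TensorProduct.exists_finset t).choose, f p.1 p.2

theorem map_eq_sw (L : A ⊗[k] B →ₗ[k] C) (t : A ⊗[k] B) :
    L t = sw t (fun a b => L (a ⊗ₜ[k] b)) := by
  have h := (TensorProduct.exists_finset t).choose_spec
  conv_lhs => rw [h]
  rw [map_sum]
  rfl

theorem eq_sw (t : A ⊗[k] B) : t = sw t (fun a b => a ⊗ₜ[k] b) :=
  (TensorProduct.exists_finset t).choose_spec

/-- For a bilinear body the Sweedler sum is the usual linear extension. -/
theorem sw_eq_lift (f : A →ₗ[k] B →ₗ[k] C) (t : A ⊗[k] B) :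
    sw t (fun a b => f a b) = TensorProduct.lift f t := by
  rw [map_eq_sw (TensorProduct.lift f) t]
  simp

theorem sw_tmul (t : A ⊗[k] B) (f : A → B → C) (d : D) :
    (sw t f) ⊗ₜ[k] d = sw t (fun a b => f a b ⊗ₜ[k] d) := TensorProduct.sum_tmul _ _ _

theorem tmul_sw (t : A ⊗[k] B) (f : A → B → C) (d : D) :
    d ⊗ₜ[k] (sw t f) = sw t (fun a b => d ⊗ₜ[k] f a b) := TensorProduct.tmul_sum _ _ _

theorem smul_sw (t : A ⊗[k] B) (f : A → B → C) (c : k) :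
    c • (sw t f) = sw t (fun a b => c • f a b) := Finset.smul_sum

end Sweedler

theorem map_sw {k A B C D F : Type*} [Field k] [AddCommGroup A] [Module k A]
    [AddCommGroup B] [Module k B] [AddCommGroup C] [AddCommGroup D]
    [FunLike F C D] [AddMonoidHomClass F C D] (L : F) (t : A ⊗[k] B)
    (f : A → B → C) : L (sw t f) = sw t (fun a b => L (f a b)) := map_sum _ _ _

/-! ### Dual quasi-bialgebras -/

/-- The convolution `f ∗ g = p ∘ (f ⊗ g) ∘ Δ` of two linear maps on a coalgebra, with respect to a
pairing `p` of their targets: the multiplication of `k`, or a scalar multiplication. -/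
noncomputable def conv {k C A B D : Type*} [Field k] [AddCommMonoid C] [Module k C] [Coalgebra k C]
    [AddCommMonoid A] [Module k A] [AddCommMonoid B] [Module k B] [AddCommMonoid D] [Module k D]
    (p : A ⊗[k] B →ₗ[k] D) (f : C →ₗ[k] A) (g : C →ₗ[k] B) : C →ₗ[k] D :=
  p ∘ₗ TensorProduct.map f g ∘ₗ Coalgebra.comul

section Composites

variable {k H : Type*} [Field k] [AddCommGroup H] [Module k H]

/-- `m(H ⊗ m) : (h ⊗ l) ⊗ j ↦ h (l j)` -/
noncomputable def mR (m : H ⊗[k] H →ₗ[k] H) : (H ⊗[k] H) ⊗[k] H →ₗ[k] H :=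
  m ∘ₗ TensorProduct.map LinearMap.id m ∘ₗ (TensorProduct.assoc k H H H).toLinearMap

/-- `m(m ⊗ H) : (h ⊗ l) ⊗ j ↦ (h l) j` -/
noncomputable def mL (m : H ⊗[k] H →ₗ[k] H) : (H ⊗[k] H) ⊗[k] H →ₗ[k] H :=
  m ∘ₗ TensorProduct.map m LinearMap.id

/-- `ω(H ⊗ H ⊗ m) : ((h ⊗ l) ⊗ j) ⊗ i ↦ ω(h ⊗ l ⊗ j i)` -/
noncomputable def ωHHm (ω : (H ⊗[k] H) ⊗[k] H →ₗ[k] k) (m : H ⊗[k] H →ₗ[k] H) :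
    ((H ⊗[k] H) ⊗[k] H) ⊗[k] H →ₗ[k] k :=
  ω ∘ₗ TensorProduct.map LinearMap.id m ∘ₗ (TensorProduct.assoc k (H ⊗[k] H) H H).toLinearMap

/-- `ω(m ⊗ H ⊗ H) : ((h ⊗ l) ⊗ j) ⊗ i ↦ ω(h l ⊗ j ⊗ i)` -/
noncomputable def ωmHH (ω : (H ⊗[k] H) ⊗[k] H →ₗ[k] k) (m : H ⊗[k] H →ₗ[k] H) :
    ((H ⊗[k] H) ⊗[k] H) ⊗[k] H →ₗ[k] k :=
  ω ∘ₗ TensorProduct.map (TensorProduct.map m LinearMap.id) LinearMap.id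

/-- `ω(H ⊗ m ⊗ H) : ((h ⊗ l) ⊗ j) ⊗ i ↦ ω(h ⊗ l j ⊗ i)` -/
noncomputable def ωHmH (ω : (H ⊗[k] H) ⊗[k] H →ₗ[k] k) (m : H ⊗[k] H →ₗ[k] H) :
    ((H ⊗[k] H) ⊗[k] H) ⊗[k] H →ₗ[k] k :=
  ω ∘ₗ TensorProduct.map
    (TensorProduct.map LinearMap.id m ∘ₗ (TensorProduct.assoc k H H H).toLinearMap) LinearMap.id

/-- `ε ⊗ ω : ((h ⊗ l) ⊗ j) ⊗ i ↦ ε(h) ω(l ⊗ j ⊗ i)` -/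
noncomputable def εω (ε : H →ₗ[k] k) (ω : (H ⊗[k] H) ⊗[k] H →ₗ[k] k) :
    ((H ⊗[k] H) ⊗[k] H) ⊗[k] H →ₗ[k] k :=
  LinearMap.mul' k k ∘ₗ TensorProduct.map ε ω ∘ₗ
    TensorProduct.map LinearMap.id (TensorProduct.assoc k H H H).symm.toLinearMap ∘ₗ
    (TensorProduct.assoc k H H (H ⊗[k] H)).toLinearMap ∘ₗ
    (TensorProduct.assoc k (H ⊗[k] H) H H).toLinearMap

/-- `ω ⊗ ε : ((h ⊗ l) ⊗ j) ⊗ i ↦ ω(h ⊗ l ⊗ j) ε(i)` -/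
noncomputable def ωε (ε : H →ₗ[k] k) (ω : (H ⊗[k] H) ⊗[k] H →ₗ[k] k) :
    ((H ⊗[k] H) ⊗[k] H) ⊗[k] H →ₗ[k] k :=
  LinearMap.mul' k k ∘ₗ TensorProduct.map ω ε

end Composites

/-- A dual quasi-bialgebra `(H, m, u, Δ, ε, ω)` over `k`.  The convolution inverse of `ω`, which is
unique, is recorded as `ωInv`. -/
class DualQuasiBialgebra (k : Type u) (H : Type v) [Field k] [AddCommGroup H] [Module k H]
    extends Coalgebra k H where
  /-- the multiplication, a coalgebra map -/
  m : H ⊗[k] H →ₗc[k] H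
  /-- the unit, a coalgebra map -/
  u : k →ₗc[k] H
  /-- the reassociator -/
  ω : (H ⊗[k] H) ⊗[k] H →ₗ[k] k
  /-- the convolution inverse of the reassociator -/
  ωInv : (H ⊗[k] H) ⊗[k] H →ₗ[k] k
  ω_conv_ωInv : conv (LinearMap.mul' k k) ω ωInv = Coalgebra.counit
  ωInv_conv_ω : conv (LinearMap.mul' k k) ωInv ω = Coalgebra.counit
  /-- `ω(H ⊗ H ⊗ m) ∗ ω(m ⊗ H ⊗ H) = (ε ⊗ ω) ∗ ω(H ⊗ m ⊗ H) ∗ (ω ⊗ ε)` -/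
  cocycle :
    conv (LinearMap.mul' k k) (ωHHm ω m.toLinearMap) (ωmHH ω m.toLinearMap) =
    conv (LinearMap.mul' k k)
      (conv (LinearMap.mul' k k) (εω Coalgebra.counit ω) (ωHmH ω m.toLinearMap))
      (ωε Coalgebra.counit ω)
  ω_one_left : ∀ h l : H,
    ω ((u 1 ⊗ₜ[k] h) ⊗ₜ[k] l) = Coalgebra.counit (R := k) h * Coalgebra.counit (R := k) l
  ω_one_mid : ∀ h l : H,
    ω ((h ⊗ₜ[k] u 1) ⊗ₜ[k] l) = Coalgebra.counit (R := k) h * Coalgebra.counit (R := k) l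
  ω_one_right : ∀ h l : H,
    ω ((h ⊗ₜ[k] l) ⊗ₜ[k] u 1) = Coalgebra.counit (R := k) h * Coalgebra.counit (R := k) l
  /-- `m(H ⊗ m) ∗ ω = ω ∗ m(m ⊗ H)` -/
  quasi_assoc :
    conv (TensorProduct.rid k H).toLinearMap (mR m.toLinearMap) ω =
    conv (TensorProduct.lid k H).toLinearMap ω (mL m.toLinearMap)
  one_m : ∀ h : H, m (u 1 ⊗ₜ[k] h) = h
  m_one : ∀ h : H, m (h ⊗ₜ[k] u 1) = h

/-- A morphism of dual quasi-bialgebras. -/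
structure DualQuasiBialgebraHom (k : Type u) (H : Type v) (H' : Type w) [Field k]
    [AddCommGroup H] [Module k H] [AddCommGroup H'] [Module k H']
    [DualQuasiBialgebra k H] [DualQuasiBialgebra k H'] extends H →ₗc[k] H' where
  map_m : ∀ h l : H, toFun (DualQuasiBialgebra.m (k := k) (h ⊗ₜ[k] l)) =
    DualQuasiBialgebra.m (k := k) (toFun h ⊗ₜ[k] toFun l)
  map_u : ∀ c : k, toFun (DualQuasiBialgebra.u c) = DualQuasiBialgebra.u c
  map_ω : ∀ h l j : H,
    DualQuasiBialgebra.ω (k := k) ((toFun h ⊗ₜ[k] toFun l) ⊗ₜ[k] toFun j) =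
      DualQuasiBialgebra.ω (k := k) ((h ⊗ₜ[k] l) ⊗ₜ[k] j)

section Notations

variable (k : Type*) {H : Type*} [Field k] [AddCommGroup H] [Module k H] [DualQuasiBialgebra k H]

/-- `Δ h` -/
noncomputable abbrev Δ (h : H) : H ⊗[k] H := Coalgebra.comul h

/-- the counit `ε h` -/
noncomputable abbrev ε (h : H) : k := Coalgebra.counit h

/-- the product `h l` -/
noncomputable abbrev mulH (h l : H) : H := DualQuasiBialgebra.m (k := k) (h ⊗ₜ[k] l)

/-- the unit `1_H` -/
noncomputable abbrev oneH (H : Type*) [AddCommGroup H] [Module k H] [DualQuasiBialgebra k H] : H :=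
  DualQuasiBialgebra.u (1 : k)

/-- `ω(h ⊗ l ⊗ j)` -/
noncomputable abbrev om (h l j : H) : k := DualQuasiBialgebra.ω ((h ⊗ₜ[k] l) ⊗ₜ[k] j)

/-- `ω⁻¹(h ⊗ l ⊗ j)` -/
noncomputable abbrev omInv (h l j : H) : k := DualQuasiBialgebra.ωInv ((h ⊗ₜ[k] l) ⊗ₜ[k] j)

end Notations

/-! ### The associativity constraint of left comodules and the braiding -/

section Constraints

variable {k H U V W : Type*} [Field k] [AddCommGroup H] [Module k H]
  [AddCommGroup U] [Module k U] [AddCommGroup V] [Module k V] [AddCommGroup W] [Module k W]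

/-- `(u ⊗ v) ⊗ w ↦ φ(u₋₁ ⊗ v₋₁ ⊗ w₋₁) (u₀ ⊗ v₀) ⊗ w₀` -/
noncomputable def twist (φ : (H ⊗[k] H) ⊗[k] H →ₗ[k] k)
    (ρU : U →ₗ[k] H ⊗[k] U) (ρV : V →ₗ[k] H ⊗[k] V) (ρW : W →ₗ[k] H ⊗[k] W) :
    (U ⊗[k] V) ⊗[k] W →ₗ[k] (U ⊗[k] V) ⊗[k] W :=
  (TensorProduct.lid k ((U ⊗[k] V) ⊗[k] W)).toLinearMap ∘ₗ
    TensorProduct.map φ LinearMap.id ∘ₗ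
    (TensorProduct.tensorTensorTensorComm k (H ⊗[k] H) (U ⊗[k] V) H W).toLinearMap ∘ₗ
    TensorProduct.map
      ((TensorProduct.tensorTensorTensorComm k H U H V).toLinearMap ∘ₗ TensorProduct.map ρU ρV) ρW

/-- The diagonal coaction `v ⊗ w ↦ v₋₁ w₋₁ ⊗ (v₀ ⊗ w₀)`. -/
noncomputable def tensorCoaction [DualQuasiBialgebra k H]
    (ρV : V →ₗ[k] H ⊗[k] V) (ρW : W →ₗ[k] H ⊗[k] W) :
    V ⊗[k] W →ₗ[k] H ⊗[k] (V ⊗[k] W) :=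
  TensorProduct.map (DualQuasiBialgebra.m (k := k) (H := H)).toLinearMap LinearMap.id ∘ₗ
    (TensorProduct.tensorTensorTensorComm k H V H W).toLinearMap ∘ₗ TensorProduct.map ρV ρW

/-- The associativity constraint of left `H`-comodules,
`(u ⊗ v) ⊗ w ↦ ω⁻¹(u₋₁ ⊗ v₋₁ ⊗ w₋₁) u₀ ⊗ (v₀ ⊗ w₀)`. -/
noncomputable def assocC [DualQuasiBialgebra k H]
    (ρU : U →ₗ[k] H ⊗[k] U) (ρV : V →ₗ[k] H ⊗[k] V) (ρW : W →ₗ[k] H ⊗[k] W) :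
    (U ⊗[k] V) ⊗[k] W →ₗ[k] U ⊗[k] (V ⊗[k] W) :=
  (TensorProduct.assoc k U V W).toLinearMap ∘ₗ twist DualQuasiBialgebra.ωInv ρU ρV ρW

/-- The inverse of the associativity constraint,
`u ⊗ (v ⊗ w) ↦ ω(u₋₁ ⊗ v₋₁ ⊗ w₋₁) (u₀ ⊗ v₀) ⊗ w₀`. -/
noncomputable def assocCInv [DualQuasiBialgebra k H]
    (ρU : U →ₗ[k] H ⊗[k] U) (ρV : V →ₗ[k] H ⊗[k] V) (ρW : W →ₗ[k] H ⊗[k] W) :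
    U ⊗[k] (V ⊗[k] W) →ₗ[k] (U ⊗[k] V) ⊗[k] W :=
  twist DualQuasiBialgebra.ω ρU ρV ρW ∘ₗ (TensorProduct.assoc k U V W).symm.toLinearMap

/-- `c (v ⊗ w) = (v₋₁ ▷ w) ⊗ v₀` -/
noncomputable def braid (ρV : V →ₗ[k] H ⊗[k] V) (μW : H ⊗[k] W →ₗ[k] W) :
    V ⊗[k] W →ₗ[k] W ⊗[k] V :=
  TensorProduct.map μW LinearMap.id ∘ₗ
    (TensorProduct.rightComm k H V W).toLinearMap ∘ₗ TensorProduct.map ρV LinearMap.id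

theorem twist_tmul (φ : (H ⊗[k] H) ⊗[k] H →ₗ[k] k)
    (ρU : U →ₗ[k] H ⊗[k] U) (ρV : V →ₗ[k] H ⊗[k] V) (ρW : W →ₗ[k] H ⊗[k] W)
    (x : U) (y : V) (z : W) :
    twist φ ρU ρV ρW ((x ⊗ₜ[k] y) ⊗ₜ[k] z) =
      sw (ρU x) fun x₁ x₀ => sw (ρV y) fun y₁ y₀ => sw (ρW z) fun z₁ z₀ =>
        φ ((x₁ ⊗ₜ[k] y₁) ⊗ₜ[k] z₁) • ((x₀ ⊗ₜ[k] y₀) ⊗ₜ[k] z₀) := by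
  simp only [twist, LinearMap.comp_apply, TensorProduct.map_tmul, LinearEquiv.coe_coe]
  conv_lhs => rw [eq_sw (ρU x), eq_sw (ρV y), eq_sw (ρW z)]
  simp only [sw_tmul]
  rw [map_sw, sw_tmul, map_sw, map_sw, map_sw]
  congr! 3 with x₁ x₀
  rw [tmul_sw (ρV y), map_sw, sw_tmul, map_sw, map_sw, map_sw]
  congr! 3 with y₁ y₀
  rw [tmul_sw, map_sw, map_sw, map_sw]
  simp

theorem braid_tmul (ρV : V →ₗ[k] H ⊗[k] V) (μW : H ⊗[k] W →ₗ[k] W) (x : V) (y : W) :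
    braid ρV μW (x ⊗ₜ[k] y) = sw (ρV x) fun x₁ x₀ => μW (x₁ ⊗ₜ[k] y) ⊗ₜ[k] x₀ := by
  simp only [braid, LinearMap.comp_apply, TensorProduct.map_tmul, LinearEquiv.coe_coe]
  conv_lhs => rw [eq_sw (ρV x)]
  simp only [sw_tmul, map_sw]
  simp

end Constraints

/-! ### Yetter–Drinfeld modules -/

/-- A left coaction and a left action of `H` on `V`, no axioms being imposed. -/
structure PreYD (k : Type u) (H : Type v) (V : Type w) [Field k] [AddCommGroup H] [Module k H]
    [AddCommGroup V] [Module k V] where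
  /-- the coaction `v ↦ v₋₁ ⊗ v₀` -/
  coact : V →ₗ[k] H ⊗[k] V
  /-- the action `h ⊗ v ↦ h ▷ v` -/
  act : H ⊗[k] V →ₗ[k] V

/-- A Yetter–Drinfeld module over the dual quasi-bialgebra `H`. -/
structure YDModule (k : Type u) (H : Type v) (V : Type w) [Field k] [AddCommGroup H] [Module k H]
    [DualQuasiBialgebra k H] [AddCommGroup V] [Module k V] extends PreYD k H V where
  coact_coassoc : (TensorProduct.assoc k H H V).toLinearMap ∘ₗ
      TensorProduct.map Coalgebra.comul LinearMap.id ∘ₗ coact =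
    TensorProduct.map LinearMap.id coact ∘ₗ coact
  coact_counit : (TensorProduct.lid k V).toLinearMap ∘ₗ
      TensorProduct.map Coalgebra.counit LinearMap.id ∘ₗ coact = LinearMap.id
  /-- `(h l) ▷ v = ω⁻¹(h₁ ⊗ l₁ ⊗ v₋₁) ω(h₂ ⊗ (l₂ ▷ v₀)₋₁ ⊗ l₃)
  ω⁻¹((h₃ ▷ (l₂ ▷ v₀)₀)₋₁ ⊗ h₄ ⊗ l₄) (h₃ ▷ (l₂ ▷ v₀)₀)₀` -/
  mul_act : ∀ (h l : H) (v : V), act (mulH k h l ⊗ₜ[k] v) =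
    sw (Δ k h) fun h₁ h' => sw (Δ k h') fun h₂ h' => sw (Δ k h') fun h₃ h₄ =>
    sw (Δ k l) fun l₁ l' => sw (Δ k l') fun l₂ l' => sw (Δ k l') fun l₃ l₄ =>
    sw (coact v) fun v₁ v₀ =>
    sw (coact (act (l₂ ⊗ₜ[k] v₀))) fun x₁ x₀ =>
    sw (coact (act (h₃ ⊗ₜ[k] x₀))) fun y₁ y₀ =>
      (omInv k h₁ l₁ v₁ * om k h₂ x₁ l₃ * omInv k y₁ h₄ l₄) • y₀
  one_act : ∀ v : V, act (oneH k H ⊗ₜ[k] v) = v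
  /-- `(h₁ ▷ v)₋₁ h₂ ⊗ (h₁ ▷ v)₀ = h₁ v₋₁ ⊗ (h₂ ▷ v₀)` -/
  compat : ∀ (h : H) (v : V),
    (sw (Δ k h) fun h₁ h₂ => sw (coact (act (h₁ ⊗ₜ[k] v))) fun x₁ x₀ =>
      mulH k x₁ h₂ ⊗ₜ[k] x₀) =
    sw (Δ k h) fun h₁ h₂ => sw (coact v) fun v₁ v₀ =>
      mulH k h₁ v₁ ⊗ₜ[k] act (h₂ ⊗ₜ[k] v₀)

section YD

variable {k H V W : Type*} [Field k] [AddCommGroup H] [Module k H] [DualQuasiBialgebra k H]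
  [AddCommGroup V] [Module k V] [AddCommGroup W] [Module k W]

/-- A linear map that respects the coactions and the actions, that is, a morphism of
Yetter–Drinfeld modules if `X` and `Y` are such modules. -/
structure IsYDHom (X : PreYD k H V) (Y : PreYD k H W) (f : V →ₗ[k] W) : Prop where
  colinear : Y.coact ∘ₗ f = TensorProduct.map LinearMap.id f ∘ₗ X.coact
  linear : f ∘ₗ X.act = Y.act ∘ₗ TensorProduct.map LinearMap.id f

variable (k H) in
/-- The unit object `k`: `ρ(c) = 1_H ⊗ c` and `h ▷ c = ε(h) c`. -/
noncomputable def unitYD : PreYD k H k where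
  coact := TensorProduct.mk k H k (oneH k H)
  act := LinearMap.mul' k k ∘ₗ TensorProduct.map Coalgebra.counit LinearMap.id

/-- The action of `H` on a tensor product: the braiding of `H` with `V ⊗ W` followed by the counit
of `H`. See `tensorAct_tmul` for the explicit formula. -/
noncomputable def tensorAct (X : PreYD k H V) (Y : PreYD k H W) :
    H ⊗[k] (V ⊗[k] W) →ₗ[k] V ⊗[k] W :=
  (TensorProduct.rid k (V ⊗[k] W)).toLinearMap ∘ₗ
    TensorProduct.map LinearMap.id Coalgebra.counit ∘ₗ
    assocCInv X.coact Y.coact Coalgebra.comul ∘ₗ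
    TensorProduct.map LinearMap.id (braid Coalgebra.comul Y.act) ∘ₗ
    assocC X.coact Coalgebra.comul Y.coact ∘ₗ
    TensorProduct.map (braid Coalgebra.comul X.act) LinearMap.id ∘ₗ
    assocCInv Coalgebra.comul X.coact Y.coact

/-- `h ▷ (v ⊗ w) = ω(h₁ ⊗ v₋₁ ⊗ w₋₂) ω⁻¹((h₂ ▷ v₀)₋₂ ⊗ h₃ ⊗ w₋₁)
ω((h₂ ▷ v₀)₋₁ ⊗ (h₄ ▷ w₀)₋₁ ⊗ h₅) (h₂ ▷ v₀)₀ ⊗ (h₄ ▷ w₀)₀` -/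
theorem tensorAct_tmul (X : PreYD k H V) (Y : PreYD k H W) (h : H) (v : V) (w : W) :
    tensorAct X Y (h ⊗ₜ[k] (v ⊗ₜ[k] w)) =
      sw (Δ k h) fun h₁ h' => sw (X.coact v) fun v₁ v₀ => sw (Y.coact w) fun w₂ w' =>
      sw (Δ k h') fun h₂ h' =>
      sw (X.coact (X.act (h₂ ⊗ₜ[k] v₀))) fun x₂ x' => sw (Δ k h') fun h₃ h' =>
      sw (Y.coact w') fun w₁ w₀ =>
      sw (Δ k h') fun h₄ h₅ =>
      sw (X.coact x') fun x₁ x₀ => sw (Y.coact (Y.act (h₄ ⊗ₜ[k] w₀))) fun y₁ y₀ =>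
        (om k h₁ v₁ w₂ * omInv k x₂ h₃ w₁ * om k x₁ y₁ h₅) • (x₀ ⊗ₜ[k] y₀) := by
  have key : ∀ (g : H →ₗ[k] k) (h : H) (z : V ⊗[k] W),
      (sw (Coalgebra.comul (R := k) h) fun a b => g a • (Coalgebra.counit (R := k) b • z)) =
        g h • z := by
    intro g h z
    have h1 := congrArg (fun t => TensorProduct.rid k k (LinearMap.rTensor k g t))
      (Coalgebra.lTensor_counit_comul (R := k) h)
    simp only [LinearMap.rTensor_tmul, TensorProduct.rid_tmul, one_smul] at h1
    rw [← h1]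
    conv_rhs => rw [eq_sw (Coalgebra.comul h)]
    simp only [map_sw]
    simp [sw, Finset.sum_smul, smul_smul, mul_comm]
  have key2 : ∀ (x y : H) (h : H) (z : V ⊗[k] W),
      (sw (Coalgebra.comul (R := k) h) fun a b =>
        DualQuasiBialgebra.ω (k := k) ((x ⊗ₜ[k] y) ⊗ₜ[k] a) • (Coalgebra.counit (R := k) b • z)) =
        DualQuasiBialgebra.ω (k := k) ((x ⊗ₜ[k] y) ⊗ₜ[k] h) • z := fun x y =>
    key (DualQuasiBialgebra.ω (k := k) ∘ₗ TensorProduct.mk k _ _ (x ⊗ₜ[k] y))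
  simp only [tensorAct, assocC, assocCInv, LinearMap.comp_apply, LinearEquiv.coe_coe,
    TensorProduct.assoc_symm_tmul, twist_tmul, map_sw, map_smul, TensorProduct.map_tmul, braid_tmul,
    sw_tmul, tmul_sw, TensorProduct.assoc_tmul, LinearMap.id_apply, TensorProduct.rid_tmul, key2]
  simp only [smul_sw, smul_smul, mul_assoc]

/-- The tensor product of two Yetter–Drinfeld modules. -/
noncomputable def tensorYD (X : PreYD k H V) (Y : PreYD k H W) : PreYD k H (V ⊗[k] W) where
  coact := tensorCoaction X.coact Y.coact
  act := tensorAct X Y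

/-- The associativity constraint `(V ⊗ W) ⊗ U ⟶ V ⊗ (W ⊗ U)`. -/
noncomputable abbrev aYD {U : Type*} [AddCommGroup U] [Module k U]
    (X : PreYD k H V) (Y : PreYD k H W) (Z : PreYD k H U) :
    (V ⊗[k] W) ⊗[k] U →ₗ[k] V ⊗[k] (W ⊗[k] U) :=
  assocC X.coact Y.coact Z.coact

/-- The inverse of the associativity constraint. -/
noncomputable abbrev aInvYD {U : Type*} [AddCommGroup U] [Module k U]
    (X : PreYD k H V) (Y : PreYD k H W) (Z : PreYD k H U) :
    V ⊗[k] (W ⊗[k] U) →ₗ[k] (V ⊗[k] W) ⊗[k] U :=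
  assocCInv X.coact Y.coact Z.coact

/-- The pre-braiding `V ⊗ W ⟶ W ⊗ V`, `v ⊗ w ↦ (v₋₁ ▷ w) ⊗ v₀`. -/
noncomputable abbrev cYD (X : PreYD k H V) (Y : PreYD k H W) : V ⊗[k] W →ₗ[k] W ⊗[k] V :=
  braid X.coact Y.act

/-- The comultiplication of the tensor square of a coalgebra `(X, D)` in the pre-braided category:
`a⁻¹ ∘ (X ⊗ a) ∘ (X ⊗ (c ⊗ X)) ∘ (X ⊗ a⁻¹) ∘ a ∘ (D ⊗ D)`. -/
noncomputable def comulSquare (X : PreYD k H V) (D : V →ₗ[k] V ⊗[k] V) :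
    V ⊗[k] V →ₗ[k] (V ⊗[k] V) ⊗[k] (V ⊗[k] V) :=
  aInvYD X X (tensorYD X X) ∘ₗ
    TensorProduct.map LinearMap.id (aYD X X X) ∘ₗ
    TensorProduct.map LinearMap.id (TensorProduct.map (cYD X X) LinearMap.id) ∘ₗ
    TensorProduct.map LinearMap.id (aInvYD X X X) ∘ₗ
    aYD X X (tensorYD X X) ∘ₗ
    TensorProduct.map D D

end YD

/-- A bialgebra in the pre-braided monoidal category of Yetter–Drinfeld modules over `H`. -/
structure YDBialgebra (k : Type u) (H : Type v) (R : Type w) [Field k] [AddCommGroup H] [Module k H]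
    [DualQuasiBialgebra k H] [AddCommGroup R] [Module k R] extends YDModule k H R where
  /-- the multiplication `m_R` -/
  mul : R ⊗[k] R →ₗ[k] R
  /-- the unit `u_R` -/
  unit : k →ₗ[k] R
  /-- the comultiplication `Δ_R` -/
  comul : R →ₗ[k] R ⊗[k] R
  /-- the counit `ε_R` -/
  counit : R →ₗ[k] k
  mul_hom : IsYDHom (tensorYD toPreYD toPreYD) toPreYD mul
  unit_hom : IsYDHom (unitYD k H) toPreYD unit
  comul_hom : IsYDHom toPreYD (tensorYD toPreYD toPreYD) comul
  counit_hom : IsYDHom toPreYD (unitYD k H) counit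
  mul_assoc : mul ∘ₗ TensorProduct.map mul LinearMap.id =
    mul ∘ₗ TensorProduct.map LinearMap.id mul ∘ₗ aYD toPreYD toPreYD toPreYD
  one_mul : mul ∘ₗ TensorProduct.map unit LinearMap.id = (TensorProduct.lid k R).toLinearMap
  mul_one : mul ∘ₗ TensorProduct.map LinearMap.id unit = (TensorProduct.rid k R).toLinearMap
  comul_coassoc : aYD toPreYD toPreYD toPreYD ∘ₗ TensorProduct.map comul LinearMap.id ∘ₗ comul =
    TensorProduct.map LinearMap.id comul ∘ₗ comul
  counit_comul : (TensorProduct.lid k R).toLinearMap ∘ₗ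
    TensorProduct.map counit LinearMap.id ∘ₗ comul = LinearMap.id
  comul_counit : (TensorProduct.rid k R).toLinearMap ∘ₗ
    TensorProduct.map LinearMap.id counit ∘ₗ comul = LinearMap.id
  comul_mul : comul ∘ₗ mul = TensorProduct.map mul mul ∘ₗ comulSquare toPreYD comul
  counit_mul : counit ∘ₗ mul = LinearMap.mul' k k ∘ₗ TensorProduct.map counit counit
  comul_unit : comul ∘ₗ unit =
    TensorProduct.map unit unit ∘ₗ (TensorProduct.lid k k).symm.toLinearMap
  counit_unit : counit ∘ₗ unit = LinearMap.id

end DQB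

open DQB

/-! Left `H`-comodules form a monoidal category whose associativity constraint is the action of
`ω⁻¹`: invertibility of `ω` makes it invertible, quasi-associativity of `m` makes it colinear, and
the 3-cocycle condition is the pentagon. A Yetter–Drinfeld module `R` carries maps `c_L : L ⊗ R ⟶ R
⊗ L`, natural in the comodule `L`. The compatibility axiom says that `c_L` is colinear
(`isColinear_braid`), the formula for `(hl) ▷ v` is the hexagon in `L` (`braid_tensorCoaction`), and
the action on a tensor product is defined so that the hexagon in `R` holds (`braid_tensorAct`).

So if `R` is a bialgebra, the functor `F = R ⊗ -` on comodules is lax monoidal (`mulMap_assoc`) and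
a comonad (`comulMap_coassoc`) whose comultiplication respects the lax structure
(`comulMap_mulMap`). These are facts about a half-braided object of any monoidal category and are
proved there by coherence, without Sweedler formulas.

The bosonization is `F(H)`, for `H` the regular comodule. Its product is `F(H) ⊗ F(H) ⟶ F(H ⊗ H)`
followed by `F(m)`. Its coproduct is the comonad map `F(H) ⟶ F(F(H))` followed by `expand`, which
splits off the coaction of the inner `F(H)`. The link between functor and vector space is given by
the matrix coefficients `x ↦ ξ(x₀) x₋₁`: they are comodule maps into `H`, and contractions with
functionals `ξ` separate tensors. After such a contraction, an identity about the coproduct becomes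
an instance of naturality of the structure of `F` (`bosComul_coassoc`, `expand_mulMap`,
`bosComul_bosMul`). The same device extends the Yetter–Drinfeld axioms, which concern elements of
`H`, to all comodules.

The reassociator of `R # H` is `ω` pulled back along `π`, which is a multiplicative coalgebra map;
hence its invertibility, cocycle and unit conditions are inherited. Quasi-associativity is lax
associativity of `F` at `H, H, H` combined with quasi-associativity of `H`; the factor `ω⁻¹` is
carried across the threefold product by `mulMap_translate`. -/

namespace DQB

/-! ### Half-braidings in a monoidal category -/

section HalfBraiding

open CategoryTheory MonoidalCategory

/-- A half-braiding of the object `R`, no invertibility being imposed. -/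
structure HalfBraid {C : Type u} [Category.{v} C] [MonoidalCategory C] (R : C) where
  /-- the half-braiding -/
  c : ∀ X : C, X ⊗ R ⟶ R ⊗ X
  nat : ∀ {X Y : C} (f : X ⟶ Y), f ▷ R ≫ c Y = c X ≫ R ◁ f
  tensor : ∀ X Y : C, c (X ⊗ Y) =
    (α_ X Y R).hom ≫ X ◁ c Y ≫ (α_ X R Y).inv ≫ c X ▷ Y ≫ (α_ R X Y).hom

namespace HalfBraid
variable {C : Type u} [Category.{v} C] [MonoidalCategory C] {R : C} (B : HalfBraid R)

/-- The half-braiding of `R ⊗ R`. -/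
def c₂ (X : C) : X ⊗ (R ⊗ R) ⟶ (R ⊗ R) ⊗ X :=
  (α_ X R R).inv ≫ B.c X ▷ R ≫ (α_ R X R).hom ≫ R ◁ B.c X ≫ (α_ R R X).inv

/-- The interchange of `L` and the second factor `R`. -/
def T (L M : C) : (R ⊗ L) ⊗ (R ⊗ M) ⟶ (R ⊗ R) ⊗ (L ⊗ M) :=
  (α_ R L (R ⊗ M)).hom ≫ R ◁ (α_ L R M).inv ≫ R ◁ (B.c L ▷ M) ≫ R ◁ (α_ R L M).hom ≫
    (α_ R R (L ⊗ M)).inv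

/-- If `R` is an algebra, then `R ⊗ -` is lax monoidal. -/
theorem T_assoc (L M N : C) (μ : R ⊗ R ⟶ R) (hμ : ∀ X, X ◁ μ ≫ B.c X = B.c₂ X ≫ μ ▷ X)
    (hassoc : μ ▷ R ≫ μ = (α_ R R R).hom ≫ R ◁ μ ≫ μ) :
    (B.T L M ≫ μ ▷ (L ⊗ M)) ▷ (R ⊗ N) ≫ (B.T (L ⊗ M) N ≫ μ ▷ _) ≫ R ◁ (α_ L M N).hom =
      (α_ _ _ _).hom ≫ (R ⊗ L) ◁ (B.T M N ≫ μ ▷ _) ≫ (B.T L (M ⊗ N) ≫ μ ▷ _) := by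
  calc _ = 𝟙 _ ⊗≫ R ◁ B.c L ▷ M ▷ R ▷ N ⊗≫ ((μ ▷ ((L ⊗ M) ⊗ R)) ≫ R ◁ B.c (L ⊗ M)) ▷ N ⊗≫
          μ ▷ (L ⊗ M ⊗ N) := by
        simp only [T]; monoidal
    -- The first `μ` and `c_{L ⊗ M}` act on disjoint tensor factors, so `μ` moves behind it and
    -- meets the second `μ`.
    _ = 𝟙 _ ⊗≫ R ◁ B.c L ▷ M ▷ R ▷ N ⊗≫ (R ⊗ R) ◁ B.c (L ⊗ M) ▷ N ⊗≫
          (μ ▷ R ≫ μ) ▷ (L ⊗ M ⊗ N) := by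
        rw [← whisker_exchange]; monoidal
    -- Associativity of `μ`, and the hexagon for `c_{L ⊗ M}`.
    _ = 𝟙 _ ⊗≫ R ◁ B.c L ▷ M ▷ R ▷ N ⊗≫ (R ⊗ R) ◁ L ◁ B.c M ▷ N ⊗≫ (R ⊗ R) ◁ B.c L ▷ M ▷ N ⊗≫
          (R ◁ μ ≫ μ) ▷ (L ⊗ M ⊗ N) := by
        rw [hassoc, B.tensor]; monoidal
    _ = 𝟙 _ ⊗≫ R ◁ (B.c L ▷ (M ⊗ R) ≫ (R ⊗ L) ◁ B.c M) ▷ N ⊗≫ (R ⊗ R) ◁ B.c L ▷ M ▷ N ⊗≫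
          (R ◁ μ ≫ μ) ▷ (L ⊗ M ⊗ N) := by
        monoidal
    -- Once `c_M` is moved to the front, the two copies of `c_L` are adjacent and form the
    -- half-braiding of `R ⊗ R`, past which `μ` can slide.
    _ = 𝟙 _ ⊗≫ R ◁ L ◁ R ◁ B.c M ▷ N ⊗≫ R ◁ (B.c₂ L ≫ μ ▷ L) ▷ (M ⊗ N) ⊗≫ μ ▷ (L ⊗ M ⊗ N) := by
        rw [← whisker_exchange, c₂]; monoidal
    _ = 𝟙 _ ⊗≫ R ◁ L ◁ R ◁ B.c M ▷ N ⊗≫ R ◁ L ◁ μ ▷ (M ⊗ N) ⊗≫ R ◁ B.c L ▷ (M ⊗ N) ⊗≫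
          μ ▷ (L ⊗ M ⊗ N) := by
        rw [← hμ]; monoidal
    _ = _ := by simp only [T]; monoidal

/-- If `R` is a bialgebra, then `R ⊗ L ⟶ R ⊗ (R ⊗ L)` is monoidal. -/
theorem T_comul (L M : C) (μ : R ⊗ R ⟶ R) (Δ : R ⟶ R ⊗ R)
    (hΔ : ∀ X, X ◁ Δ ≫ B.c₂ X = B.c X ≫ Δ ▷ X)
    (hμΔ : μ ≫ Δ = (Δ ⊗ₘ Δ) ≫ B.T R R ≫ (μ ⊗ₘ μ)) :
    (B.T L M ≫ μ ▷ (L ⊗ M)) ≫ Δ ▷ (L ⊗ M) ≫ (α_ R R (L ⊗ M)).hom =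
      ((Δ ▷ L ≫ (α_ R R L).hom) ⊗ₘ (Δ ▷ M ≫ (α_ R R M).hom)) ≫
        (B.T (R ⊗ L) (R ⊗ M) ≫ μ ▷ _) ≫ R ◁ (B.T L M ≫ μ ▷ _) := by
  calc _ = 𝟙 _ ⊗≫ R ◁ B.c L ▷ M ⊗≫ (μ ≫ Δ) ▷ (L ⊗ M) ⊗≫ 𝟙 _ := by
        simp only [T]; monoidal
    _ = 𝟙 _ ⊗≫ R ◁ B.c L ▷ M ⊗≫ (Δ ▷ R) ▷ (L ⊗ M) ⊗≫ R ◁ R ◁ (Δ ▷ L) ▷ M ⊗≫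
          R ◁ B.c R ▷ (R ⊗ L ⊗ M) ⊗≫ μ ▷ (R ⊗ R ⊗ L ⊗ M) ⊗≫ R ◁ μ ▷ (L ⊗ M) ⊗≫ 𝟙 _ := by
        rw [hμΔ, MonoidalCategory.tensorHom_def, MonoidalCategory.tensorHom_def]
        simp only [T]; monoidal
    _ = 𝟙 _ ⊗≫ (R ◁ B.c L ≫ Δ ▷ (R ⊗ L)) ▷ M ⊗≫ R ◁ R ◁ (Δ ▷ L) ▷ M ⊗≫ R ◁ B.c R ▷ (R ⊗ L ⊗ M) ⊗≫
          μ ▷ (R ⊗ R ⊗ L ⊗ M) ⊗≫ R ◁ μ ▷ (L ⊗ M) ⊗≫ 𝟙 _ := by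
        monoidal
    -- The left `Δ` moves in front of `c_L`, so that `c_L` is followed directly by the right `Δ` and
    -- `hΔ` applies.
    _ = 𝟙 _ ⊗≫ Δ ▷ L ▷ R ▷ M ⊗≫ R ◁ R ◁ (B.c L ≫ Δ ▷ L) ▷ M ⊗≫ R ◁ B.c R ▷ (R ⊗ L ⊗ M) ⊗≫
          μ ▷ (R ⊗ R ⊗ L ⊗ M) ⊗≫ R ◁ μ ▷ (L ⊗ M) ⊗≫ 𝟙 _ := by
        rw [whisker_exchange]; monoidal
    _ = 𝟙 _ ⊗≫ Δ ▷ L ▷ R ▷ M ⊗≫ R ◁ R ◁ L ◁ Δ ▷ M ⊗≫ R ◁ R ◁ B.c L ▷ R ▷ M ⊗≫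
          R ◁ ((R ⊗ R) ◁ B.c L ≫ B.c R ▷ (R ⊗ L)) ▷ M ⊗≫
          μ ▷ (R ⊗ R ⊗ L ⊗ M) ⊗≫ R ◁ μ ▷ (L ⊗ M) ⊗≫ 𝟙 _ := by
        rw [← hΔ, c₂]; monoidal
    _ = 𝟙 _ ⊗≫ Δ ▷ L ▷ R ▷ M ⊗≫ R ◁ R ◁ L ◁ Δ ▷ M ⊗≫ R ◁ R ◁ B.c L ▷ R ▷ M ⊗≫
          R ◁ B.c R ▷ L ▷ R ▷ M ⊗≫ (R ⊗ R) ◁ R ◁ B.c L ▷ M ⊗≫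
          μ ▷ (R ⊗ R ⊗ L ⊗ M) ⊗≫ R ◁ μ ▷ (L ⊗ M) ⊗≫ 𝟙 _ := by
        rw [whisker_exchange]; monoidal
    _ = 𝟙 _ ⊗≫ Δ ▷ L ▷ R ▷ M ⊗≫ R ◁ R ◁ L ◁ Δ ▷ M ⊗≫ R ◁ R ◁ B.c L ▷ R ▷ M ⊗≫
          R ◁ B.c R ▷ L ▷ R ▷ M ⊗≫ ((R ⊗ R) ◁ (R ◁ B.c L ▷ M) ≫ μ ▷ (R ⊗ (R ⊗ L) ⊗ M)) ⊗≫
          R ◁ μ ▷ (L ⊗ M) ⊗≫ 𝟙 _ := by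
        monoidal
    -- The first `c_L` and `c_R` are the two factors of `c_{R ⊗ L}`; the other `c_L` passes behind
    -- the outer `μ` and belongs to the inner product.
    _ = 𝟙 _ ⊗≫ Δ ▷ L ▷ R ▷ M ⊗≫ R ◁ R ◁ L ◁ Δ ▷ M ⊗≫ R ◁ B.c (R ⊗ L) ▷ (R ⊗ M) ⊗≫
          μ ▷ (R ⊗ L ⊗ R ⊗ M) ⊗≫
         R ◁ R ◁ B.c L ▷ M ⊗≫ R ◁ μ ▷ (L ⊗ M) ⊗≫ 𝟙 _ := by
        rw [whisker_exchange, B.tensor]; monoidal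
    _ = _ := by
        rw [MonoidalCategory.tensorHom_def]; simp only [T]; monoidal

/-- If `R` is a coalgebra, then `R ⊗ -` is a comonad. -/
theorem whisker_coassoc (L : C) (Δ : R ⟶ R ⊗ R) (hΔ : Δ ≫ Δ ▷ R ≫ (α_ R R R).hom = Δ ≫ R ◁ Δ) :
    (Δ ▷ L ≫ (α_ R R L).hom) ≫ R ◁ (Δ ▷ L ≫ (α_ R R L).hom) =
    (Δ ▷ L ≫ (α_ R R L).hom) ≫ (Δ ▷ (R ⊗ L) ≫ (α_ R R (R ⊗ L)).hom) := by
  calc _ = (Δ ≫ R ◁ Δ) ▷ L ⊗≫ 𝟙 _ := by monoidal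
    _ = _ := by rw [← hΔ]; monoidal

end HalfBraid

end HalfBraiding

/-! ### Comodules over a coalgebra -/

section Comodules

variable {k : Type*} [Field k] {A D E F U V W U' V' W' : Type*}
  [AddCommGroup A] [Module k A] [AddCommGroup D] [Module k D]
  [AddCommGroup E] [Module k E] [AddCommGroup F] [Module k F]
  [AddCommGroup U] [Module k U] [AddCommGroup V] [Module k V] [AddCommGroup W] [Module k W]
  [AddCommGroup U'] [Module k U'] [AddCommGroup V'] [Module k V'] [AddCommGroup W'] [Module k W']

/-- A coassociative and counital left coaction of the coalgebra `E`. -/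
structure IsComodule [Coalgebra k E] (ρ : V →ₗ[k] E ⊗[k] V) : Prop where
  coassoc : (TensorProduct.assoc k E E V).toLinearMap ∘ₗ
      TensorProduct.map Coalgebra.comul LinearMap.id ∘ₗ ρ = TensorProduct.map LinearMap.id ρ ∘ₗ ρ
  counit : (TensorProduct.lid k V).toLinearMap ∘ₗ
      TensorProduct.map Coalgebra.counit LinearMap.id ∘ₗ ρ = LinearMap.id

/-- `f` respects the coactions. -/
def IsColinear (ρ : V →ₗ[k] E ⊗[k] V) (ρ' : V' →ₗ[k] E ⊗[k] V') (f : V →ₗ[k] V') : Prop :=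
  ρ' ∘ₗ f = TensorProduct.map LinearMap.id f ∘ₗ ρ

/-- `v ↦ φ(v₋₁) v₀` -/
noncomputable def coactBy (ρ : V →ₗ[k] E ⊗[k] V) (φ : E →ₗ[k] k) : V →ₗ[k] V :=
  (TensorProduct.lid k V).toLinearMap ∘ₗ TensorProduct.map φ LinearMap.id ∘ₗ ρ

/-- The outer tensor product of two coactions. -/
noncomputable def outer (ρ : U →ₗ[k] E ⊗[k] U) (ρ' : V →ₗ[k] F ⊗[k] V) :
    U ⊗[k] V →ₗ[k] (E ⊗[k] F) ⊗[k] (U ⊗[k] V) :=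
  (TensorProduct.tensorTensorTensorComm k E U F V).toLinearMap ∘ₗ TensorProduct.map ρ ρ'

/-- The coaction along a map of coalgebras. -/
noncomputable def push (p : E →ₗ[k] F) (ρ : V →ₗ[k] E ⊗[k] V) : V →ₗ[k] F ⊗[k] V :=
  TensorProduct.map p LinearMap.id ∘ₗ ρ

theorem IsColinear.apply {ρ : V →ₗ[k] E ⊗[k] V} {ρ' : V' →ₗ[k] E ⊗[k] V'} {f : V →ₗ[k] V'}
    (h : IsColinear ρ ρ' f) (x : V) : ρ' (f x) = TensorProduct.map LinearMap.id f (ρ x) :=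
  LinearMap.congr_fun h x

theorem IsColinear.id (ρ : V →ₗ[k] E ⊗[k] V) : IsColinear ρ ρ LinearMap.id := by
  simp [IsColinear]

theorem IsColinear.comp {ρ : U →ₗ[k] E ⊗[k] U} {ρ' : V →ₗ[k] E ⊗[k] V} {ρ'' : W →ₗ[k] E ⊗[k] W}
    {g : V →ₗ[k] W} {f : U →ₗ[k] V} (hg : IsColinear ρ' ρ'' g) (hf : IsColinear ρ ρ' f) :
    IsColinear ρ ρ'' (g ∘ₗ f) := by
  unfold IsColinear at *
  rw [← LinearMap.comp_assoc, hg, LinearMap.comp_assoc, hf, ← LinearMap.comp_assoc,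
    ← TensorProduct.map_comp, LinearMap.id_comp]

theorem IsColinear.symm {ρ : U →ₗ[k] E ⊗[k] U} {ρ' : V →ₗ[k] E ⊗[k] V} {f : U →ₗ[k] V}
    {g : V →ₗ[k] U} (hf : IsColinear ρ ρ' f) (hfg : f ∘ₗ g = LinearMap.id)
    (hgf : g ∘ₗ f = LinearMap.id) : IsColinear ρ' ρ g := by
  unfold IsColinear at *
  calc ρ ∘ₗ g = TensorProduct.map LinearMap.id (g ∘ₗ f) ∘ₗ ρ ∘ₗ g := by simp [hgf]
    _ = TensorProduct.map LinearMap.id g ∘ₗ (TensorProduct.map LinearMap.id f ∘ₗ ρ) ∘ₗ g := by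
      rw [← LinearMap.id_comp (LinearMap.id : E →ₗ[k] E), TensorProduct.map_comp]; rfl
    _ = TensorProduct.map LinearMap.id g ∘ₗ ρ' ∘ₗ (f ∘ₗ g) := by rw [← hf]; rfl
    _ = _ := by rw [hfg, LinearMap.comp_id]

/-- `v ↦ v₋₂ φ(v₋₁) ⊗ v₀` and `v ↦ φ(v₋₂) v₋₁ ⊗ v₀`, in terms of the convolution. -/
theorem IsComodule.push_conv_right [Coalgebra k E] {ρ : V →ₗ[k] E ⊗[k] V} (h : IsComodule ρ)
    (p : E →ₗ[k] A) (φ : E →ₗ[k] k) :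
    push (conv (TensorProduct.rid k A).toLinearMap p φ) ρ =
      TensorProduct.map LinearMap.id (coactBy ρ φ) ∘ₗ push p ρ := by
  ext x
  have key := congrArg (TensorProduct.map p
    ((TensorProduct.lid k V).toLinearMap ∘ₗ TensorProduct.map φ LinearMap.id))
    (LinearMap.congr_fun h.coassoc x)
  simp only [LinearMap.comp_apply, LinearEquiv.coe_coe] at key
  simp only [coactBy, push, LinearMap.comp_apply]
  convert! key using 1
  · induction ρ x using TensorProduct.induction_on with
    | zero => simp
    | tmul e v =>
      simp only [TensorProduct.map_tmul, conv, LinearMap.comp_apply, LinearMap.id_apply]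
      induction Coalgebra.comul (R := k) e using TensorProduct.induction_on with
      | zero => simp
      | tmul a b => simp [TensorProduct.smul_tmul]
      | add a b ha hb => simp_all [TensorProduct.add_tmul]
    | add a b ha hb => simp_all
  · induction ρ x using TensorProduct.induction_on with
    | zero => simp
    | tmul e v => simp
    | add a b ha hb => simp_all

/-- Coassociativity, with `φ` applied to the first leg and `p` to the second. Together with
`push_conv_right` it turns an identity `p ∗ φ = φ ∗ q` into colinearity of `coactBy ρ φ`. -/
theorem IsComodule.push_conv_left [Coalgebra k E] {ρ : V →ₗ[k] E ⊗[k] V} (h : IsComodule ρ)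
    (p : E →ₗ[k] A) (φ : E →ₗ[k] k) :
    push (conv (TensorProduct.lid k A).toLinearMap φ p) ρ = push p ρ ∘ₗ coactBy ρ φ := by
  ext x
  have key := congrArg ((TensorProduct.lid k (A ⊗[k] V)).toLinearMap ∘ₗ
    TensorProduct.map φ (TensorProduct.map p LinearMap.id)) (LinearMap.congr_fun h.coassoc x)
  simp only [LinearMap.comp_apply, LinearEquiv.coe_coe] at key
  simp only [coactBy, push, LinearMap.comp_apply]
  convert! key using 1
  · induction ρ x using TensorProduct.induction_on with
    | zero => simp
    | tmul e v =>
      simp only [TensorProduct.map_tmul, conv, LinearMap.comp_apply, LinearMap.id_apply]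
      induction Coalgebra.comul (R := k) e using TensorProduct.induction_on with
      | zero => simp
      | tmul a b => simp [TensorProduct.smul_tmul']
      | add a b ha hb => simp_all [TensorProduct.add_tmul]
    | add a b ha hb => simp_all
  · induction ρ x using TensorProduct.induction_on with
    | zero => simp
    | tmul e v => simp
    | add a b ha hb => simp_all

/-- A left comodule is a right module over the convolution algebra of functionals, whence the
reversed order. This turns the axioms on `ω` into identities between maps. -/
theorem IsComodule.coactBy_conv [Coalgebra k E] {ρ : V →ₗ[k] E ⊗[k] V} (h : IsComodule ρ)
    (φ ψ : E →ₗ[k] k) :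
    coactBy ρ (conv (LinearMap.mul' k k) φ ψ) = coactBy ρ ψ ∘ₗ coactBy ρ φ := by
  have := h.push_conv_left ψ φ
  rw [show (TensorProduct.lid k k).toLinearMap = LinearMap.mul' k k by ext; simp] at this
  ext x
  simpa [coactBy, push] using congrArg (TensorProduct.lid k V) (LinearMap.congr_fun this x)

theorem IsComodule.coactBy_counit [Coalgebra k E] {ρ : V →ₗ[k] E ⊗[k] V} (h : IsComodule ρ) :
    coactBy ρ Coalgebra.counit = LinearMap.id := h.counit

theorem IsComodule.push [Coalgebra k E] [Coalgebra k F] {ρ : V →ₗ[k] E ⊗[k] V} (h : IsComodule ρ)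
    (p : E →ₗc[k] F) : IsComodule (push p.toLinearMap ρ) where
  coassoc := by
    ext x
    have key := congrArg (TensorProduct.map p.toLinearMap
      (TensorProduct.map p.toLinearMap LinearMap.id)) (LinearMap.congr_fun h.coassoc x)
    simp only [LinearMap.comp_apply, LinearEquiv.coe_coe] at key
    simp only [DQB.push, LinearMap.comp_apply]
    convert! key using 1
    · induction ρ x using TensorProduct.induction_on with
      | zero => simp
      | tmul e v =>
        have := LinearMap.congr_fun p.map_comp_comul e
        simp only [LinearMap.comp_apply] at this
        simp only [TensorProduct.map_tmul, LinearMap.id_apply, ← this]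
        induction Coalgebra.comul (R := k) e using TensorProduct.induction_on with
        | zero => simp
        | tmul a b => simp
        | add a b ha hb => simp_all [TensorProduct.add_tmul]
      | add a b ha hb => simp_all
    · induction ρ x using TensorProduct.induction_on with
      | zero => simp
      | tmul e v => simp
      | add a b ha hb => simp_all
  counit := by
    ext x
    have key := LinearMap.congr_fun h.counit x
    simp only [LinearMap.comp_apply, LinearEquiv.coe_coe] at key
    simp only [DQB.push, LinearMap.comp_apply]
    convert! key using 1
    induction ρ x using TensorProduct.induction_on with
    | zero => simp
    | tmul e v => simp
    | add a b ha hb => simp_all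

theorem IsComodule.outer [Coalgebra k E] [Coalgebra k F] {ρ : U →ₗ[k] E ⊗[k] U}
    {ρ' : V →ₗ[k] F ⊗[k] V} (h : IsComodule ρ) (h' : IsComodule ρ') :
    IsComodule (outer ρ ρ') where
  coassoc := by
    ext x y
    -- The tensor product of the two coassociativity identities, with the legs regrouped so that the
    -- factors of `E ⊗ F` stand together.
    have key := congrArg (TensorProduct.map LinearMap.id
        (TensorProduct.tensorTensorTensorComm k E U F V).toLinearMap ∘ₗ
        (TensorProduct.tensorTensorTensorComm k E (E ⊗[k] U) F (F ⊗[k] V)).toLinearMap)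
      (congrArg₂ (· ⊗ₜ[k] ·) (LinearMap.congr_fun h.coassoc x) (LinearMap.congr_fun h'.coassoc y))
    simp only [LinearMap.comp_apply, LinearEquiv.coe_coe] at key
    simp only [DQB.outer, LinearMap.comp_apply, TensorProduct.AlgebraTensorModule.curry_apply,
      LinearMap.restrictScalars_self, TensorProduct.curry_apply, TensorProduct.map_tmul,
      LinearEquiv.coe_coe]
    convert! key using 1
    · induction ρ x using TensorProduct.induction_on with
      | zero => simp
      | tmul e v =>
        induction ρ' y using TensorProduct.induction_on with
        | zero => simp
        | tmul e' v' =>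
          simp only [TensorProduct.map_tmul, LinearMap.id_apply, TensorProduct.comul_tmul,
            TensorProduct.tensorTensorTensorComm_tmul]
          induction Coalgebra.comul (R := k) e using TensorProduct.induction_on with
          | zero => simp
          | tmul a b =>
            induction Coalgebra.comul (R := k) e' using TensorProduct.induction_on with
            | zero => simp
            | tmul a b => simp
            | add a b ha hb => simp_all [TensorProduct.add_tmul, TensorProduct.tmul_add]
          | add a b ha hb => simp_all [TensorProduct.add_tmul]
        | add a b ha hb => simp_all [TensorProduct.tmul_add]
      | add a b ha hb => simp_all [TensorProduct.add_tmul]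
    · induction ρ x using TensorProduct.induction_on with
      | zero => simp
      | tmul e v =>
        induction ρ' y using TensorProduct.induction_on with
        | zero => simp
        | tmul e' v' => simp
        | add a b ha hb => simp_all [TensorProduct.tmul_add]
      | add a b ha hb => simp_all [TensorProduct.add_tmul]
  counit := by
    ext x y
    have key := congrArg₂ (· ⊗ₜ[k] ·) (LinearMap.congr_fun h.counit x)
      (LinearMap.congr_fun h'.counit y)
    simp only [LinearMap.comp_apply, LinearEquiv.coe_coe, LinearMap.id_apply] at key
    simp only [DQB.outer, LinearMap.comp_apply, TensorProduct.AlgebraTensorModule.curry_apply,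
      LinearMap.restrictScalars_self, TensorProduct.curry_apply, TensorProduct.map_tmul,
      LinearEquiv.coe_coe, LinearMap.id_apply]
    convert! key using 1
    induction ρ x using TensorProduct.induction_on with
    | zero => simp
    | tmul e v =>
      induction ρ' y using TensorProduct.induction_on with
      | zero => simp
      | tmul e' v' => simp [TensorProduct.smul_tmul, TensorProduct.tmul_smul, smul_smul, mul_comm]
      | add a b ha hb => simp_all [TensorProduct.tmul_add]
    | add a b ha hb => simp_all [TensorProduct.add_tmul]

theorem isComodule_comul [Coalgebra k E] :
    IsComodule (Coalgebra.comul : E →ₗ[k] E ⊗[k] E) where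
  coassoc := Coalgebra.coassoc
  counit := by
    ext x
    have := congrArg (TensorProduct.lid k E) (Coalgebra.rTensor_counit_comul (R := k) x)
    rwa [TensorProduct.lid_tmul, one_smul] at this

/-- `f` respects the coactions up to the linear map `e` of the coefficients. -/
def IsColinearAlong (e : E →ₗ[k] F) (ρ : V →ₗ[k] E ⊗[k] V) (ρ' : V' →ₗ[k] F ⊗[k] V')
    (f : V →ₗ[k] V') : Prop :=
  ρ' ∘ₗ f = TensorProduct.map e f ∘ₗ ρ

theorem IsColinear.along {ρ : V →ₗ[k] E ⊗[k] V} {ρ' : V' →ₗ[k] E ⊗[k] V'} {f : V →ₗ[k] V'}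
    (h : IsColinear ρ ρ' f) : IsColinearAlong LinearMap.id ρ ρ' f := h

theorem isColinearAlong_push (p : E →ₗ[k] F) (ρ : V →ₗ[k] E ⊗[k] V) :
    IsColinearAlong p ρ (push p ρ) LinearMap.id := rfl

theorem IsColinearAlong.apply {e : E →ₗ[k] F} {ρ : V →ₗ[k] E ⊗[k] V} {ρ' : V' →ₗ[k] F ⊗[k] V'}
    {f : V →ₗ[k] V'} (h : IsColinearAlong e ρ ρ' f) (x : V) :
    ρ' (f x) = TensorProduct.map e f (ρ x) :=
  LinearMap.congr_fun h x

theorem IsColinearAlong.comp {e : E →ₗ[k] F} {e' : F →ₗ[k] D} {ρ : U →ₗ[k] E ⊗[k] U}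
    {ρ' : V →ₗ[k] F ⊗[k] V} {ρ'' : W →ₗ[k] D ⊗[k] W} {g : V →ₗ[k] W} {f : U →ₗ[k] V}
    (hg : IsColinearAlong e' ρ' ρ'' g) (hf : IsColinearAlong e ρ ρ' f) :
    IsColinearAlong (e' ∘ₗ e) ρ ρ'' (g ∘ₗ f) := by
  unfold IsColinearAlong at *
  rw [← LinearMap.comp_assoc, hg, LinearMap.comp_assoc, hf, ← LinearMap.comp_assoc,
    ← TensorProduct.map_comp]

theorem IsColinearAlong.outer {D' : Type*} [AddCommGroup D'] [Module k D']
    {e : E →ₗ[k] D} {e' : F →ₗ[k] D'} {ρ : U →ₗ[k] E ⊗[k] U} {ρ' : U' →ₗ[k] D ⊗[k] U'}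
    {f : U →ₗ[k] U'} {τ : V →ₗ[k] F ⊗[k] V} {τ' : V' →ₗ[k] D' ⊗[k] V'} {g : V →ₗ[k] V'}
    (hf : IsColinearAlong e ρ ρ' f) (hg : IsColinearAlong e' τ τ' g) :
    IsColinearAlong (TensorProduct.map e e') (outer ρ τ) (outer ρ' τ') (TensorProduct.map f g) := by
  unfold IsColinearAlong DQB.outer at *
  rw [LinearMap.comp_assoc, ← TensorProduct.map_comp, hf, hg, TensorProduct.map_comp,
    ← LinearMap.comp_assoc, ← LinearMap.comp_assoc]
  congr 1
  ext; simp

/-- A functional is pulled back along the map of coefficients. With `e = id` this is naturality of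
the constraints; with `e` built from `m` and rebracketings it brings constraints of tensor products
to a common `H ⊗ H ⊗ H ⊗ H`. -/
theorem coactBy_comp {e : E →ₗ[k] F} {ρ : V →ₗ[k] E ⊗[k] V} {ρ' : V' →ₗ[k] F ⊗[k] V'}
    {f : V →ₗ[k] V'} (h : IsColinearAlong e ρ ρ' f) (φ : F →ₗ[k] k) :
    coactBy ρ' φ ∘ₗ f = f ∘ₗ coactBy ρ (φ ∘ₗ e) := by
  ext x
  simp only [coactBy, LinearMap.comp_apply, h.apply]
  induction ρ x using TensorProduct.induction_on with
  | zero => simp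
  | tmul a b => simp
  | add a b ha hb => simp_all

theorem push_comp {e : E →ₗ[k] F} {ρ : V →ₗ[k] E ⊗[k] V} {ρ' : V' →ₗ[k] F ⊗[k] V'}
    {f : V →ₗ[k] V'} (h : IsColinearAlong e ρ ρ' f) (p : F →ₗ[k] D) :
    push p ρ' ∘ₗ f = TensorProduct.map LinearMap.id f ∘ₗ push (p ∘ₗ e) ρ := by
  unfold push
  rw [LinearMap.comp_assoc, h, ← LinearMap.comp_assoc, ← LinearMap.comp_assoc,
    ← TensorProduct.map_comp, ← TensorProduct.map_comp]
  rfl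

theorem coactBy_natural {ρ : V →ₗ[k] E ⊗[k] V} {ρ' : V' →ₗ[k] E ⊗[k] V'} {f : V →ₗ[k] V'}
    (h : IsColinear ρ ρ' f) (φ : E →ₗ[k] k) : coactBy ρ' φ ∘ₗ f = f ∘ₗ coactBy ρ φ :=
  coactBy_comp h.along φ

theorem IsColinear.push {ρ : V →ₗ[k] E ⊗[k] V} {ρ' : V' →ₗ[k] E ⊗[k] V'} {f : V →ₗ[k] V'}
    (h : IsColinear ρ ρ' f) (p : E →ₗ[k] F) : IsColinear (push p ρ) (push p ρ') f :=
  push_comp h.along p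

theorem IsColinear.outer {ρ : U →ₗ[k] E ⊗[k] U} {ρ' : U' →ₗ[k] E ⊗[k] U'} {f : U →ₗ[k] U'}
    {τ : V →ₗ[k] F ⊗[k] V} {τ' : V' →ₗ[k] F ⊗[k] V'} {g : V →ₗ[k] V'}
    (hf : IsColinear ρ ρ' f) (hg : IsColinear τ τ' g) :
    IsColinear (outer ρ τ) (outer ρ' τ') (TensorProduct.map f g) := by
  have := hf.along.outer hg.along
  rwa [IsColinearAlong, TensorProduct.map_id] at this

/-- Rebracketing the spaces also rebrackets the coefficient coalgebra, so ordinary colinearity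
cannot express this. -/
theorem isColinearAlong_assoc (ρ : U →ₗ[k] D ⊗[k] U) (τ : V →ₗ[k] E ⊗[k] V)
    (θ : W →ₗ[k] F ⊗[k] W) :
    IsColinearAlong (TensorProduct.assoc k D E F).toLinearMap (outer (outer ρ τ) θ)
      (outer ρ (outer τ θ)) (TensorProduct.assoc k U V W).toLinearMap := by
  unfold IsColinearAlong
  ext x y z
  simp only [DQB.outer, LinearMap.comp_apply, TensorProduct.AlgebraTensorModule.curry_apply,
    LinearMap.restrictScalars_self, TensorProduct.curry_apply, TensorProduct.map_tmul,
    LinearEquiv.coe_coe, TensorProduct.assoc_tmul]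
  induction ρ x using TensorProduct.induction_on with
  | zero => simp
  | add a b ha hb => simp_all [TensorProduct.add_tmul]
  | tmul e v =>
    induction τ y using TensorProduct.induction_on with
    | zero => simp
    | add a b ha hb => simp_all [TensorProduct.add_tmul, TensorProduct.tmul_add]
    | tmul e' v' =>
      induction θ z using TensorProduct.induction_on with
      | zero => simp
      | add a b ha hb => simp_all [TensorProduct.tmul_add]
      | tmul e'' v'' => simp

theorem IsColinearAlong.symm {e : E ≃ₗ[k] F} {f : U ≃ₗ[k] V} {ρ : U →ₗ[k] E ⊗[k] U}
    {ρ' : V →ₗ[k] F ⊗[k] V} (h : IsColinearAlong e.toLinearMap ρ ρ' f.toLinearMap) :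
    IsColinearAlong e.symm.toLinearMap ρ' ρ f.symm.toLinearMap := by
  unfold IsColinearAlong
  ext x
  obtain ⟨y, rfl⟩ := f.surjective x
  have := h.apply y
  simp only [LinearEquiv.coe_coe] at this
  rw [LinearMap.comp_apply, LinearMap.comp_apply, LinearEquiv.coe_coe,
    LinearEquiv.symm_apply_apply, this, ← LinearMap.comp_apply, ← TensorProduct.map_comp]
  simp

/-- With a counit in one slot, the corresponding factor is left alone; this is how `ε ⊗ ω` and `ω ⊗
ε` become whiskered constraints. -/
theorem coactBy_outer (ρ : U →ₗ[k] E ⊗[k] U) (τ : V →ₗ[k] F ⊗[k] V) (φ : E →ₗ[k] k)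
    (ψ : F →ₗ[k] k) :
    coactBy (outer ρ τ) (LinearMap.mul' k k ∘ₗ TensorProduct.map φ ψ) =
      TensorProduct.map (coactBy ρ φ) (coactBy τ ψ) := by
  ext x y
  simp only [DQB.outer, coactBy, LinearMap.comp_apply,
    TensorProduct.AlgebraTensorModule.curry_apply, LinearMap.restrictScalars_self,
    TensorProduct.curry_apply, TensorProduct.map_tmul, LinearEquiv.coe_coe]
  induction ρ x using TensorProduct.induction_on with
  | zero => simp
  | add a b ha hb => simp_all [TensorProduct.add_tmul]
  | tmul e v =>
    induction τ y using TensorProduct.induction_on with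
    | zero => simp
    | add a b ha hb => simp_all [TensorProduct.tmul_add]
    | tmul e' v' => simp [TensorProduct.smul_tmul, TensorProduct.tmul_smul, smul_smul, mul_comm]

end Comodules

/-- The constraint is the action of a functional on `H ⊗ H ⊗ H` on an outer tensor product of
comodules, so that `coactBy_conv` and `coactBy_comp` apply to it. -/
theorem twist_eq {k H U V W : Type*} [Field k] [AddCommGroup H] [Module k H]
    [AddCommGroup U] [Module k U] [AddCommGroup V] [Module k V] [AddCommGroup W] [Module k W]
    (φ : (H ⊗[k] H) ⊗[k] H →ₗ[k] k) (ρU : U →ₗ[k] H ⊗[k] U) (ρV : V →ₗ[k] H ⊗[k] V)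
    (ρW : W →ₗ[k] H ⊗[k] W) : twist φ ρU ρV ρW = coactBy (outer (outer ρU ρV) ρW) φ := rfl

/-! ### The monoidal structure on left comodules -/

section Monoidal

open DualQuasiBialgebra

variable {k H : Type*} [Field k] [AddCommGroup H] [Module k H] [DualQuasiBialgebra k H]
  {U V W Y U' V' W' : Type*}
  [AddCommGroup U] [Module k U] [AddCommGroup V] [Module k V] [AddCommGroup W] [Module k W]
  [AddCommGroup Y] [Module k Y]
  [AddCommGroup U'] [Module k U'] [AddCommGroup V'] [Module k V'] [AddCommGroup W'] [Module k W']
  {ρU : U →ₗ[k] H ⊗[k] U} {ρV : V →ₗ[k] H ⊗[k] V} {ρW : W →ₗ[k] H ⊗[k] W}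
  {ρY : Y →ₗ[k] H ⊗[k] Y}
  {ρU' : U' →ₗ[k] H ⊗[k] U'} {ρV' : V' →ₗ[k] H ⊗[k] V'} {ρW' : W' →ₗ[k] H ⊗[k] W'}

theorem tensorCoaction_eq (ρU : U →ₗ[k] H ⊗[k] U) (ρV : V →ₗ[k] H ⊗[k] V) :
    tensorCoaction ρU ρV = push (m (k := k) (H := H)).toLinearMap (outer ρU ρV) := rfl

theorem IsComodule.tensor (hU : IsComodule ρU) (hV : IsComodule ρV) :
    IsComodule (tensorCoaction ρU ρV) := (hU.outer hV).push m

theorem IsColinear.tensor {f : U →ₗ[k] U'} {g : V →ₗ[k] V'} (hf : IsColinear ρU ρU' f)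
    (hg : IsColinear ρV ρV' g) :
    IsColinear (tensorCoaction ρU ρV) (tensorCoaction ρU' ρV') (TensorProduct.map f g) :=
  (hf.outer hg).push _

theorem isColinearAlong_tensor (ρU : U →ₗ[k] H ⊗[k] U) (ρV : V →ₗ[k] H ⊗[k] V) :
    IsColinearAlong (m (k := k) (H := H)).toLinearMap (outer ρU ρV) (tensorCoaction ρU ρV)
      LinearMap.id := rfl

theorem assocC_assocCInv (hU : IsComodule ρU) (hV : IsComodule ρV) (hW : IsComodule ρW) :
    assocC ρU ρV ρW ∘ₗ assocCInv ρU ρV ρW = LinearMap.id := by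
  have h := ((hU.outer hV).outer hW).coactBy_conv (ω (k := k) (H := H)) ωInv
  rw [ω_conv_ωInv, ((hU.outer hV).outer hW).coactBy_counit] at h
  refine LinearMap.ext fun x => ?_
  simpa [assocC, assocCInv, twist_eq] using
    congrArg (TensorProduct.assoc k U V W) (LinearMap.congr_fun h.symm
      ((TensorProduct.assoc k U V W).symm x))

theorem twist_ω_ωInv (hU : IsComodule ρU) (hV : IsComodule ρV) (hW : IsComodule ρW) :
    twist ω ρU ρV ρW ∘ₗ twist ωInv ρU ρV ρW = LinearMap.id := by
  have h := ((hU.outer hV).outer hW).coactBy_conv (ωInv (k := k) (H := H)) ω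
  rwa [ωInv_conv_ω, ((hU.outer hV).outer hW).coactBy_counit, eq_comm] at h

theorem assocCInv_assocC (hU : IsComodule ρU) (hV : IsComodule ρV) (hW : IsComodule ρW) :
    assocCInv ρU ρV ρW ∘ₗ assocC ρU ρV ρW = LinearMap.id := by
  ext1
  rw [← twist_ω_ωInv hU hV hW]
  ext
  simp [assocC, assocCInv]

theorem assocC_natural {f : U →ₗ[k] U'} {g : V →ₗ[k] V'} {h : W →ₗ[k] W'}
    (hf : IsColinear ρU ρU' f) (hg : IsColinear ρV ρV' g) (hh : IsColinear ρW ρW' h) :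
    assocC ρU' ρV' ρW' ∘ₗ TensorProduct.map (TensorProduct.map f g) h =
      TensorProduct.map f (TensorProduct.map g h) ∘ₗ assocC ρU ρV ρW := by
  rw [assocC, assocC, LinearMap.comp_assoc, twist_eq, twist_eq,
    coactBy_natural ((hf.outer hg).outer hh), ← LinearMap.comp_assoc, ← LinearMap.comp_assoc]
  congr 1
  ext; simp

theorem assocCInv_natural {f : U →ₗ[k] U'} {g : V →ₗ[k] V'} {h : W →ₗ[k] W'}
    (hf : IsColinear ρU ρU' f) (hg : IsColinear ρV ρV' g) (hh : IsColinear ρW ρW' h) :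
    assocCInv ρU' ρV' ρW' ∘ₗ TensorProduct.map f (TensorProduct.map g h) =
      TensorProduct.map (TensorProduct.map f g) h ∘ₗ assocCInv ρU ρV ρW := by
  rw [assocCInv, assocCInv, ← LinearMap.comp_assoc, twist_eq, twist_eq,
    ← coactBy_natural ((hf.outer hg).outer hh), LinearMap.comp_assoc, LinearMap.comp_assoc]
  congr 1
  ext; simp

/-- The coaction of `(U ⊗ V) ⊗ W`. -/
theorem tensorCoaction_left (ρU : U →ₗ[k] H ⊗[k] U) (ρV : V →ₗ[k] H ⊗[k] V)
    (ρW : W →ₗ[k] H ⊗[k] W) :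
    tensorCoaction (tensorCoaction ρU ρV) ρW =
      push (mL (m (k := k)).toLinearMap) (outer (outer ρU ρV) ρW) := by
  have := push_comp ((isColinearAlong_tensor ρU ρV).outer (IsColinear.id ρW).along)
    (m (k := k) (H := H)).toLinearMap
  simp only [TensorProduct.map_id, LinearMap.comp_id, LinearMap.id_comp] at this
  exact this

/-- The coaction of `U ⊗ (V ⊗ W)`. -/
theorem tensorCoaction_right (ρU : U →ₗ[k] H ⊗[k] U) (ρV : V →ₗ[k] H ⊗[k] V)
    (ρW : W →ₗ[k] H ⊗[k] W) :
    tensorCoaction ρU (tensorCoaction ρV ρW) ∘ₗ (TensorProduct.assoc k U V W).toLinearMap =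
      TensorProduct.map LinearMap.id (TensorProduct.assoc k U V W).toLinearMap ∘ₗ
      push (mR (m (k := k)).toLinearMap) (outer (outer ρU ρV) ρW) := by
  have := push_comp (((IsColinear.id ρU).along.outer (isColinearAlong_tensor ρV ρW)).comp
    (isColinearAlong_assoc ρU ρV ρW)) (m (k := k) (H := H)).toLinearMap
  rw [TensorProduct.map_id, LinearMap.id_comp] at this
  exact this

/-- The two bracketings carry the coactions pushed along `m(H ⊗ m)` and `m(m ⊗ H)`.
Quasi-associativity, fed into `push_conv_right` and `push_conv_left`, says that acting by `ω`
intertwines them. -/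
theorem isColinear_assocCInv (hU : IsComodule ρU) (hV : IsComodule ρV) (hW : IsComodule ρW) :
    IsColinear (tensorCoaction ρU (tensorCoaction ρV ρW))
      (tensorCoaction (tensorCoaction ρU ρV) ρW) (assocCInv ρU ρV ρW) := by
  have h := ((hU.outer hV).outer hW)
  have h1 := h.push_conv_right (mR (m (k := k) (H := H)).toLinearMap) ω
  rw [quasi_assoc, h.push_conv_left] at h1
  have h2 := tensorCoaction_right ρU ρV ρW
  unfold IsColinear
  rw [tensorCoaction_left, assocCInv, ← LinearMap.comp_assoc, twist_eq, h1]
  refine LinearMap.ext fun x => ?_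
  obtain ⟨y, rfl⟩ := (TensorProduct.assoc k U V W).surjective x
  have h3 := LinearMap.congr_fun h2 y
  simp only [LinearMap.comp_apply, LinearEquiv.coe_coe, LinearEquiv.symm_apply_apply] at h3 ⊢
  rw [h3, TensorProduct.map_map, LinearMap.comp_assoc]
  have : (TensorProduct.assoc k U V W).symm.toLinearMap ∘ₗ
      (TensorProduct.assoc k U V W).toLinearMap = LinearMap.id := by ext; simp
  rw [this, LinearMap.comp_id]
  rfl

theorem isColinear_assocC (hU : IsComodule ρU) (hV : IsComodule ρV) (hW : IsComodule ρW) :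
    IsColinear (tensorCoaction (tensorCoaction ρU ρV) ρW)
      (tensorCoaction ρU (tensorCoaction ρV ρW)) (assocC ρU ρV ρW) :=
  (isColinear_assocCInv hU hV hW).symm (assocCInv_assocC hU hV hW) (assocC_assocCInv hU hV hW)

/-- The cocycle identity acting on the fourfold outer tensor product, with the convolution factors
in reverse order by `coactBy_conv`. -/
theorem assocCInv_pentagon (hU : IsComodule ρU) (hV : IsComodule ρV) (hW : IsComodule ρW)
    (hY : IsComodule ρY) :
    assocCInv (tensorCoaction ρU ρV) ρW ρY ∘ₗ assocCInv ρU ρV (tensorCoaction ρW ρY) =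
      TensorProduct.map (assocCInv ρU ρV ρW) LinearMap.id ∘ₗ
      assocCInv ρU (tensorCoaction ρV ρW) ρY ∘ₗ
      TensorProduct.map LinearMap.id (assocCInv ρV ρW ρY) := by
  have h := ((hU.outer hV).outer hW).outer hY
  have h0 := h.coactBy_conv (ωHHm ω (m (k := k) (H := H)).toLinearMap) (ωmHH ω m.toLinearMap)
  rw [cocycle, h.coactBy_conv, h.coactBy_conv] at h0
  -- Each factor of the cocycle is identified with one edge of the pentagon, all written on `((U ⊗
  -- V) ⊗ W) ⊗ Y`: `e1` for `ωmHH`, `e2` for `ωHHm`, `e3` for `ωε`, `e4` for `ωHmH`, and `e5`, `e6`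
  -- for `εω`.
  have e1 : twist ω (tensorCoaction ρU ρV) ρW ρY =
      coactBy (outer (outer (outer ρU ρV) ρW) ρY) (ωmHH ω m.toLinearMap) := by
    have := coactBy_comp (((isColinearAlong_tensor ρU ρV).outer (IsColinear.id ρW).along).outer
      (IsColinear.id ρY).along) (ω (k := k) (H := H))
    simp only [TensorProduct.map_id, LinearMap.comp_id, LinearMap.id_comp] at this
    exact this
  have e2 := coactBy_comp (((IsColinear.id (outer ρU ρV)).along.outer
    (isColinearAlong_tensor ρW ρY)).comp (isColinearAlong_assoc (outer ρU ρV) ρW ρY))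
      (ω (k := k) (H := H))
  have e3 : TensorProduct.map (twist ω ρU ρV ρW) LinearMap.id =
      coactBy (outer (outer (outer ρU ρV) ρW) ρY) (ωε Coalgebra.counit ω) := by
    rw [ωε, coactBy_outer, hY.coactBy_counit]
    rfl
  have e4 := coactBy_comp (((IsColinear.id ρU).along.outer
    (isColinearAlong_tensor ρV ρW)).comp (isColinearAlong_assoc ρU ρV ρW)|>.outer
    (IsColinear.id ρY).along) (ω (k := k) (H := H))
  have e5 : TensorProduct.map LinearMap.id (twist ω ρV ρW ρY) =
      coactBy (outer ρU (outer (outer ρV ρW) ρY))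
        (LinearMap.mul' k k ∘ₗ TensorProduct.map Coalgebra.counit ω) := by
    rw [coactBy_outer, hU.coactBy_counit]
    rfl
  have e6 := coactBy_comp (((IsColinear.id ρU).along.outer
    (isColinearAlong_assoc ρV ρW ρY).symm).comp ((isColinearAlong_assoc ρU ρV (outer ρW ρY)).comp
    (isColinearAlong_assoc (outer ρU ρV) ρW ρY)))
      (LinearMap.mul' k k ∘ₗ TensorProduct.map Coalgebra.counit (ω (k := k) (H := H)))
  rw [← e5] at e6
  refine LinearMap.ext fun x => ?_
  obtain ⟨x, rfl⟩ := (TensorProduct.assoc k U V (W ⊗[k] Y)).surjective x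
  obtain ⟨x, rfl⟩ := (TensorProduct.assoc k (U ⊗[k] V) W Y).surjective x
  have p1 : ∀ x, (TensorProduct.assoc k U (V ⊗[k] W) Y).symm
      (TensorProduct.map LinearMap.id (TensorProduct.assoc k V W Y).symm.toLinearMap
      (TensorProduct.assoc k U V (W ⊗[k] Y) (TensorProduct.assoc k (U ⊗[k] V) W Y x))) =
      TensorProduct.map (TensorProduct.assoc k U V W).toLinearMap LinearMap.id x := by
    intro x
    refine LinearMap.congr_fun (f := (TensorProduct.assoc k U (V ⊗[k] W) Y).symm.toLinearMap ∘ₗ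
      TensorProduct.map LinearMap.id (TensorProduct.assoc k V W Y).symm.toLinearMap ∘ₗ
      (TensorProduct.assoc k U V (W ⊗[k] Y)).toLinearMap ∘ₗ
      (TensorProduct.assoc k (U ⊗[k] V) W Y).toLinearMap) ?_ x
    ext; simp
  have l : assocCInv ρU ρV (tensorCoaction ρW ρY)
      (TensorProduct.assoc k U V (W ⊗[k] Y) (TensorProduct.assoc k (U ⊗[k] V) W Y x)) =
      TensorProduct.assoc k (U ⊗[k] V) W Y
        (coactBy (outer (outer (outer ρU ρV) ρW) ρY) (ωHHm ω (m (k := k)).toLinearMap) x) := by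
    have := LinearMap.congr_fun e2 x
    simp only [TensorProduct.map_id, LinearMap.id_comp] at this
    simp only [assocCInv, LinearMap.comp_apply, LinearEquiv.coe_coe, LinearEquiv.symm_apply_apply]
    exact this
  have r : TensorProduct.map LinearMap.id (assocCInv ρV ρW ρY)
      (TensorProduct.assoc k U V (W ⊗[k] Y) (TensorProduct.assoc k (U ⊗[k] V) W Y x)) =
      TensorProduct.map LinearMap.id (TensorProduct.assoc k V W Y).symm.toLinearMap
      (TensorProduct.assoc k U V (W ⊗[k] Y) (TensorProduct.assoc k (U ⊗[k] V) W Y 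
        (coactBy (outer (outer (outer ρU ρV) ρW) ρY) (εω Coalgebra.counit ω) x))) := by
    rw [assocCInv, ← LinearMap.id_comp (LinearMap.id : U →ₗ[k] U), TensorProduct.map_comp]
    exact LinearMap.congr_fun e6 x
  have r2 : ∀ x, assocCInv ρU (tensorCoaction ρV ρW) ρY (TensorProduct.map LinearMap.id
      (TensorProduct.assoc k V W Y).symm.toLinearMap
      (TensorProduct.assoc k U V (W ⊗[k] Y) (TensorProduct.assoc k (U ⊗[k] V) W Y x))) =
      TensorProduct.map (TensorProduct.assoc k U V W).toLinearMap LinearMap.id 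
        (coactBy (outer (outer (outer ρU ρV) ρW) ρY) (ωHmH ω (m (k := k)).toLinearMap) x) := by
    intro x
    rw [assocCInv, LinearMap.comp_apply, LinearEquiv.coe_coe, p1]
    have := LinearMap.congr_fun e4 x
    rw [TensorProduct.map_id, LinearMap.id_comp] at this
    exact this
  rw [LinearMap.comp_apply, LinearMap.comp_apply, LinearMap.comp_apply, l, r, r2,
    assocCInv, e1, assocCInv, ← LinearMap.comp_apply (TensorProduct.map _ _),
    ← TensorProduct.map_comp, LinearMap.comp_assoc, LinearMap.comp_apply, LinearEquiv.coe_coe,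
    LinearEquiv.symm_apply_apply]
  have : (TensorProduct.assoc k U V W).symm.toLinearMap ∘ₗ 
      (TensorProduct.assoc k U V W).toLinearMap = LinearMap.id := by ext; simp
  rw [this, LinearMap.comp_id, LinearMap.comp_id, e3]
  exact LinearMap.congr_fun h0.symm x

/-- Normalization of `ω`. Being stated for a single coinvariant element, it covers `1_H` and `1_R`
as well as the elements of trivial comodules. -/
theorem assocCInv_of_left {x : U} (hx : ρU x = oneH k H ⊗ₜ[k] x) (hV : IsComodule ρV)
    (hW : IsComodule ρW) (y : V) (z : W) :
    assocCInv ρU ρV ρW (x ⊗ₜ[k] (y ⊗ₜ[k] z)) = (x ⊗ₜ[k] y) ⊗ₜ[k] z := by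
  have hy := LinearMap.congr_fun hV.counit y
  have hz := LinearMap.congr_fun hW.counit z
  simp only [LinearMap.comp_apply, LinearEquiv.coe_coe, LinearMap.id_apply] at hy hz
  simp only [assocCInv, twist, LinearMap.comp_apply, LinearEquiv.coe_coe,
    TensorProduct.assoc_symm_tmul, TensorProduct.map_tmul, hx]
  conv_rhs => rw [← hy, ← hz]
  induction ρV y using TensorProduct.induction_on with
  | zero => simp
  | add a b ha hb => simp_all [TensorProduct.add_tmul, TensorProduct.tmul_add]
  | tmul e v =>
    induction ρW z using TensorProduct.induction_on with
    | zero => simp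
    | add a b ha hb => simp_all [TensorProduct.tmul_add]
    | tmul e' v' =>
      simp [ω_one_left, TensorProduct.smul_tmul, TensorProduct.tmul_smul, smul_smul, mul_comm]

theorem assocCInv_of_mid {y : V} (hy : ρV y = oneH k H ⊗ₜ[k] y) (hU : IsComodule ρU)
    (hW : IsComodule ρW) (x : U) (z : W) :
    assocCInv ρU ρV ρW (x ⊗ₜ[k] (y ⊗ₜ[k] z)) = (x ⊗ₜ[k] y) ⊗ₜ[k] z := by
  have hx := LinearMap.congr_fun hU.counit x
  have hz := LinearMap.congr_fun hW.counit z
  simp only [LinearMap.comp_apply, LinearEquiv.coe_coe, LinearMap.id_apply] at hx hz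
  simp only [assocCInv, twist, LinearMap.comp_apply, LinearEquiv.coe_coe,
    TensorProduct.assoc_symm_tmul, TensorProduct.map_tmul, hy]
  conv_rhs => rw [← hx, ← hz]
  induction ρU x using TensorProduct.induction_on with
  | zero => simp
  | add a b ha hb => simp_all [TensorProduct.add_tmul]
  | tmul e v =>
    induction ρW z using TensorProduct.induction_on with
    | zero => simp
    | add a b ha hb => simp_all [TensorProduct.tmul_add]
    | tmul e' v' =>
      simp [ω_one_mid, TensorProduct.smul_tmul, TensorProduct.tmul_smul, smul_smul, mul_comm]

theorem assocCInv_of_right {z : W} (hz : ρW z = oneH k H ⊗ₜ[k] z) (hU : IsComodule ρU)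
    (hV : IsComodule ρV) (x : U) (y : V) :
    assocCInv ρU ρV ρW (x ⊗ₜ[k] (y ⊗ₜ[k] z)) = (x ⊗ₜ[k] y) ⊗ₜ[k] z := by
  have hx := LinearMap.congr_fun hU.counit x
  have hy := LinearMap.congr_fun hV.counit y
  simp only [LinearMap.comp_apply, LinearEquiv.coe_coe, LinearMap.id_apply] at hx hy
  simp only [assocCInv, twist, LinearMap.comp_apply, LinearEquiv.coe_coe,
    TensorProduct.assoc_symm_tmul, TensorProduct.map_tmul, hz]
  conv_rhs => rw [← hx, ← hy]
  induction ρU x using TensorProduct.induction_on with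
  | zero => simp
  | add a b ha hb => simp_all [TensorProduct.add_tmul]
  | tmul e v =>
    induction ρV y using TensorProduct.induction_on with
    | zero => simp
    | add a b ha hb => simp_all [TensorProduct.add_tmul, TensorProduct.tmul_add]
    | tmul e' v' =>
      simp [ω_one_right, TensorProduct.smul_tmul, TensorProduct.tmul_smul, smul_smul, mul_comm]

theorem assocC_of_assocCInv (hU : IsComodule ρU) (hV : IsComodule ρV) (hW : IsComodule ρW)
    {x : U} {y : V} {z : W}
    (h : assocCInv ρU ρV ρW (x ⊗ₜ[k] (y ⊗ₜ[k] z)) = (x ⊗ₜ[k] y) ⊗ₜ[k] z) :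
    assocC ρU ρV ρW ((x ⊗ₜ[k] y) ⊗ₜ[k] z) = x ⊗ₜ[k] (y ⊗ₜ[k] z) := by
  rw [← h, ← LinearMap.comp_apply, assocC_assocCInv hU hV hW, LinearMap.id_apply]

end Monoidal

/-! ### Contraction with functionals -/

section Slice

variable {k : Type*} [Field k] {E U V W X : Type*} [AddCommGroup E] [Module k E]
  [AddCommGroup U] [Module k U] [AddCommGroup V] [Module k V] [AddCommGroup W] [Module k W]
  [AddCommGroup X] [Module k X]

/-- `v ⊗ x ↦ ξ(x) v` -/
noncomputable def slice (V : Type*) [AddCommGroup V] [Module k V] (ξ : X →ₗ[k] k) :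
    V ⊗[k] X →ₗ[k] V :=
  (TensorProduct.rid k V).toLinearMap ∘ₗ TensorProduct.map LinearMap.id ξ

/-- `ξ ⊗ η` as a functional. -/
noncomputable def tensorDual (ξ : U →ₗ[k] k) (η : V →ₗ[k] k) : U ⊗[k] V →ₗ[k] k :=
  LinearMap.mul' k k ∘ₗ TensorProduct.map ξ η

/-- The matrix coefficients `x ↦ ξ(x₀) x₋₁`. -/
noncomputable def coeffMap (ρ : X →ₗ[k] E ⊗[k] X) (ξ : X →ₗ[k] k) : X →ₗ[k] E :=
  slice E ξ ∘ₗ ρ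

@[simp] theorem slice_tmul (ξ : X →ₗ[k] k) (v : V) (x : X) : slice V ξ (v ⊗ₜ[k] x) = ξ x • v := by
  simp [slice]

@[simp] theorem tensorDual_tmul (ξ : U →ₗ[k] k) (η : V →ₗ[k] k) (x : U) (y : V) :
    tensorDual ξ η (x ⊗ₜ[k] y) = ξ x * η y := by
  simp [tensorDual]

/-- Over a field `X` has a basis, and its coordinate functionals recover the components of a tensor.
-/
theorem slice_basis_ext {ι : Type*} (b : Module.Basis ι k X) {z z' : V ⊗[k] X}
    (h : ∀ i, slice V (b.coord i) z = slice V (b.coord i) z') : z = z' := by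
  classical
  apply (TensorProduct.equivFinsuppOfBasisRight b).injective
  ext i
  rw [TensorProduct.equivFinsuppOfBasisRight_apply, TensorProduct.equivFinsuppOfBasisRight_apply]
  exact h i

theorem slice_ext {z z' : V ⊗[k] X} (h : ∀ ξ : X →ₗ[k] k, slice V ξ z = slice V ξ z') : z = z' :=
  slice_basis_ext (Module.Basis.ofVectorSpace k X) fun _ => h _

/-- Contraction in two stages shows that product functionals suffice. These are the ones whose
matrix coefficients factor over a tensor product of comodules. -/
theorem slice_ext₂ {z z' : V ⊗[k] (U ⊗[k] W)}
    (h : ∀ (ξ : U →ₗ[k] k) (η : W →ₗ[k] k),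
      slice V (tensorDual ξ η) z = slice V (tensorDual ξ η) z') : z = z' := by
  apply (TensorProduct.assoc k V U W).symm.injective
  have key : ∀ ξ η z, slice V ξ (slice (V ⊗[k] U) η ((TensorProduct.assoc k V U W).symm z)) =
      slice V (tensorDual ξ η) z := fun ξ η z => by
    refine LinearMap.congr_fun (f := slice V ξ ∘ₗ slice (V ⊗[k] U) η ∘ₗ
      (TensorProduct.assoc k V U W).symm.toLinearMap) ?_ z
    ext
    simp [smul_smul, mul_comm]
  exact slice_ext fun η => slice_ext fun ξ => by rw [key, key, h]

theorem slice_ext₃ {z z' : V ⊗[k] ((U ⊗[k] W) ⊗[k] X)}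
    (h : ∀ (ξ : U →ₗ[k] k) (η : W →ₗ[k] k) (ζ : X →ₗ[k] k),
      slice V (tensorDual (tensorDual ξ η) ζ) z = slice V (tensorDual (tensorDual ξ η) ζ) z') :
    z = z' := by
  apply (TensorProduct.assoc k V (U ⊗[k] W) X).symm.injective
  have key : ∀ ξ η ζ z, slice V (tensorDual ξ η) (slice (V ⊗[k] (U ⊗[k] W)) ζ
      ((TensorProduct.assoc k V (U ⊗[k] W) X).symm z)) =
      slice V (tensorDual (tensorDual ξ η) ζ) z := fun ξ η ζ z => by
    refine LinearMap.congr_fun (f := slice V (tensorDual ξ η) ∘ₗ slice (V ⊗[k] (U ⊗[k] W)) ζ ∘ₗ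
      (TensorProduct.assoc k V (U ⊗[k] W) X).symm.toLinearMap) ?_ z
    ext
    simp [smul_smul, mul_comm]
  exact slice_ext fun ζ => slice_ext₂ fun ξ η => by rw [key, key, h]

theorem slice_mid_ext {z z' : V ⊗[k] (U ⊗[k] W)}
    (h : ∀ η : W →ₗ[k] k, TensorProduct.map LinearMap.id (slice U η) z =
      TensorProduct.map LinearMap.id (slice U η) z') : z = z' := by
  apply (TensorProduct.assoc k V U W).symm.injective
  have key : ∀ η z, slice (V ⊗[k] U) η ((TensorProduct.assoc k V U W).symm z) =
      TensorProduct.map LinearMap.id (slice U η) z := fun η z => by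
    refine LinearMap.congr_fun (f := slice (V ⊗[k] U) η ∘ₗ
      (TensorProduct.assoc k V U W).symm.toLinearMap) ?_ z
    ext
    simp
  exact slice_ext fun η => by rw [key, key, h]

theorem slice_map (ξ : X →ₗ[k] k) (f : U →ₗ[k] V) (g : W →ₗ[k] X) :
    slice V ξ ∘ₗ TensorProduct.map f g = f ∘ₗ slice U (ξ ∘ₗ g) := by
  ext; simp

theorem slice_map_apply (ξ : X →ₗ[k] k) (f : U →ₗ[k] V) (g : W →ₗ[k] X) (z : U ⊗[k] W) :
    slice V ξ (TensorProduct.map f g z) = f (slice U (ξ ∘ₗ g) z) :=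
  LinearMap.congr_fun (slice_map ξ f g) z

theorem tensorDual_comp {U' V' : Type*} [AddCommGroup U'] [Module k U'] [AddCommGroup V']
    [Module k V'] (ξ : U →ₗ[k] k) (η : V →ₗ[k] k) (f : U' →ₗ[k] U) (g : V' →ₗ[k] V) :
    tensorDual ξ η ∘ₗ TensorProduct.map f g = tensorDual (ξ ∘ₗ f) (η ∘ₗ g) := by
  ext; simp

theorem coeffMap_comp {ρ : X →ₗ[k] E ⊗[k] X} {τ : U →ₗ[k] E ⊗[k] U} {f : U →ₗ[k] X}
    (hf : IsColinear τ ρ f) (ξ : X →ₗ[k] k) : coeffMap ρ ξ ∘ₗ f = coeffMap τ (ξ ∘ₗ f) := by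
  ext x
  simp [coeffMap, hf.apply, slice_map_apply]

/-- Coassociativity with `ξ` applied to the last leg. These morphisms into the regular comodule let
naturality reduce statements about all comodules to `H`. -/
theorem isColinear_coeffMap [Coalgebra k E] {ρ : X →ₗ[k] E ⊗[k] X} (h : IsComodule ρ)
    (ξ : X →ₗ[k] k) : IsColinear ρ Coalgebra.comul (coeffMap ρ ξ) := by
  refine LinearMap.ext fun x => ?_
  have key := congrArg (TensorProduct.map LinearMap.id (slice E ξ))
    (LinearMap.congr_fun h.coassoc x)
  simp only [LinearMap.comp_apply, TensorProduct.map_map, LinearMap.id_comp,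
    LinearEquiv.coe_coe] at key
  simp only [LinearMap.comp_apply]
  refine Eq.trans ?_ key
  simp only [coeffMap, LinearMap.comp_apply]
  induction ρ x using TensorProduct.induction_on with
  | zero => simp
  | add a b ha hb => simp_all
  | tmul e v =>
    simp only [slice_tmul, map_smul, TensorProduct.map_tmul, LinearMap.id_apply]
    induction Coalgebra.comul (R := k) e using TensorProduct.induction_on with
    | zero => simp
    | tmul a b => simp
    | add a b ha hb => simp_all [TensorProduct.add_tmul]

/-- This makes the reduction to the regular comodule reversible: applying the counit there amounts
to applying `ξ` in the original comodule. -/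
theorem counit_coeffMap [Coalgebra k E] {ρ : X →ₗ[k] E ⊗[k] X} (h : IsComodule ρ)
    (ξ : X →ₗ[k] k) : Coalgebra.counit ∘ₗ coeffMap ρ ξ = ξ := by
  refine LinearMap.ext fun x => ?_
  have key := congrArg ξ (LinearMap.congr_fun h.counit x)
  simp only [LinearMap.comp_apply, LinearEquiv.coe_coe, LinearMap.id_apply] at key
  rw [← key]
  simp only [coeffMap, LinearMap.comp_apply]
  induction ρ x using TensorProduct.induction_on with
  | zero => simp
  | add a b ha hb => simp_all
  | tmul e v => simp [mul_comm]

theorem coeffMap_outer {F : Type*} [AddCommGroup F] [Module k F] (ρ : U →ₗ[k] E ⊗[k] U)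
    (τ : V →ₗ[k] F ⊗[k] V) (ξ : U →ₗ[k] k) (η : V →ₗ[k] k) :
    coeffMap (outer ρ τ) (tensorDual ξ η) = TensorProduct.map (coeffMap ρ ξ) (coeffMap τ η) := by
  ext x y
  simp only [coeffMap, outer, LinearMap.comp_apply, TensorProduct.AlgebraTensorModule.curry_apply,
    LinearMap.restrictScalars_self, TensorProduct.curry_apply, TensorProduct.map_tmul,
    LinearEquiv.coe_coe]
  induction ρ x using TensorProduct.induction_on with
  | zero => simp
  | add a b ha hb => simp_all [TensorProduct.add_tmul]
  | tmul e v =>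
    induction τ y using TensorProduct.induction_on with
    | zero => simp
    | add a b ha hb => simp_all [TensorProduct.tmul_add]
    | tmul e' v' => simp [TensorProduct.smul_tmul, TensorProduct.tmul_smul, smul_smul, mul_comm]

theorem coeffMap_push {F : Type*} [AddCommGroup F] [Module k F] (p : E →ₗ[k] F)
    (ρ : U →ₗ[k] E ⊗[k] U) (ξ : U →ₗ[k] k) : coeffMap (push p ρ) ξ = p ∘ₗ coeffMap ρ ξ := by
  ext x
  simp [coeffMap, push, slice_map_apply]

end Slice

/-! ### Pasting commutative squares of linear maps -/

section Squares

variable {k : Type*} [CommSemiring k] {A B C D E F : Type*} [AddCommMonoid A] [Module k A]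
  [AddCommMonoid B] [Module k B] [AddCommMonoid C] [Module k C] [AddCommMonoid D] [Module k D]
  [AddCommMonoid E] [Module k E] [AddCommMonoid F] [Module k F]

theorem square_comp {f : A →ₗ[k] B} {g : B →ₗ[k] C} {f' : D →ₗ[k] E} {g' : E →ₗ[k] F}
    {a : A →ₗ[k] D} {b : B →ₗ[k] E} {c : C →ₗ[k] F} (hg : g' ∘ₗ b = c ∘ₗ g)
    (hf : f' ∘ₗ a = b ∘ₗ f) : (g' ∘ₗ f') ∘ₗ a = c ∘ₗ g ∘ₗ f := by
  rw [LinearMap.comp_assoc, hf, ← LinearMap.comp_assoc, hg, LinearMap.comp_assoc]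

theorem square_lTensor {f : A →ₗ[k] B} {f' : D →ₗ[k] E} {a : A →ₗ[k] D} {b : B →ₗ[k] E}
    (h : f' ∘ₗ a = b ∘ₗ f) (p : C →ₗ[k] F) :
    TensorProduct.map LinearMap.id f' ∘ₗ TensorProduct.map p a =
      TensorProduct.map p b ∘ₗ TensorProduct.map LinearMap.id f := by
  rw [← TensorProduct.map_comp, ← TensorProduct.map_comp, h, LinearMap.id_comp, LinearMap.comp_id]

theorem square_rTensor {f : A →ₗ[k] B} {f' : D →ₗ[k] E} {a : A →ₗ[k] D} {b : B →ₗ[k] E}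
    (h : f' ∘ₗ a = b ∘ₗ f) (p : C →ₗ[k] F) :
    TensorProduct.map f' LinearMap.id ∘ₗ TensorProduct.map a p =
      TensorProduct.map b p ∘ₗ TensorProduct.map f LinearMap.id := by
  rw [← TensorProduct.map_comp, ← TensorProduct.map_comp, h, LinearMap.id_comp, LinearMap.comp_id]

end Squares

/-! ### The braiding -/

section Braid

open DualQuasiBialgebra

variable {k H : Type*} [Field k] [AddCommGroup H] [Module k H]
  {U V W U' V' W' : Type*}
  [AddCommGroup U] [Module k U] [AddCommGroup V] [Module k V] [AddCommGroup W] [Module k W]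
  [AddCommGroup U'] [Module k U'] [AddCommGroup V'] [Module k V'] [AddCommGroup W'] [Module k W']
  {ρU : U →ₗ[k] H ⊗[k] U} {ρV : V →ₗ[k] H ⊗[k] V} {ρV' : V' →ₗ[k] H ⊗[k] V'}
  {μ : H ⊗[k] W →ₗ[k] W} {μ' : H ⊗[k] W' →ₗ[k] W'}

theorem braid_natural {f : V →ₗ[k] V'} {g : W →ₗ[k] W'} (hf : IsColinear ρV ρV' f)
    (hg : g ∘ₗ μ = μ' ∘ₗ TensorProduct.map LinearMap.id g) :
    braid ρV' μ' ∘ₗ TensorProduct.map f g = TensorProduct.map g f ∘ₗ braid ρV μ := by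
  ext x y
  have hg' : ∀ h w, g (μ (h ⊗ₜ[k] w)) = μ' (h ⊗ₜ[k] g w) := fun h w => by
    simpa using LinearMap.congr_fun hg (h ⊗ₜ[k] w)
  simp only [braid, LinearMap.comp_apply, TensorProduct.AlgebraTensorModule.curry_apply,
    LinearMap.restrictScalars_self, TensorProduct.curry_apply, TensorProduct.map_tmul,
    LinearEquiv.coe_coe, hf.apply]
  induction ρV x using TensorProduct.induction_on with
  | zero => simp
  | add a b ha hb => simp_all [TensorProduct.add_tmul]
  | tmul e v => simp [hg']

/-- The braiding with any comodule is recovered from the action of matrix coefficients. -/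
theorem slice_braid (ρV : V →ₗ[k] H ⊗[k] V) (μ : H ⊗[k] W →ₗ[k] W) (ξ : V →ₗ[k] k) (x : V) (y : W) :
    slice W ξ (braid ρV μ (x ⊗ₜ[k] y)) = μ (coeffMap ρV ξ x ⊗ₜ[k] y) := by
  simp only [braid, LinearMap.comp_apply, TensorProduct.map_tmul, LinearEquiv.coe_coe, coeffMap]
  induction ρV x using TensorProduct.induction_on with
  | zero => simp
  | add a b ha hb => simp_all [TensorProduct.add_tmul]
  | tmul e v => simp [← TensorProduct.smul_tmul']

variable [DualQuasiBialgebra k H]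

theorem sw_congr {A B C : Type*} [AddCommGroup A] [Module k A] [AddCommGroup B] [Module k B]
    [AddCommGroup C] {t : A ⊗[k] B} {f g : A → B → C} (h : ∀ a b, f a b = g a b) :
    sw t f = sw t g := by
  rw [show f = g from funext₂ h]

theorem sw_comm {A B C D F : Type*} [AddCommGroup A] [Module k A] [AddCommGroup B] [Module k B]
    [AddCommGroup C] [Module k C] [AddCommGroup D] [Module k D] [AddCommGroup F]
    (t : A ⊗[k] B) (s : C ⊗[k] D) (f : A → B → C → D → F) :
    (sw t fun a b => sw s fun c d => f a b c d) = sw s fun c d => sw t fun a b => f a b c d :=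
  Finset.sum_comm

theorem tensorCoaction_tmul (ρU : U →ₗ[k] H ⊗[k] U) (ρV : V →ₗ[k] H ⊗[k] V) (x : U) (y : V) :
    tensorCoaction ρU ρV (x ⊗ₜ[k] y) = sw (ρU x) fun x₁ x₀ => sw (ρV y) fun y₁ y₀ =>
      mulH k x₁ y₁ ⊗ₜ[k] (x₀ ⊗ₜ[k] y₀) := by
  simp only [tensorCoaction, LinearMap.comp_apply, TensorProduct.map_tmul, LinearEquiv.coe_coe]
  conv_lhs => rw [eq_sw (ρU x), eq_sw (ρV y)]
  simp only [sw_tmul, tmul_sw, map_sw, TensorProduct.tensorTensorTensorComm_tmul,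
    TensorProduct.map_tmul, LinearMap.id_apply]
  exact sw_comm _ _ _

theorem coeffMap_comul_counit (h : H) :
    coeffMap (k := k) (Coalgebra.comul : H →ₗ[k] H ⊗[k] H) Coalgebra.counit h = h := by
  have := congrArg (TensorProduct.rid k H) (Coalgebra.lTensor_counit_comul (R := k) h)
  rwa [TensorProduct.rid_tmul, one_smul] at this

theorem map_slice_tensorCoaction (ρU : U →ₗ[k] H ⊗[k] U) (ρV : V →ₗ[k] H ⊗[k] V)
    (η : V →ₗ[k] k) (x : U) (y : V) :
    TensorProduct.map LinearMap.id (slice U η) (tensorCoaction ρU ρV (x ⊗ₜ[k] y)) =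
      sw (ρU x) fun x₁ x₀ => mulH k x₁ (coeffMap ρV η y) ⊗ₜ[k] x₀ := by
  rw [tensorCoaction_tmul, map_sw]
  refine sw_congr fun x₁ x₀ => ?_
  rw [coeffMap, LinearMap.comp_apply]
  conv_rhs => rw [eq_sw (ρV y)]
  simp only [mulH, map_sw, tmul_sw, sw_tmul, slice_tmul, TensorProduct.map_tmul,
    LinearMap.id_apply, TensorProduct.tmul_smul, map_smul, ← TensorProduct.smul_tmul']

/-- For the regular comodule, with the counit applied to the leg in `H`, this is the compatibility
axiom `X.compat`. Naturality along coefficient maps gives the general case. -/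
theorem isColinear_braid {X : YDModule k H W} (hV : IsComodule ρV) :
    IsColinear (tensorCoaction ρV X.coact) (tensorCoaction X.coact ρV) (braid ρV X.act) := by
  have key : ∀ (h : H) (w : W),
      TensorProduct.map LinearMap.id (slice W Coalgebra.counit)
        (tensorCoaction X.coact Coalgebra.comul (braid Coalgebra.comul X.act (h ⊗ₜ[k] w))) =
      TensorProduct.map LinearMap.id X.act
        (tensorCoaction Coalgebra.comul X.coact (h ⊗ₜ[k] w)) := by
    intro h w
    rw [braid_tmul, map_sw, map_sw, tensorCoaction_tmul]
    simp only [map_slice_tensorCoaction, coeffMap_comul_counit, map_sw, TensorProduct.map_tmul,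
      LinearMap.id_apply]
    exact X.compat h w
  unfold IsColinear
  ext x w
  simp only [TensorProduct.AlgebraTensorModule.curry_apply, LinearMap.restrictScalars_self,
    TensorProduct.curry_apply, LinearMap.comp_apply]
  refine slice_mid_ext fun ξ => ?_
  have hξ := isColinear_coeffMap hV ξ
  have h1 := LinearMap.congr_fun (((IsColinear.id X.coact).tensor hξ)) (braid ρV X.act (x ⊗ₜ[k] w))
  have h2 := LinearMap.congr_fun
    (braid_natural (μ := X.act) (μ' := X.act) hξ (g := LinearMap.id) (by simp)) (x ⊗ₜ[k] w)
  have h3 := LinearMap.congr_fun (hξ.tensor (IsColinear.id X.coact)) (x ⊗ₜ[k] w)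
  simp only [LinearMap.comp_apply, TensorProduct.map_tmul, LinearMap.id_apply] at h1 h2 h3
  -- The regular case at the coefficient of `x`; pulling the coefficient map out through the
  -- naturality squares turns the counit into `ξ`.
  have hk := key (coeffMap ρV ξ x) w
  rw [h2, h1, h3, TensorProduct.map_map, TensorProduct.map_map, slice_map, counit_coeffMap hV,
    LinearMap.id_comp, LinearMap.id_comp] at hk
  rw [hk, TensorProduct.map_map, LinearMap.id_comp]
  congr 1
  congr 1
  ext v w
  simp [slice_braid]

/-- For `U = H`, applying the counit of `H` to the right-hand side gives the definition of
`tensorAct`. The other comodules follow by naturality along coefficient maps. -/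
theorem braid_tensorAct (X : YDModule k H V) (Y : YDModule k H W) (hU : IsComodule ρU) :
    braid ρU (tensorAct X.toPreYD Y.toPreYD) =
      assocCInv X.coact Y.coact ρU ∘ₗ TensorProduct.map LinearMap.id (braid ρU Y.act) ∘ₗ
      assocC X.coact ρU Y.coact ∘ₗ TensorProduct.map (braid ρU X.act) LinearMap.id ∘ₗ
      assocCInv ρU X.coact Y.coact := by
  refine TensorProduct.ext' fun x z => slice_ext fun ξ => ?_
  have hξ := isColinear_coeffMap hU ξ
  have hX := IsColinear.id X.coact
  have hY := IsColinear.id Y.coact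
  have e := square_comp (assocCInv_natural hX hY hξ) (square_comp
    (square_lTensor (braid_natural (g := LinearMap.id) (μ := Y.act) (μ' := Y.act) hξ (by simp))
      LinearMap.id) (square_comp (assocC_natural hX hξ hY)
    (square_comp (square_rTensor
      (braid_natural (g := LinearMap.id) (μ := X.act) (μ' := X.act) hξ (by simp)) LinearMap.id)
    (assocCInv_natural hξ hX hY))))
  simp only [TensorProduct.map_id] at e
  have h := congrArg (slice _ Coalgebra.counit) (LinearMap.congr_fun e (x ⊗ₜ[k] z))
  rw [LinearMap.comp_apply (TensorProduct.map LinearMap.id (coeffMap ρU ξ)), slice_map_apply,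
    counit_coeffMap hU, LinearMap.id_apply] at h
  rw [← h, slice_braid]
  rfl

theorem assocC_tmul (ρU : U →ₗ[k] H ⊗[k] U) (ρV : V →ₗ[k] H ⊗[k] V) (ρW : W →ₗ[k] H ⊗[k] W)
    (x : U) (y : V) (z : W) : assocC ρU ρV ρW ((x ⊗ₜ[k] y) ⊗ₜ[k] z) =
      sw (ρU x) fun x₁ x₀ => sw (ρV y) fun y₁ y₀ => sw (ρW z) fun z₁ z₀ =>
        omInv k x₁ y₁ z₁ • (x₀ ⊗ₜ[k] (y₀ ⊗ₜ[k] z₀)) := by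
  simp only [assocC, LinearMap.comp_apply, twist_tmul, map_sw, map_smul, LinearEquiv.coe_coe,
    TensorProduct.assoc_tmul]

theorem assocCInv_tmul (ρU : U →ₗ[k] H ⊗[k] U) (ρV : V →ₗ[k] H ⊗[k] V) (ρW : W →ₗ[k] H ⊗[k] W)
    (x : U) (y : V) (z : W) : assocCInv ρU ρV ρW (x ⊗ₜ[k] (y ⊗ₜ[k] z)) =
      sw (ρU x) fun x₁ x₀ => sw (ρV y) fun y₁ y₀ => sw (ρW z) fun z₁ z₀ =>
        om k x₁ y₁ z₁ • ((x₀ ⊗ₜ[k] y₀) ⊗ₜ[k] z₀) := by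
  simp only [assocCInv, LinearMap.comp_apply, twist_tmul, LinearEquiv.coe_coe,
    TensorProduct.assoc_symm_tmul]

/-- The constraint with two regular comodules loses its last two legs under the counits. This
removes the redundant coproducts before the comparison with `mul_act`. -/
theorem slice_assocC_comul (ρU : U →ₗ[k] H ⊗[k] U) (x : U) (h l : H) :
    slice U (tensorDual Coalgebra.counit Coalgebra.counit)
      (assocC ρU Coalgebra.comul Coalgebra.comul ((x ⊗ₜ[k] h) ⊗ₜ[k] l)) =
      sw (ρU x) fun x₁ x₀ => omInv k x₁ h l • x₀ := by
  rw [assocC_tmul, map_sw]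
  refine sw_congr fun x₁ x₀ => ?_
  conv_rhs => rw [← coeffMap_comul_counit (k := k) h, ← coeffMap_comul_counit (k := k) l]
  rw [coeffMap, LinearMap.comp_apply, LinearMap.comp_apply]
  conv_rhs => rw [eq_sw (Coalgebra.comul (R := k) h), eq_sw (Coalgebra.comul (R := k) l)]
  simp only [omInv, map_sw, tmul_sw, sw_tmul, slice_tmul, TensorProduct.tmul_smul, map_smul,
    ← TensorProduct.smul_tmul', tensorDual_tmul]
  simp only [sw, smul_eq_mul, Finset.sum_smul, smul_smul, Finset.mul_sum]
  rw [Finset.sum_comm]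
  refine Finset.sum_congr rfl fun i _ => Finset.sum_congr rfl fun j _ => ?_
  congr 1
  ring

/-- On `(H ⊗ H) ⊗ W`, with counits applied to the two copies of `H`, this is the axiom for `(hl) ▷
w`. Coefficient maps of both factors extend it to all comodules. -/
theorem braid_tensorCoaction (X : YDModule k H W) (hU : IsComodule ρU) (hV : IsComodule ρV) :
    braid (tensorCoaction ρU ρV) X.act =
      assocC X.coact ρU ρV ∘ₗ TensorProduct.map (braid ρU X.act) LinearMap.id ∘ₗ
      assocCInv ρU X.coact ρV ∘ₗ TensorProduct.map LinearMap.id (braid ρV X.act) ∘ₗ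
      assocC ρU ρV X.coact := by
  have key : ∀ (h l : H) (w : W), slice W (tensorDual Coalgebra.counit Coalgebra.counit)
      ((assocC X.coact Coalgebra.comul Coalgebra.comul ∘ₗ
      TensorProduct.map (braid Coalgebra.comul X.act) LinearMap.id ∘ₗ
      assocCInv Coalgebra.comul X.coact Coalgebra.comul ∘ₗ
      TensorProduct.map LinearMap.id (braid Coalgebra.comul X.act) ∘ₗ
      assocC Coalgebra.comul Coalgebra.comul X.coact) ((h ⊗ₜ[k] l) ⊗ₜ[k] w)) =
      X.act (mulH k h l ⊗ₜ[k] w) := by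
    intro h l w
    -- The last constraint and the counits are kept together as an opaque map, so that expansion
    -- uses `hS'` and not the full formula for `assocC`.
    obtain ⟨S, hS⟩ : ∃ S, S = slice W (tensorDual Coalgebra.counit Coalgebra.counit) ∘ₗ
      assocC X.coact (Coalgebra.comul (R := k) (A := H)) Coalgebra.comul := ⟨_, rfl⟩
    have hS' : ∀ x h l, S ((x ⊗ₜ[k] h) ⊗ₜ[k] l) =
        sw (X.coact x) fun x₁ x₀ => omInv k x₁ h l • x₀ := fun x h l => by
      rw [hS]
      exact slice_assocC_comul X.coact x h l
    rw [← LinearMap.comp_apply (slice _ _), ← LinearMap.comp_assoc, ← hS, X.mul_act]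
    simp only [assocC_tmul, assocCInv_tmul, LinearMap.comp_apply, map_sw, map_smul,
      TensorProduct.map_tmul, braid_tmul, sw_tmul, tmul_sw, LinearMap.id_apply, hS', smul_sw,
      smul_smul, mul_assoc]
    -- From here on only independent Sweedler sums are exchanged, until their order is that of
    -- `mul_act`.
    refine sw_congr fun h₁ h' => ?_
    refine (sw_congr fun _ _ => sw_congr fun _ _ => sw_comm _ _ _).trans ?_
    refine (sw_congr fun _ _ => sw_comm _ _ _).trans ((sw_comm _ _ _).trans ?_)
    refine sw_congr fun h₂ h' => ?_
    refine (sw_congr fun _ _ => sw_congr fun _ _ => sw_congr fun _ _ => sw_congr fun _ _ =>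
      sw_comm _ _ _).trans ?_
    refine (sw_congr fun _ _ => sw_congr fun _ _ => sw_congr fun _ _ => sw_comm _ _ _).trans ?_
    refine (sw_congr fun _ _ => sw_congr fun _ _ => sw_comm _ _ _).trans ?_
    refine (sw_congr fun _ _ => sw_comm _ _ _).trans ((sw_comm _ _ _).trans ?_)
    refine sw_congr fun h₃ h₄ => sw_congr fun l₁ l' => ?_
    refine (sw_comm _ _ _).trans ?_
    refine sw_congr fun l₂ l' => ?_
    refine (sw_congr fun _ _ => sw_comm _ _ _).trans ((sw_comm _ _ _).trans ?_)
    rfl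
  refine TensorProduct.ext_threefold fun x y z => slice_ext₂ fun ξ η => ?_
  have hξ := isColinear_coeffMap hU ξ
  have hη := isColinear_coeffMap hV η
  have hX := IsColinear.id X.coact
  have e := square_comp (assocC_natural hX hξ hη) (square_comp (square_rTensor
    (braid_natural (g := LinearMap.id) (μ := X.act) (μ' := X.act) hξ (by simp)) (coeffMap ρV η))
    (square_comp (assocCInv_natural hξ hX hη) (square_comp (square_lTensor
    (braid_natural (g := LinearMap.id) (μ := X.act) (μ' := X.act) hη (by simp)) (coeffMap ρU ξ))
    (assocC_natural hξ hη hX))))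
  have h := congrArg (slice W (tensorDual Coalgebra.counit Coalgebra.counit))
    (LinearMap.congr_fun e ((x ⊗ₜ[k] y) ⊗ₜ[k] z))
  rw [LinearMap.comp_apply, TensorProduct.map_tmul, TensorProduct.map_tmul, LinearMap.id_apply,
    key, LinearMap.comp_apply (TensorProduct.map LinearMap.id _), slice_map_apply, tensorDual_comp,
    counit_coeffMap hU, counit_coeffMap hV, LinearMap.id_apply] at h
  rw [← h, slice_braid, tensorCoaction_eq, coeffMap_push, coeffMap_outer]
  rfl

end Braid

/-! ### The functor `R ⊗ -` on left comodules -/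

section Interchange

open DualQuasiBialgebra

variable {k H : Type*} [Field k] [AddCommGroup H] [Module k H] [DualQuasiBialgebra k H]
  {R S L M L' M' : Type*}
  [AddCommGroup R] [Module k R] [AddCommGroup S] [Module k S]
  [AddCommGroup L] [Module k L] [AddCommGroup M] [Module k M]
  [AddCommGroup L'] [Module k L'] [AddCommGroup M'] [Module k M']
  {ρL : L →ₗ[k] H ⊗[k] L} {ρM : M →ₗ[k] H ⊗[k] M}
  {ρL' : L' →ₗ[k] H ⊗[k] L'} {ρM' : M' →ₗ[k] H ⊗[k] M'}

/-- The map `(R ⊗ L) ⊗ (R ⊗ M) ⟶ (R ⊗ R) ⊗ (L ⊗ M)` given by the braiding of `L` with `R`. -/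
noncomputable def interchange (X : PreYD k H R) (ρL : L →ₗ[k] H ⊗[k] L) (ρM : M →ₗ[k] H ⊗[k] M) :
    (R ⊗[k] L) ⊗[k] (R ⊗[k] M) →ₗ[k] (R ⊗[k] R) ⊗[k] (L ⊗[k] M) :=
  assocCInv X.coact X.coact (tensorCoaction ρL ρM) ∘ₗ
    TensorProduct.map LinearMap.id (assocC X.coact ρL ρM) ∘ₗ
    TensorProduct.map LinearMap.id (TensorProduct.map (braid ρL X.act) LinearMap.id) ∘ₗ
    TensorProduct.map LinearMap.id (assocCInv ρL X.coact ρM) ∘ₗ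
    assocC X.coact ρL (tensorCoaction X.coact ρM)

/-- Five naturality squares pasted together. Varying `R` as well allows comparison with a lifted
copy of `R`, and with `k` along `ε_R` and `u_R`. -/
theorem interchange_natural {X : PreYD k H R} {Y : PreYD k H S} {f : R →ₗ[k] S} (hf : IsYDHom X Y f)
    {g : L →ₗ[k] L'} (hg : IsColinear ρL ρL' g) {h : M →ₗ[k] M'} (hh : IsColinear ρM ρM' h) :
    interchange Y ρL' ρM' ∘ₗ TensorProduct.map (TensorProduct.map f g) (TensorProduct.map f h) =
      TensorProduct.map (TensorProduct.map f f) (TensorProduct.map g h) ∘ₗ interchange X ρL ρM :=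
  have hc : IsColinear X.coact Y.coact f := hf.colinear
  square_comp (assocCInv_natural hc hc (hg.tensor hh)) (square_comp
    (square_lTensor (assocC_natural hc hg hh) f) (square_comp
    (square_lTensor (square_rTensor (braid_natural hg hf.linear) h) f) (square_comp
    (square_lTensor (assocCInv_natural hg hc hh) f) (assocC_natural hc hg (hc.tensor hh)))))

theorem isColinear_interchange (X : YDModule k H R) (hL : IsComodule ρL) (hM : IsComodule ρM) :
    IsColinear (tensorCoaction (tensorCoaction X.coact ρL) (tensorCoaction X.coact ρM))
      (tensorCoaction (tensorCoaction X.coact X.coact) (tensorCoaction ρL ρM))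
      (interchange X.toPreYD ρL ρM) := by
  have hX : IsComodule X.coact := ⟨X.coact_coassoc, X.coact_counit⟩
  have i := IsColinear.id X.coact
  exact (isColinear_assocCInv hX hX (hL.tensor hM)).comp
    ((i.tensor (isColinear_assocC hX hL hM)).comp
    ((i.tensor ((isColinear_braid hL).tensor (IsColinear.id ρM))).comp
    ((i.tensor (isColinear_assocCInv hL hX hM)).comp
    (isColinear_assocC hX hL (hX.tensor hM)))))

/-- The multiplication `(R ⊗ L) ⊗ (R ⊗ M) ⟶ R ⊗ (L ⊗ M)`. -/
noncomputable def mulMap (X : PreYD k H R) (μ : R ⊗[k] R →ₗ[k] R) (ρL : L →ₗ[k] H ⊗[k] L)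
    (ρM : M →ₗ[k] H ⊗[k] M) : (R ⊗[k] L) ⊗[k] (R ⊗[k] M) →ₗ[k] R ⊗[k] (L ⊗[k] M) :=
  TensorProduct.map μ LinearMap.id ∘ₗ interchange X ρL ρM

/-- The comultiplication `R ⊗ L ⟶ R ⊗ (R ⊗ L)`. -/
noncomputable def comulMap (ρ : R →ₗ[k] H ⊗[k] R) (D : R →ₗ[k] R ⊗[k] R) (ρL : L →ₗ[k] H ⊗[k] L) :
    R ⊗[k] L →ₗ[k] R ⊗[k] (R ⊗[k] L) :=
  assocC ρ ρ ρL ∘ₗ TensorProduct.map D LinearMap.id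

theorem mulMap_natural {X : PreYD k H R} {Y : PreYD k H S} {f : R →ₗ[k] S} (hf : IsYDHom X Y f)
    {μ : R ⊗[k] R →ₗ[k] R} {μ' : S ⊗[k] S →ₗ[k] S} (hμ : μ' ∘ₗ TensorProduct.map f f = f ∘ₗ μ)
    {g : L →ₗ[k] L'} (hg : IsColinear ρL ρL' g) {h : M →ₗ[k] M'} (hh : IsColinear ρM ρM' h) :
    mulMap Y μ' ρL' ρM' ∘ₗ TensorProduct.map (TensorProduct.map f g) (TensorProduct.map f h) =
      TensorProduct.map f (TensorProduct.map g h) ∘ₗ mulMap X μ ρL ρM :=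
  square_comp (square_rTensor hμ (TensorProduct.map g h)) (interchange_natural hf hg hh)

theorem comulMap_natural {ρ : R →ₗ[k] H ⊗[k] R} {ρ' : S →ₗ[k] H ⊗[k] S} {f : R →ₗ[k] S}
    (hf : IsColinear ρ ρ' f) {D : R →ₗ[k] R ⊗[k] R} {D' : S →ₗ[k] S ⊗[k] S}
    (hD : D' ∘ₗ f = TensorProduct.map f f ∘ₗ D) {g : L →ₗ[k] L'} (hg : IsColinear ρL ρL' g) :
    comulMap ρ' D' ρL' ∘ₗ TensorProduct.map f g =
      TensorProduct.map f (TensorProduct.map f g) ∘ₗ comulMap ρ D ρL :=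
  square_comp (assocC_natural hf hf hg) (square_rTensor hD g)

theorem comulMap_natural_right (ρ : R →ₗ[k] H ⊗[k] R) (D : R →ₗ[k] R ⊗[k] R) {g : L →ₗ[k] L'}
    (hg : IsColinear ρL ρL' g) :
    comulMap ρ D ρL' ∘ₗ TensorProduct.map LinearMap.id g =
      TensorProduct.map LinearMap.id (TensorProduct.map LinearMap.id g) ∘ₗ comulMap ρ D ρL :=
  comulMap_natural (IsColinear.id ρ) (by simp) hg

theorem isYDHom_id (X : PreYD k H R) : IsYDHom X X LinearMap.id := ⟨by simp, by simp⟩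

theorem mulMap_natural_right (X : PreYD k H R) (μ : R ⊗[k] R →ₗ[k] R)
    {g : L →ₗ[k] L'} (hg : IsColinear ρL ρL' g) {h : M →ₗ[k] M'} (hh : IsColinear ρM ρM' h) :
    mulMap X μ ρL' ρM' ∘ₗ TensorProduct.map (TensorProduct.map LinearMap.id g)
      (TensorProduct.map LinearMap.id h) =
      TensorProduct.map LinearMap.id (TensorProduct.map g h) ∘ₗ mulMap X μ ρL ρM :=
  mulMap_natural (isYDHom_id X) (by simp) hg hh

theorem isColinear_mulMap (X : YDModule k H R) {μ : R ⊗[k] R →ₗ[k] R}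
    (hμ : IsYDHom (tensorYD X.toPreYD X.toPreYD) X.toPreYD μ) (hL : IsComodule ρL)
    (hM : IsComodule ρM) :
    IsColinear (tensorCoaction (tensorCoaction X.coact ρL) (tensorCoaction X.coact ρM))
      (tensorCoaction X.coact (tensorCoaction ρL ρM)) (mulMap X.toPreYD μ ρL ρM) :=
  IsColinear.comp (IsColinear.tensor (f := μ) hμ.colinear (IsColinear.id _))
    (isColinear_interchange X hL hM)

theorem isColinear_comulMap (X : YDModule k H R) {D : R →ₗ[k] R ⊗[k] R}
    (hD : IsYDHom X.toPreYD (tensorYD X.toPreYD X.toPreYD) D) (hL : IsComodule ρL) :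
    IsColinear (tensorCoaction X.coact ρL) (tensorCoaction X.coact (tensorCoaction X.coact ρL))
      (comulMap X.coact D ρL) := by
  have hX : IsComodule X.coact := ⟨X.coact_coassoc, X.coact_counit⟩
  exact (isColinear_assocC hX hX hL).comp (IsColinear.tensor (f := D) hD.colinear (IsColinear.id _))

end Interchange

/-! ### The monoidal category of left comodules -/

section Category

open DualQuasiBialgebra CategoryTheory MonoidalCategory

variable (k : Type u) (H : Type v) [Field k] [AddCommGroup H] [Module k H] [DualQuasiBialgebra k H]

/-- The left comodules over `H`. -/
structure LComod where
  /-- the underlying vector space -/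
  carrier : Type (max u w)
  [addCommGroup : AddCommGroup carrier]
  [module : Module k carrier]
  /-- the coaction -/
  coact : carrier →ₗ[k] H ⊗[k] carrier
  isComodule : IsComodule coact

attribute [instance] LComod.addCommGroup LComod.module

variable {k H}

/-- The morphisms of left comodules. -/
@[ext]
structure LComod.Hom (V W : LComod.{u, v, w} k H) where
  /-- the underlying linear map -/
  lin : V.carrier →ₗ[k] W.carrier
  colinear : IsColinear V.coact W.coact lin

instance : Category (LComod.{u, v, w} k H) where
  Hom := LComod.Hom
  id V := ⟨LinearMap.id, IsColinear.id _⟩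
  comp f g := ⟨g.lin ∘ₗ f.lin, g.colinear.comp f.colinear⟩

@[ext]
theorem LComod.hom_ext {V W : LComod.{u, v, w} k H} {f g : V ⟶ W} (h : f.lin = g.lin) : f = g :=
  LComod.Hom.ext h

@[simp] theorem LComod.comp_lin {U V W : LComod.{u, v, w} k H} (f : U ⟶ V) (g : V ⟶ W) :
    (f ≫ g).lin = g.lin ∘ₗ f.lin := rfl

/-- The isomorphism of comodules given by two inverse linear maps. -/
def LComod.mkIso {V W : LComod.{u, v, w} k H} (f : V.carrier →ₗ[k] W.carrier)
    (g : W.carrier →ₗ[k] V.carrier) (hf : IsColinear V.coact W.coact f)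
    (hgf : g ∘ₗ f = LinearMap.id) (hfg : f ∘ₗ g = LinearMap.id) : V ≅ W where
  hom := ⟨f, hf⟩
  inv := ⟨g, hf.symm hfg hgf⟩
  hom_inv_id := LComod.hom_ext hgf
  inv_hom_id := LComod.hom_ext hfg

variable (k H) in
theorem comul_oneH : Δ k (oneH k H) = oneH k H ⊗ₜ[k] oneH k H := by
  have := LinearMap.congr_fun (u (k := k) (H := H)).map_comp_comul 1
  rw [LinearMap.comp_apply, LinearMap.comp_apply, CommSemiring.comul_apply,
    TensorProduct.map_tmul] at this
  exact this.symm

variable (k H) in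
theorem counit_oneH : ε k (oneH k H) = 1 := by
  have := LinearMap.congr_fun (u (k := k) (H := H)).counit_comp 1
  exact this

/-- The trivial coaction. -/
noncomputable def trivialCoact (V : Type*) [AddCommGroup V] [Module k V] : V →ₗ[k] H ⊗[k] V :=
  TensorProduct.mk k H V (oneH k H)

theorem isComodule_trivialCoact (V : Type*) [AddCommGroup V] [Module k V] :
    IsComodule (trivialCoact (k := k) (H := H) V) where
  coassoc := by
    ext x
    have : Coalgebra.comul (R := k) (oneH k H) = _ := comul_oneH k H
    simp only [trivialCoact, LinearMap.comp_apply, TensorProduct.mk_apply, TensorProduct.map_tmul,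
      LinearMap.id_apply]
    rw [this]
    simp
  counit := by
    ext x
    have : Coalgebra.counit (R := k) (oneH k H) = _ := counit_oneH k H
    simp only [trivialCoact, LinearMap.comp_apply, TensorProduct.mk_apply, TensorProduct.map_tmul,
      LinearMap.id_apply]
    rw [this]
    simp

/-- The map `e` is arbitrary so that the statement covers the unit object, which is a lifted copy of
`k`. -/
theorem isColinear_lid {V U : Type*} [AddCommGroup V] [Module k V] [AddCommGroup U] [Module k U]
    (e : U →ₗ[k] k) (ρ : V →ₗ[k] H ⊗[k] V) :
    IsColinear (tensorCoaction (trivialCoact U) ρ) ρ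
      ((TensorProduct.lid k V).toLinearMap ∘ₗ TensorProduct.map e LinearMap.id) := by
  refine TensorProduct.ext' fun x y => ?_
  simp only [tensorCoaction, trivialCoact, LinearMap.comp_apply, TensorProduct.map_tmul,
    TensorProduct.mk_apply, LinearEquiv.coe_coe, LinearMap.id_apply, TensorProduct.lid_tmul,
    map_smul]
  induction ρ y using TensorProduct.induction_on with
  | zero => simp
  | add a b ha hb => simp_all [TensorProduct.tmul_add]
  | tmul h v => simp [one_m]

theorem isColinear_rid {V U : Type*} [AddCommGroup V] [Module k V] [AddCommGroup U] [Module k U]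
    (e : U →ₗ[k] k) (ρ : V →ₗ[k] H ⊗[k] V) :
    IsColinear (tensorCoaction ρ (trivialCoact U)) ρ
      ((TensorProduct.rid k V).toLinearMap ∘ₗ TensorProduct.map LinearMap.id e) := by
  refine TensorProduct.ext' fun y x => ?_
  simp only [tensorCoaction, trivialCoact, LinearMap.comp_apply, TensorProduct.map_tmul,
    TensorProduct.mk_apply, LinearEquiv.coe_coe, LinearMap.id_apply, TensorProduct.rid_tmul,
    map_smul]
  induction ρ y using TensorProduct.induction_on with
  | zero => simp
  | add a b ha hb => simp_all [TensorProduct.add_tmul]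
  | tmul h v => simp [m_one]

/-- The comodule with the given coaction. -/
abbrev LComod.of {V : Type (max u w)} [AddCommGroup V] [Module k V] {ρ : V →ₗ[k] H ⊗[k] V}
    (h : IsComodule ρ) : LComod.{u, v, w} k H := ⟨V, ρ, h⟩

noncomputable instance : MonoidalCategoryStruct (LComod.{u, v, w} k H) where
  tensorObj V W := LComod.of (V.isComodule.tensor W.isComodule)
  tensorHom f g := ⟨TensorProduct.map f.lin g.lin, f.colinear.tensor g.colinear⟩
  whiskerLeft V _ _ g := ⟨TensorProduct.map LinearMap.id g.lin, (IsColinear.id _).tensor g.colinear⟩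
  whiskerRight f V := ⟨TensorProduct.map f.lin LinearMap.id, f.colinear.tensor (IsColinear.id _)⟩
  -- The lift places `k` in the universe of the carriers.
  tensorUnit := LComod.of (isComodule_trivialCoact (ULift.{w} k))
  associator U V W := LComod.mkIso (assocC U.coact V.coact W.coact)
    (assocCInv U.coact V.coact W.coact)
    (isColinear_assocC U.isComodule V.isComodule W.isComodule)
    (assocCInv_assocC U.isComodule V.isComodule W.isComodule)
    (assocC_assocCInv U.isComodule V.isComodule W.isComodule)
  leftUnitor V := LComod.mkIso
    ((TensorProduct.lid k V.carrier).toLinearMap ∘ₗ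
      TensorProduct.map ULift.moduleEquiv.toLinearMap LinearMap.id)
    (TensorProduct.map ULift.moduleEquiv.symm.toLinearMap LinearMap.id ∘ₗ
      (TensorProduct.lid k V.carrier).symm.toLinearMap)
    (isColinear_lid _ _)
    (TensorProduct.ext' fun x y => (TensorProduct.smul_tmul x.down (ULift.up 1) y).symm.trans
      (congrArg (· ⊗ₜ[k] y) (ULift.ext _ _ (mul_one x.down))))
    (by ext; simp)
  rightUnitor V := LComod.mkIso
    ((TensorProduct.rid k V.carrier).toLinearMap ∘ₗ
      TensorProduct.map LinearMap.id ULift.moduleEquiv.toLinearMap)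
    (TensorProduct.map LinearMap.id ULift.moduleEquiv.symm.toLinearMap ∘ₗ
      (TensorProduct.rid k V.carrier).symm.toLinearMap)
    (isColinear_rid _ _)
    (TensorProduct.ext' fun x y => (TensorProduct.smul_tmul y.down x (ULift.up 1)).trans
      (congrArg (x ⊗ₜ[k] ·) (ULift.ext _ _ (mul_one y.down))))
    (by ext; simp)

noncomputable instance : MonoidalCategory (LComod.{u, v, w} k H) where
  tensorHom_def f g := LComod.hom_ext (by
    change TensorProduct.map _ _ = TensorProduct.map _ _ ∘ₗ TensorProduct.map _ _
    rw [← TensorProduct.map_comp]; rfl)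
  id_tensorHom_id U V := LComod.hom_ext TensorProduct.map_id
  tensorHom_comp_tensorHom f g f' g' := LComod.hom_ext (TensorProduct.map_comp _ _ _ _).symm
  whiskerLeft_id U V := LComod.hom_ext TensorProduct.map_id
  id_whiskerRight U V := LComod.hom_ext TensorProduct.map_id
  associator_naturality f g h := LComod.hom_ext (assocC_natural f.colinear g.colinear h.colinear)
  leftUnitor_naturality f := LComod.hom_ext (TensorProduct.ext' fun x y =>
    (map_smul f.lin x.down y).symm)
  rightUnitor_naturality f := LComod.hom_ext (TensorProduct.ext' fun x y =>
    (map_smul f.lin y.down x).symm)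
  pentagon U V W X := by
    -- The pentagon is known for the inverse constraints. To invert it, the whiskered isomorphisms
    -- are cancelled by hand, since the monoidal structure is still being constructed.
    have h : (α_ U V (W ⊗ X)).inv ≫ (α_ (U ⊗ V) W X).inv =
        U ◁ (α_ V W X).inv ≫ (α_ U (V ⊗ W) X).inv ≫ (α_ U V W).inv ▷ X :=
      LComod.hom_ext (assocCInv_pentagon U.isComodule V.isComodule W.isComodule X.isComodule)
    have h₁ : ∀ {A B : LComod.{u, v, w} k H} (e : A ≅ B) (C : LComod.{u, v, w} k H),
        e.inv ▷ C ≫ e.hom ▷ C = 𝟙 _ := fun e C => LComod.hom_ext (by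
      refine (TensorProduct.map_comp _ _ _ _).symm.trans ?_
      rw [← LComod.comp_lin, e.inv_hom_id]
      exact TensorProduct.map_id)
    have h₂ : ∀ {A B : LComod.{u, v, w} k H} (e : A ≅ B) (C : LComod.{u, v, w} k H),
        C ◁ e.inv ≫ C ◁ e.hom = 𝟙 _ := fun e C => LComod.hom_ext (by
      refine (TensorProduct.map_comp _ _ _ _).symm.trans ?_
      rw [← LComod.comp_lin, e.inv_hom_id]
      exact TensorProduct.map_id)
    have h₁' : ∀ {A B : LComod.{u, v, w} k H} (e : A ≅ B) {C D : LComod.{u, v, w} k H}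
        (g : B ⊗ C ⟶ D), e.inv ▷ C ≫ e.hom ▷ C ≫ g = g := fun e C D g => by
      rw [← Category.assoc, h₁, Category.id_comp]
    rw [← cancel_epi ((α_ U V (W ⊗ X)).inv ≫ (α_ (U ⊗ V) W X).inv)]
    conv_lhs => rw [h]
    simp only [Category.assoc, h₁', Iso.inv_hom_id_assoc, h₂, Iso.inv_hom_id]
  triangle U V := LComod.hom_ext (TensorProduct.ext_threefold fun x y z => by
    have := assocC_of_assocCInv U.isComodule (isComodule_trivialCoact (ULift.{w} k)) V.isComodule
      (assocCInv_of_mid (y := y) rfl U.isComodule V.isComodule x z)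
    exact (congrArg (TensorProduct.map LinearMap.id (λ_ V).hom.lin) this).trans
      (TensorProduct.smul_tmul y.down x z).symm)

end Category

/-! ### Change of universe -/

section Transport

variable {k H V V' R R' : Type*} [Field k] [AddCommGroup H] [Module k H]
  [AddCommGroup V] [Module k V] [AddCommGroup V'] [Module k V']
  [AddCommGroup R] [Module k R] [AddCommGroup R'] [Module k R']

/-- The coaction carried along a linear equivalence. -/
noncomputable def transportCoact (e : V ≃ₗ[k] V') (ρ : V →ₗ[k] H ⊗[k] V) : V' →ₗ[k] H ⊗[k] V' :=
  TensorProduct.map LinearMap.id e.toLinearMap ∘ₗ ρ ∘ₗ e.symm.toLinearMap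

theorem isColinear_transport (e : V ≃ₗ[k] V') (ρ : V →ₗ[k] H ⊗[k] V) :
    IsColinear ρ (transportCoact e ρ) e.toLinearMap := by
  refine LinearMap.ext fun x => ?_
  simp [transportCoact]

theorem IsComodule.of_equiv [Coalgebra k H] {e : V ≃ₗ[k] V'} {ρ : V →ₗ[k] H ⊗[k] V}
    {ρ' : V' →ₗ[k] H ⊗[k] V'} (h : IsComodule ρ) (he : IsColinear ρ ρ' e.toLinearMap) :
    IsComodule ρ' where
  coassoc := by
    refine LinearMap.ext fun x => ?_
    obtain ⟨x, rfl⟩ := e.surjective x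
    have := congrArg (TensorProduct.map LinearMap.id (TensorProduct.map LinearMap.id e.toLinearMap))
      (LinearMap.congr_fun h.coassoc x)
    have hx := he.apply x
    have hc : ρ' ∘ₗ e.toLinearMap = TensorProduct.map LinearMap.id e.toLinearMap ∘ₗ ρ := he
    simp only [LinearMap.comp_apply, LinearEquiv.coe_coe] at this hx ⊢
    rw [hx, TensorProduct.map_map, TensorProduct.map_map, hc]
    rw [TensorProduct.map_map] at this
    refine Eq.trans ?_ this
    induction ρ x using TensorProduct.induction_on with
    | zero => simp
    | add a b ha hb => simp_all
    | tmul a v =>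
      simp only [TensorProduct.map_tmul, LinearMap.comp_apply, LinearMap.id_apply]
      induction Coalgebra.comul (R := k) a using TensorProduct.induction_on with
      | zero => simp
      | add a b ha hb => simp_all [TensorProduct.add_tmul]
      | tmul a b => simp
  counit := by
    refine LinearMap.ext fun x => ?_
    obtain ⟨x, rfl⟩ := e.surjective x
    have := congrArg e (LinearMap.congr_fun h.counit x)
    have hx := he.apply x
    simp only [LinearMap.comp_apply, LinearEquiv.coe_coe, LinearMap.id_apply] at this hx ⊢
    rw [hx]
    refine Eq.trans ?_ this
    induction ρ x using TensorProduct.induction_on with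
    | zero => simp
    | add a b ha hb => simp_all
    | tmul a v => simp

/-- The coaction and the action carried along a linear equivalence. -/
noncomputable def PreYD.transport (X : PreYD k H R) (e : R ≃ₗ[k] R') : PreYD k H R' where
  coact := transportCoact e X.coact
  act := e.toLinearMap ∘ₗ X.act ∘ₗ TensorProduct.map LinearMap.id e.symm.toLinearMap

theorem PreYD.isYDHom_transport [DualQuasiBialgebra k H] (X : PreYD k H R) (e : R ≃ₗ[k] R') :
    IsYDHom X (X.transport e) e.toLinearMap where
  colinear := isColinear_transport e X.coact
  linear := by
    refine TensorProduct.ext' fun h x => ?_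
    simp [transport]

theorem comp_equiv_cancel {f g : V' →ₗ[k] R} (e : V ≃ₗ[k] V')
    (h : f ∘ₗ e.toLinearMap = g ∘ₗ e.toLinearMap) : f = g := by
  refine LinearMap.ext fun x => ?_
  obtain ⟨x, rfl⟩ := e.surjective x
  exact LinearMap.congr_fun h x

end Transport

/-! ### Half-braidings from Yetter–Drinfeld modules -/

section

open CategoryTheory MonoidalCategory

theorem YDModule.isComodule {k H R : Type*} [Field k] [AddCommGroup H] [Module k H]
    [DualQuasiBialgebra k H] [AddCommGroup R] [Module k R] (X : YDModule k H R) :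
    IsComodule X.coact := ⟨X.coact_coassoc, X.coact_counit⟩

variable {k : Type u} {H : Type v} [Field k] [AddCommGroup H] [Module k H] [DualQuasiBialgebra k H]
  {R : Type*} [AddCommGroup R] [Module k R] {R' : Type (max u w)} [AddCommGroup R'] [Module k R']

theorem isComodule_transport (X : YDModule k H R) (e : R ≃ₗ[k] R') :
    IsComodule (X.transport e).coact :=
  X.isComodule.of_equiv (isColinear_transport e X.coact)

theorem braid_transport (X : PreYD k H R) (e : R ≃ₗ[k] R') {L : Type*} [AddCommGroup L] [Module k L]
    (ρ : L →ₗ[k] H ⊗[k] L) : braid ρ (X.transport e).act ∘ₗ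
      TensorProduct.map LinearMap.id e.toLinearMap =
      TensorProduct.map e.toLinearMap LinearMap.id ∘ₗ braid ρ X.act :=
  braid_natural (IsColinear.id ρ) (X.isYDHom_transport e).linear

/-- A Yetter–Drinfeld module as an object of the category of comodules. -/
noncomputable abbrev ydObj (X : YDModule k H R) (e : R ≃ₗ[k] R') : LComod.{u, v, w} k H :=
  LComod.of (isComodule_transport X e)

/-- The half-braiding of a Yetter–Drinfeld module. -/
noncomputable def ydHalfBraid (X : YDModule k H R) (e : R ≃ₗ[k] R') :
    HalfBraid (ydObj X e) where
  c L := ⟨braid L.coact (X.transport e).act, by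
    -- The braiding of the copy `R'` is that of `R` conjugated by `e`, so the Yetter–Drinfeld axioms
    -- need not be transported.
    have h := ((isColinear_transport e X.coact).tensor (IsColinear.id L.coact)).comp
      ((isColinear_braid L.isComodule).comp ((IsColinear.id L.coact).tensor
        ((isColinear_transport e X.coact).symm (g := e.symm.toLinearMap) (by ext; simp)
          (by ext; simp))))
    convert! h using 1
    rw [← LinearMap.comp_assoc, ← braid_transport, LinearMap.comp_assoc, ← TensorProduct.map_comp]
    simp⟩
  nat f := LComod.hom_ext (braid_natural f.colinear (isYDHom_id (X.transport e)).linear)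
  tensor L M := LComod.hom_ext <| by
    have he := isColinear_transport e X.coact
    have iL := IsColinear.id L.coact
    have iM := IsColinear.id M.coact
    have h := square_comp (assocC_natural he iL iM) (square_comp (square_rTensor
      (braid_transport X.toPreYD e L.coact) LinearMap.id)
      (square_comp (assocCInv_natural iL he iM) (square_comp (square_lTensor
      (braid_transport X.toPreYD e M.coact) LinearMap.id) (assocC_natural iL iM he))))
    rw [← braid_tensorCoaction X L.isComodule M.isComodule, TensorProduct.map_id,
      ← braid_transport] at h
    have : TensorProduct.map LinearMap.id e.toLinearMap =
      (TensorProduct.congr (LinearEquiv.refl k (L.carrier ⊗[k] M.carrier)) e).toLinearMap := rfl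
    rw [this] at h
    exact (comp_equiv_cancel _ h).symm

end

/-! ### A Yetter–Drinfeld bialgebra inside the category of comodules -/

section

open CategoryTheory MonoidalCategory

theorem equiv_comp_cancel {k V V' R : Type*} [Field k] [AddCommGroup V] [Module k V]
    [AddCommGroup V'] [Module k V'] [AddCommGroup R] [Module k R] {f g : R →ₗ[k] V}
    (e : V ≃ₗ[k] V') (h : e.toLinearMap ∘ₗ f = e.toLinearMap ∘ₗ g) : f = g :=
  LinearMap.ext fun x => e.injective (LinearMap.congr_fun h x)

section Objects

variable {k : Type u} {H : Type v} [Field k] [AddCommGroup H] [Module k H] [DualQuasiBialgebra k H]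
  {R : Type*} [AddCommGroup R] [Module k R] {R' : Type (max u w)} [AddCommGroup R'] [Module k R']
  (X : YDBialgebra k H R) (e : R ≃ₗ[k] R')

theorem isColinear_transport_symm (ρ : R →ₗ[k] H ⊗[k] R) :
    IsColinear (transportCoact e ρ) ρ e.symm.toLinearMap :=
  (isColinear_transport e ρ).symm (by ext; simp) (by ext; simp)

/-- The multiplication as a morphism of comodules. -/
noncomputable def ydMul : ydObj X.toYDModule e ⊗ ydObj X.toYDModule e ⟶ ydObj X.toYDModule e :=
  ⟨e.toLinearMap ∘ₗ X.mul ∘ₗ TensorProduct.map e.symm.toLinearMap e.symm.toLinearMap,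
    (isColinear_transport e X.coact).comp (IsColinear.comp X.mul_hom.colinear
      ((isColinear_transport_symm e X.coact).tensor (isColinear_transport_symm e X.coact)))⟩

/-- The comultiplication as a morphism of comodules. -/
noncomputable def ydComul : ydObj X.toYDModule e ⟶ ydObj X.toYDModule e ⊗ ydObj X.toYDModule e :=
  ⟨TensorProduct.map e.toLinearMap e.toLinearMap ∘ₗ X.comul ∘ₗ e.symm.toLinearMap,
    ((isColinear_transport e X.coact).tensor (isColinear_transport e X.coact)).comp
      (IsColinear.comp X.comul_hom.colinear (isColinear_transport_symm e X.coact))⟩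

theorem ydMul_square : (ydMul X e).lin ∘ₗ TensorProduct.map e.toLinearMap e.toLinearMap =
    e.toLinearMap ∘ₗ X.mul := by
  have : TensorProduct.map e.symm.toLinearMap e.symm.toLinearMap ∘ₗ
      TensorProduct.map e.toLinearMap e.toLinearMap = LinearMap.id := by
    ext; simp
  change e.toLinearMap ∘ₗ X.mul ∘ₗ (TensorProduct.map e.symm.toLinearMap e.symm.toLinearMap ∘ₗ
      TensorProduct.map e.toLinearMap e.toLinearMap) = _
  rw [this, LinearMap.comp_id]

theorem ydComul_square : (ydComul X e).lin ∘ₗ e.toLinearMap =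
    TensorProduct.map e.toLinearMap e.toLinearMap ∘ₗ X.comul := by
  refine LinearMap.ext fun x => ?_
  simp [ydComul]

theorem ydHalfBraid_c₂ (L : LComod.{u, v, w} k H) :
    ((ydHalfBraid X.toYDModule e).c₂ L).lin =
      assocCInv (X.transport e).coact (X.transport e).coact L.coact ∘ₗ
      TensorProduct.map LinearMap.id (braid L.coact (X.transport e).act) ∘ₗ
      assocC (X.transport e).coact L.coact (X.transport e).coact ∘ₗ
      TensorProduct.map (braid L.coact (X.transport e).act) LinearMap.id ∘ₗ
      assocCInv L.coact (X.transport e).coact (X.transport e).coact := rfl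

/-- The categorical half-braiding of `R ⊗ R` is, up to `e`, the braiding by the tensor action. This
lets the `H`-linearity of `m_R` and `Δ_R` be used. -/
theorem ydHalfBraid_c₂_square (L : LComod.{u, v, w} k H) :
    ((ydHalfBraid X.toYDModule e).c₂ L).lin ∘ₗ
      TensorProduct.map LinearMap.id (TensorProduct.map e.toLinearMap e.toLinearMap) =
    TensorProduct.map (TensorProduct.map e.toLinearMap e.toLinearMap) LinearMap.id ∘ₗ
      braid L.coact (tensorAct X.toPreYD X.toPreYD) := by
  have he := isColinear_transport e X.coact
  have iL := IsColinear.id L.coact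
  rw [braid_tensorAct X.toYDModule X.toYDModule L.isComodule, ydHalfBraid_c₂]
  exact square_comp (assocCInv_natural he he iL) (square_comp
    (square_lTensor (braid_transport X.toPreYD e L.coact) e.toLinearMap) (square_comp
    (assocC_natural he iL he) (square_comp
    (square_rTensor (braid_transport X.toPreYD e L.coact) e.toLinearMap)
    (assocCInv_natural iL he he))))

/-- `H`-linearity of `m_R` is exactly what naturality of the braiding in its second variable needs;
the rest carries this along `e`. -/
theorem ydMul_braid (L : LComod.{u, v, w} k H) :
    L ◁ ydMul X e ≫ (ydHalfBraid X.toYDModule e).c L =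
      (ydHalfBraid X.toYDModule e).c₂ L ≫ ydMul X e ▷ L := by
  refine LComod.hom_ext (comp_equiv_cancel
    (TensorProduct.congr (LinearEquiv.refl k L.carrier) (TensorProduct.congr e e)) ?_)
  refine (square_comp (braid_transport X.toPreYD e L.coact)
    (square_lTensor (ydMul_square X e) LinearMap.id)).trans (Eq.trans ?_ (square_comp
    (square_rTensor (ydMul_square X e) LinearMap.id) (ydHalfBraid_c₂_square X e L)).symm)
  congr 1
  exact braid_natural (IsColinear.id L.coact) X.mul_hom.linear

theorem ydComul_braid (L : LComod.{u, v, w} k H) :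
    L ◁ ydComul X e ≫ (ydHalfBraid X.toYDModule e).c₂ L =
      (ydHalfBraid X.toYDModule e).c L ≫ ydComul X e ▷ L := by
  refine LComod.hom_ext (comp_equiv_cancel
    (TensorProduct.congr (LinearEquiv.refl k L.carrier) e) ?_)
  refine (square_comp (ydHalfBraid_c₂_square X e L)
    (square_lTensor (ydComul_square X e) LinearMap.id)).trans (Eq.trans ?_ (square_comp
    (square_rTensor (ydComul_square X e) LinearMap.id)
    (braid_transport X.toPreYD e L.coact)).symm)
  congr 1
  exact braid_natural (IsColinear.id L.coact) X.comul_hom.linear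

theorem ydMul_assoc : ydMul X e ▷ ydObj X.toYDModule e ≫ ydMul X e =
    (α_ _ _ _).hom ≫ ydObj X.toYDModule e ◁ ydMul X e ≫ ydMul X e := by
  have he := isColinear_transport e X.coact
  refine LComod.hom_ext (comp_equiv_cancel
    (TensorProduct.congr (TensorProduct.congr e e) e) ?_)
  refine (square_comp (ydMul_square X e)
    (square_rTensor (ydMul_square X e) e.toLinearMap)).trans (Eq.trans ?_ (square_comp
    (square_comp (ydMul_square X e) (square_lTensor (ydMul_square X e) e.toLinearMap))
    (assocC_natural he he he)).symm)
  congr 1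
  exact X.mul_assoc

theorem ydComul_coassoc : ydComul X e ≫ ydComul X e ▷ ydObj X.toYDModule e ≫ (α_ _ _ _).hom =
    ydComul X e ≫ ydObj X.toYDModule e ◁ ydComul X e := by
  have he := isColinear_transport e X.coact
  refine LComod.hom_ext (comp_equiv_cancel e ?_)
  refine (square_comp (square_comp (assocC_natural he he he)
    (square_rTensor (ydComul_square X e) e.toLinearMap)) (ydComul_square X e)).trans
    (Eq.trans ?_ (square_comp (square_lTensor (ydComul_square X e) e.toLinearMap)
    (ydComul_square X e)).symm)
  congr 1
  exact X.comul_coassoc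

theorem ydComul_ydMul : ydMul X e ≫ ydComul X e =
    (ydComul X e ⊗ₘ ydComul X e) ≫ (ydHalfBraid X.toYDModule e).T _ _ ≫
      (ydMul X e ⊗ₘ ydMul X e) := by
  have he := isColinear_transport e X.coact
  refine LComod.hom_ext (comp_equiv_cancel (TensorProduct.congr e e) ?_)
  have hm : TensorProduct.map (ydMul X e).lin (ydMul X e).lin ∘ₗ TensorProduct.map
      (TensorProduct.map e.toLinearMap e.toLinearMap)
      (TensorProduct.map e.toLinearMap e.toLinearMap) =
      TensorProduct.map e.toLinearMap e.toLinearMap ∘ₗ TensorProduct.map X.mul X.mul := by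
    rw [← TensorProduct.map_comp, ← TensorProduct.map_comp, ydMul_square]
  have hc : TensorProduct.map (ydComul X e).lin (ydComul X e).lin ∘ₗ TensorProduct.map
      e.toLinearMap e.toLinearMap = TensorProduct.map
      (TensorProduct.map e.toLinearMap e.toLinearMap)
      (TensorProduct.map e.toLinearMap e.toLinearMap) ∘ₗ TensorProduct.map X.comul X.comul := by
    rw [← TensorProduct.map_comp, ← TensorProduct.map_comp, ydComul_square]
  refine (square_comp (ydComul_square X e) (ydMul_square X e)).trans
    (Eq.trans ?_ (square_comp (square_comp hm
      (interchange_natural (X.isYDHom_transport e) he he)) hc).symm)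
  congr 1
  -- `comulSquare` is by definition `interchange` at `L = M = R`, preceded by `Δ_R ⊗ Δ_R`.
  exact X.comul_mul

end Objects

end

/-! ### The categorical identities as identities of linear maps -/

section Structure

open CategoryTheory MonoidalCategory

section Transported

variable {k : Type u} {H : Type v} [Field k] [AddCommGroup H] [Module k H] [DualQuasiBialgebra k H]
  {R : Type*} [AddCommGroup R] [Module k R]
  {R' L M N : Type (max u w)} [AddCommGroup R'] [Module k R']
  [AddCommGroup L] [Module k L] [AddCommGroup M] [Module k M] [AddCommGroup N] [Module k N]
  {ρL : L →ₗ[k] H ⊗[k] L} {ρM : M →ₗ[k] H ⊗[k] M} {ρN : N →ₗ[k] H ⊗[k] N}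

-- Reading `HalfBraid.T_assoc` on underlying maps. Of the structure on the copy `R'`, only the
-- relation of `μ` to `m_R` is retained, which is what naturality needs to return to `R`.
set_option maxRecDepth 10000 in
theorem exists_mul_transport (X : YDBialgebra k H R) (e : R ≃ₗ[k] R') (hL : IsComodule ρL)
    (hM : IsComodule ρM) (hN : IsComodule ρN) :
    ∃ μ : R' ⊗[k] R' →ₗ[k] R',
      μ ∘ₗ TensorProduct.map e.toLinearMap e.toLinearMap = e.toLinearMap ∘ₗ X.mul ∧
      (TensorProduct.map LinearMap.id (assocC ρL ρM ρN) ∘ₗ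
        mulMap (X.transport e) μ (tensorCoaction ρL ρM) ρN) ∘ₗ
        TensorProduct.map (mulMap (X.transport e) μ ρL ρM) LinearMap.id =
      (mulMap (X.transport e) μ ρL (tensorCoaction ρM ρN) ∘ₗ
        TensorProduct.map LinearMap.id (mulMap (X.transport e) μ ρM ρN)) ∘ₗ
        assocC (tensorCoaction (X.transport e).coact ρL) (tensorCoaction (X.transport e).coact ρM)
          (tensorCoaction (X.transport e).coact ρN) :=
  ⟨(ydMul.{u, v, w} X e).lin, ydMul_square X e, congrArg LComod.Hom.lin
    ((ydHalfBraid.{u, v, w} X.toYDModule e).T_assoc (LComod.of hL) (LComod.of hM) (LComod.of hN)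
    (ydMul X e) (ydMul_braid X e) (ydMul_assoc X e))⟩

set_option maxRecDepth 10000 in
theorem exists_mul_comul_transport (X : YDBialgebra k H R) (e : R ≃ₗ[k] R') (hL : IsComodule ρL)
    (hM : IsComodule ρM) :
    ∃ (μ : R' ⊗[k] R' →ₗ[k] R') (D : R' →ₗ[k] R' ⊗[k] R'),
      μ ∘ₗ TensorProduct.map e.toLinearMap e.toLinearMap = e.toLinearMap ∘ₗ X.mul ∧
      D ∘ₗ e.toLinearMap = TensorProduct.map e.toLinearMap e.toLinearMap ∘ₗ X.comul ∧
      comulMap (X.transport e).coact D (tensorCoaction ρL ρM) ∘ₗ mulMap (X.transport e) μ ρL ρM =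
      (TensorProduct.map LinearMap.id (mulMap (X.transport e) μ ρL ρM) ∘ₗ
        mulMap (X.transport e) μ (tensorCoaction (X.transport e).coact ρL)
          (tensorCoaction (X.transport e).coact ρM)) ∘ₗ
        TensorProduct.map (comulMap (X.transport e).coact D ρL)
          (comulMap (X.transport e).coact D ρM) :=
  ⟨(ydMul.{u, v, w} X e).lin, (ydComul.{u, v, w} X e).lin, ydMul_square X e, ydComul_square X e,
    congrArg LComod.Hom.lin
    ((ydHalfBraid.{u, v, w} X.toYDModule e).T_comul (LComod.of hL) (LComod.of hM)
    (ydMul X e) (ydComul X e) (ydComul_braid X e) (ydComul_ydMul X e))⟩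

theorem exists_comul_transport (X : YDBialgebra k H R) (e : R ≃ₗ[k] R') (hL : IsComodule ρL) :
    ∃ D : R' →ₗ[k] R' ⊗[k] R',
      D ∘ₗ e.toLinearMap = TensorProduct.map e.toLinearMap e.toLinearMap ∘ₗ X.comul ∧
      TensorProduct.map LinearMap.id (comulMap (X.transport e).coact D ρL) ∘ₗ
        comulMap (X.transport e).coact D ρL =
      comulMap (X.transport e).coact D (tensorCoaction (X.transport e).coact ρL) ∘ₗ
        comulMap (X.transport e).coact D ρL :=
  ⟨(ydComul.{u, v, w} X e).lin, ydComul_square X e, congrArg LComod.Hom.lin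
    (HalfBraid.whisker_coassoc (C := LComod.{u, v, w} k H) (LComod.of hL) (ydComul X e)
    (ydComul_coassoc X e))⟩

end Transported
end Structure

/-! ### Descent from a common universe -/

section Transport

variable {k : Type u} {H : Type v} [Field k] [AddCommGroup H] [Module k H] [DualQuasiBialgebra k H]
  {R L M N : Type*} [AddCommGroup R] [Module k R]
  [AddCommGroup L] [Module k L] [AddCommGroup M] [Module k M] [AddCommGroup N] [Module k N]
  {R' L' M' N' : Type (max u w)} [AddCommGroup R'] [Module k R']
  [AddCommGroup L'] [Module k L'] [AddCommGroup M'] [Module k M'] [AddCommGroup N'] [Module k N']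
  {ρL : L →ₗ[k] H ⊗[k] L} {ρM : M →ₗ[k] H ⊗[k] M} {ρN : N →ₗ[k] H ⊗[k] N}

/-- Both sides are conjugated to the identity for the copies by pasting naturality squares, and the
equivalence on the target is then cancelled. -/
theorem mulMap_assoc_of_equiv (X : YDBialgebra k H R) (hL : IsComodule ρL) (hM : IsComodule ρM)
    (hN : IsComodule ρN) (eR : R ≃ₗ[k] R') (eL : L ≃ₗ[k] L') (eM : M ≃ₗ[k] M') (eN : N ≃ₗ[k] N') :
    (TensorProduct.map LinearMap.id (assocC ρL ρM ρN) ∘ₗ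
      mulMap X.toPreYD X.mul (tensorCoaction ρL ρM) ρN) ∘ₗ
      TensorProduct.map (mulMap X.toPreYD X.mul ρL ρM) LinearMap.id =
    (mulMap X.toPreYD X.mul ρL (tensorCoaction ρM ρN) ∘ₗ
      TensorProduct.map LinearMap.id (mulMap X.toPreYD X.mul ρM ρN)) ∘ₗ
      assocC (tensorCoaction X.coact ρL) (tensorCoaction X.coact ρM)
        (tensorCoaction X.coact ρN) := by
  have hR := isColinear_transport eR X.coact
  have cL := isColinear_transport eL ρL
  have cM := isColinear_transport eM ρM
  have cN := isColinear_transport eN ρN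
  have hX := X.isYDHom_transport eR
  obtain ⟨μ, hμ, key⟩ := exists_mul_transport.{u, v, w} X eR (hL.of_equiv cL) (hM.of_equiv cM)
    (hN.of_equiv cN)
  refine equiv_comp_cancel (k := k) (V := R ⊗[k] (L ⊗[k] (M ⊗[k] N)))
    (R := ((R ⊗[k] L) ⊗[k] (R ⊗[k] M)) ⊗[k] (R ⊗[k] N))
    (TensorProduct.congr eR (TensorProduct.congr eL (TensorProduct.congr eM eN))) ?_
  have s₁ := square_lTensor (assocC_natural cL cM cN) eR.toLinearMap
  have s₂ := mulMap_natural hX hμ (cL.tensor cM) cN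
  have s₃ := square_rTensor (mulMap_natural hX hμ cL cM)
    (TensorProduct.map eR.toLinearMap eN.toLinearMap)
  have s₁₂ := square_comp s₁ s₂
  have h₁ := square_comp s₁₂ s₃
  have h₂ := square_comp (square_comp (mulMap_natural hX hμ cL (cM.tensor cN))
    (square_lTensor (mulMap_natural hX hμ cM cN) (TensorProduct.map eR.toLinearMap eL.toLinearMap)))
    (assocC_natural (hR.tensor cL) (hR.tensor cM) (hR.tensor cN))
  refine h₁.symm.trans (Eq.trans ?_ h₂)
  exact congrArg (· ∘ₗ _) key

theorem comulMap_mulMap_of_equiv (X : YDBialgebra k H R) (hL : IsComodule ρL) (hM : IsComodule ρM)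
    (eR : R ≃ₗ[k] R') (eL : L ≃ₗ[k] L') (eM : M ≃ₗ[k] M') :
    comulMap X.coact X.comul (tensorCoaction ρL ρM) ∘ₗ mulMap X.toPreYD X.mul ρL ρM =
    (TensorProduct.map LinearMap.id (mulMap X.toPreYD X.mul ρL ρM) ∘ₗ
      mulMap X.toPreYD X.mul (tensorCoaction X.coact ρL) (tensorCoaction X.coact ρM)) ∘ₗ
      TensorProduct.map (comulMap X.coact X.comul ρL) (comulMap X.coact X.comul ρM) := by
  have hR := isColinear_transport eR X.coact
  have cL := isColinear_transport eL ρL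
  have cM := isColinear_transport eM ρM
  have hX := X.isYDHom_transport eR
  obtain ⟨μ, D, hμ, hD, key⟩ := exists_mul_comul_transport.{u, v, w} X eR (hL.of_equiv cL)
    (hM.of_equiv cM)
  refine equiv_comp_cancel (TensorProduct.congr eR (TensorProduct.congr eR
    (TensorProduct.congr eL eM))) ?_
  have hc : TensorProduct.map
      (comulMap (transportCoact eR X.coact) D (transportCoact eL ρL))
      (comulMap (transportCoact eR X.coact) D (transportCoact eM ρM)) ∘ₗ
      TensorProduct.map (TensorProduct.map eR.toLinearMap eL.toLinearMap)
        (TensorProduct.map eR.toLinearMap eM.toLinearMap) =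
      TensorProduct.map (TensorProduct.map eR.toLinearMap
        (TensorProduct.map eR.toLinearMap eL.toLinearMap)) (TensorProduct.map eR.toLinearMap
        (TensorProduct.map eR.toLinearMap eM.toLinearMap)) ∘ₗ
      TensorProduct.map (comulMap X.coact X.comul ρL) (comulMap X.coact X.comul ρM) := by
    rw [← TensorProduct.map_comp, ← TensorProduct.map_comp, comulMap_natural hR hD cL,
      comulMap_natural hR hD cM]
  have h₁ := square_comp (square_lTensor (mulMap_natural hX hμ cL cM) eR.toLinearMap)
      (mulMap_natural hX hμ (hR.tensor cL) (hR.tensor cM))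
  have h₂ := square_comp h₁ hc
  refine (square_comp (comulMap_natural hR hD (cL.tensor cM))
    (mulMap_natural hX hμ cL cM)).symm.trans (Eq.trans ?_ h₂)
  exact congrArg (· ∘ₗ _) key

theorem comulMap_coassoc_of_equiv (X : YDBialgebra k H R) (hL : IsComodule ρL)
    (eR : R ≃ₗ[k] R') (eL : L ≃ₗ[k] L') :
    TensorProduct.map LinearMap.id (comulMap X.coact X.comul ρL) ∘ₗ
      comulMap X.coact X.comul ρL =
    comulMap X.coact X.comul (tensorCoaction X.coact ρL) ∘ₗ comulMap X.coact X.comul ρL := by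
  have hR := isColinear_transport eR X.coact
  have cL := isColinear_transport eL ρL
  obtain ⟨D, hD, key⟩ := exists_comul_transport.{u, v, w} X eR (hL.of_equiv cL)
  refine equiv_comp_cancel (TensorProduct.congr eR (TensorProduct.congr eR
    (TensorProduct.congr eR eL))) ?_
  refine (square_comp (square_lTensor (comulMap_natural hR hD cL) eR.toLinearMap)
    (comulMap_natural hR hD cL)).symm.trans
    (Eq.trans ?_ (square_comp (comulMap_natural hR hD (hR.tensor cL))
      (comulMap_natural hR hD cL)))
  exact congrArg (· ∘ₗ _) key

end Transport

/-! ### The structure of `R ⊗ -` for spaces in arbitrary universes -/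

section Structure

universe u₁ u₂ u₃ u₄ u₅ u₆

variable {k : Type u₁} {H : Type u₂} {R : Type u₃} {L : Type u₄} {M : Type u₅} {N : Type u₆}
  [Field k] [AddCommGroup H] [Module k H] [DualQuasiBialgebra k H]
  [AddCommGroup R] [Module k R] [AddCommGroup L] [Module k L] [AddCommGroup M] [Module k M]
  [AddCommGroup N] [Module k N]
  {ρL : L →ₗ[k] H ⊗[k] L} {ρM : M →ₗ[k] H ⊗[k] M} {ρN : N →ₗ[k] H ⊗[k] N}

/-- The functor `R ⊗ -` is lax monoidal. -/
theorem mulMap_assoc (X : YDBialgebra k H R) (hL : IsComodule ρL) (hM : IsComodule ρM)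
    (hN : IsComodule ρN) :
    (TensorProduct.map LinearMap.id (assocC ρL ρM ρN) ∘ₗ
      mulMap X.toPreYD X.mul (tensorCoaction ρL ρM) ρN) ∘ₗ
      TensorProduct.map (mulMap X.toPreYD X.mul ρL ρM) LinearMap.id =
    (mulMap X.toPreYD X.mul ρL (tensorCoaction ρM ρN) ∘ₗ
      TensorProduct.map LinearMap.id (mulMap X.toPreYD X.mul ρM ρN)) ∘ₗ
      assocC (tensorCoaction X.coact ρL) (tensorCoaction X.coact ρM)
        (tensorCoaction X.coact ρN) :=
  mulMap_assoc_of_equiv.{u₁, u₂, max u₃ u₄ u₅ u₆} X hL hM hN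
    (ULift.moduleEquiv.{u₁, u₃, max u₁ u₄ u₅ u₆}.symm)
    (ULift.moduleEquiv.{u₁, u₄, max u₁ u₃ u₅ u₆}.symm)
    (ULift.moduleEquiv.{u₁, u₅, max u₁ u₃ u₄ u₆}.symm)
    (ULift.moduleEquiv.{u₁, u₆, max u₁ u₃ u₄ u₅}.symm)

/-- The comultiplication `R ⊗ L ⟶ R ⊗ (R ⊗ L)` is monoidal. -/
theorem comulMap_mulMap (X : YDBialgebra k H R) (hL : IsComodule ρL) (hM : IsComodule ρM) :
    comulMap X.coact X.comul (tensorCoaction ρL ρM) ∘ₗ mulMap X.toPreYD X.mul ρL ρM =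
    (TensorProduct.map LinearMap.id (mulMap X.toPreYD X.mul ρL ρM) ∘ₗ
      mulMap X.toPreYD X.mul (tensorCoaction X.coact ρL) (tensorCoaction X.coact ρM)) ∘ₗ
      TensorProduct.map (comulMap X.coact X.comul ρL) (comulMap X.coact X.comul ρM) :=
  comulMap_mulMap_of_equiv.{u₁, u₂, max u₃ u₄ u₅} X hL hM
    (ULift.moduleEquiv.{u₁, u₃, max u₁ u₄ u₅}.symm)
    (ULift.moduleEquiv.{u₁, u₄, max u₁ u₃ u₅}.symm)
    (ULift.moduleEquiv.{u₁, u₅, max u₁ u₃ u₄}.symm)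

/-- The functor `R ⊗ -` is a comonad. -/
theorem comulMap_coassoc (X : YDBialgebra k H R) (hL : IsComodule ρL) :
    TensorProduct.map LinearMap.id (comulMap X.coact X.comul ρL) ∘ₗ
      comulMap X.coact X.comul ρL =
    comulMap X.coact X.comul (tensorCoaction X.coact ρL) ∘ₗ comulMap X.coact X.comul ρL :=
  comulMap_coassoc_of_equiv.{u₁, u₂, max u₃ u₄} X hL
    (ULift.moduleEquiv.{u₁, u₃, max u₁ u₄}.symm) (ULift.moduleEquiv.{u₁, u₄, max u₁ u₃}.symm)

end Structure

/-! ### The coalgebra `R # H` -/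

section Expand

variable {k H : Type*} [Field k] [AddCommGroup H] [Module k H]
  (R : Type*) [AddCommGroup R] [Module k R]
  {L L' M : Type*} [AddCommGroup L] [Module k L] [AddCommGroup L'] [Module k L']
  [AddCommGroup M] [Module k M]

/-- `r ⊗ x ↦ (r ⊗ x₋₁) ⊗ x₀` -/
noncomputable def expand (ρ : L →ₗ[k] H ⊗[k] L) : R ⊗[k] L →ₗ[k] (R ⊗[k] H) ⊗[k] L :=
  (TensorProduct.assoc k R H L).symm.toLinearMap ∘ₗ TensorProduct.map LinearMap.id ρ

/-- Contracting the comodule leg turns `expand` into the functor `R ⊗ -` applied to a coefficient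
map; this is how functorial identities yield identities in `R # H`. -/
theorem slice_expand (ρ : L →ₗ[k] H ⊗[k] L) (ξ : L →ₗ[k] k) :
    slice (R ⊗[k] H) ξ ∘ₗ expand R ρ = TensorProduct.map LinearMap.id (coeffMap ρ ξ) := by
  refine TensorProduct.ext' fun r x => ?_
  simp only [expand, coeffMap, LinearMap.comp_apply, TensorProduct.map_tmul, LinearEquiv.coe_coe,
    LinearMap.id_apply]
  induction ρ x using TensorProduct.induction_on with
  | zero => simp
  | add a b ha hb => simp_all [TensorProduct.tmul_add]
  | tmul h y => simp

theorem slice_expand_apply (ρ : L →ₗ[k] H ⊗[k] L) (ξ : L →ₗ[k] k) (z : R ⊗[k] L) :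
    slice (R ⊗[k] H) ξ (expand R ρ z) = TensorProduct.map LinearMap.id (coeffMap ρ ξ) z :=
  LinearMap.congr_fun (slice_expand R ρ ξ) z

theorem expand_natural {ρ : L →ₗ[k] H ⊗[k] L} {ρ' : L' →ₗ[k] H ⊗[k] L'} {f : L →ₗ[k] L'}
    (hf : IsColinear ρ ρ' f) : expand R ρ' ∘ₗ TensorProduct.map LinearMap.id f =
      TensorProduct.map LinearMap.id f ∘ₗ expand R ρ := by
  refine LinearMap.ext fun x => slice_ext fun ξ => ?_
  rw [LinearMap.comp_apply, LinearMap.comp_apply, slice_expand_apply, slice_map_apply,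
    slice_expand_apply, TensorProduct.map_map, coeffMap_comp hf]
  rfl

end Expand

section Coalgebra

open DualQuasiBialgebra

variable {k H R : Type*} [Field k] [AddCommGroup H] [Module k H] [DualQuasiBialgebra k H]
  [AddCommGroup R] [Module k R] {L : Type*} [AddCommGroup L] [Module k L]
  {ρL : L →ₗ[k] H ⊗[k] L} (X : YDBialgebra k H R)

/-- The coaction of `H` on `R ⊗ H`. -/
noncomputable abbrev bosCoact : R ⊗[k] H →ₗ[k] H ⊗[k] (R ⊗[k] H) :=
  tensorCoaction X.coact Coalgebra.comul

theorem isComodule_bosCoact : IsComodule (bosCoact X) := X.isComodule.tensor isComodule_comul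

/-- The comultiplication of `R # H`. -/
noncomputable def bosComul : R ⊗[k] H →ₗ[k] (R ⊗[k] H) ⊗[k] (R ⊗[k] H) :=
  expand R (bosCoact X) ∘ₗ comulMap X.coact X.comul Coalgebra.comul

/-- The counit of `R # H`. -/
noncomputable def bosCounit : R ⊗[k] H →ₗ[k] k := tensorDual X.counit Coalgebra.counit

/-- The projection `r ⊗ h ↦ ε(r) h`. -/
noncomputable def bosProj : R ⊗[k] H →ₗ[k] H :=
  (TensorProduct.lid k H).toLinearMap ∘ₗ TensorProduct.map X.counit LinearMap.id

theorem isColinear_counit :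
    IsColinear X.coact (trivialCoact (k := k) (H := H) k) X.counit := X.counit_hom.colinear

theorem coeffMap_counit (r : R) : coeffMap X.coact X.counit r = X.counit r • oneH k H := by
  have h := coeffMap_comp (isColinear_counit X) (LinearMap.id : k →ₗ[k] k)
  rw [LinearMap.id_comp] at h
  rw [← h]
  simp [coeffMap, trivialCoact]

/-- Since `ε_R` is colinear, its coefficient at `r` is `ε_R(r) 1_H`. Thus `π` is itself a matrix
coefficient, which makes it colinear. -/
theorem coeffMap_bosCounit : coeffMap (bosCoact X) (bosCounit X) = bosProj X := by
  rw [bosCounit, bosCoact, tensorCoaction_eq, coeffMap_push, coeffMap_outer]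
  refine TensorProduct.ext' fun r h => ?_
  simp [coeffMap_counit, coeffMap_comul_counit, bosProj, ← TensorProduct.smul_tmul', one_m]

/-- Colinearity of `ε_R` allows the first factor `R` to be replaced by the trivial comodule `k`,
where the constraint is the identity; counitality of `Δ_R` remains. -/
theorem counit_comulMap (hL : IsComodule ρL) :
    ((TensorProduct.lid k (R ⊗[k] L)).toLinearMap ∘ₗ TensorProduct.map X.counit LinearMap.id) ∘ₗ
      comulMap X.coact X.comul ρL = LinearMap.id := by
  have h : ((TensorProduct.lid k (R ⊗[k] L)).toLinearMap ∘ₗ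
      TensorProduct.map X.counit LinearMap.id) ∘ₗ assocC X.coact X.coact ρL =
      TensorProduct.map ((TensorProduct.lid k R).toLinearMap ∘ₗ
        TensorProduct.map X.counit LinearMap.id) LinearMap.id := by
    have e := assocC_natural (isColinear_counit X) (IsColinear.id X.coact) (IsColinear.id ρL)
    rw [TensorProduct.map_id] at e
    rw [LinearMap.comp_assoc, ← e]
    refine TensorProduct.ext_threefold fun r s x => ?_
    simp only [LinearMap.comp_apply, TensorProduct.map_tmul, LinearMap.id_apply,
      LinearEquiv.coe_coe]
    rw [assocC_of_assocCInv (isComodule_trivialCoact k) X.isComodule hL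
      (assocCInv_of_left rfl X.isComodule hL _ _)]
    simp [TensorProduct.smul_tmul']
  rw [comulMap, ← LinearMap.comp_assoc, h, ← TensorProduct.map_comp, LinearMap.comp_assoc,
    X.counit_comul, LinearMap.id_comp, TensorProduct.map_id]

theorem comulMap_counit (hL : IsComodule ρL) :
    TensorProduct.map LinearMap.id ((TensorProduct.lid k L).toLinearMap ∘ₗ
      TensorProduct.map X.counit LinearMap.id) ∘ₗ
      comulMap X.coact X.comul ρL = LinearMap.id := by
  have h : TensorProduct.map LinearMap.id ((TensorProduct.lid k L).toLinearMap ∘ₗ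
      TensorProduct.map X.counit LinearMap.id) ∘ₗ assocC X.coact X.coact ρL =
      TensorProduct.map ((TensorProduct.rid k R).toLinearMap ∘ₗ
        TensorProduct.map LinearMap.id X.counit) LinearMap.id := by
    have e := assocC_natural (IsColinear.id X.coact) (isColinear_counit X) (IsColinear.id ρL)
    rw [← LinearMap.id_comp (LinearMap.id : R →ₗ[k] R), TensorProduct.map_comp,
      LinearMap.comp_assoc, ← e]
    refine TensorProduct.ext_threefold fun r s x => ?_
    simp only [LinearMap.comp_apply, TensorProduct.map_tmul, LinearMap.id_apply,
      LinearEquiv.coe_coe]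
    rw [assocC_of_assocCInv X.isComodule (isComodule_trivialCoact k) hL
      (assocCInv_of_mid rfl X.isComodule hL _ _)]
    simp [TensorProduct.smul_tmul]
  rw [comulMap, ← LinearMap.comp_assoc, h, ← TensorProduct.map_comp, LinearMap.comp_assoc,
    X.comul_counit, LinearMap.id_comp, TensorProduct.map_id]

theorem slice_bosComul (ξ : R ⊗[k] H →ₗ[k] k) :
    slice (R ⊗[k] H) ξ ∘ₗ bosComul X =
      TensorProduct.map LinearMap.id (coeffMap (bosCoact X) ξ) ∘ₗ
        comulMap X.coact X.comul Coalgebra.comul := by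
  rw [bosComul, ← LinearMap.comp_assoc, slice_expand]

/-- After contracting the last factor with `ξ`, both sides are `expand` applied to an iterate of
`comulMap` followed by the coefficient map of `ξ`. Naturality makes them the two iterates in
`comulMap_coassoc`. -/
theorem bosComul_coassoc : (TensorProduct.assoc k _ _ _).toLinearMap ∘ₗ
    TensorProduct.map (bosComul X) LinearMap.id ∘ₗ bosComul X =
    TensorProduct.map LinearMap.id (bosComul X) ∘ₗ bosComul X := by
  refine LinearMap.ext fun x => slice_mid_ext fun ξ => ?_
  have hξ := isColinear_coeffMap (isComodule_bosCoact X) ξ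
  have h₁ : TensorProduct.map LinearMap.id (slice (R ⊗[k] H) ξ) ∘ₗ
      (TensorProduct.assoc k _ _ _).toLinearMap ∘ₗ
      TensorProduct.map (bosComul X) LinearMap.id = bosComul X ∘ₗ slice (R ⊗[k] H) ξ := by
    refine TensorProduct.ext' fun y z => ?_
    simp only [LinearMap.comp_apply, TensorProduct.map_tmul, LinearMap.id_apply, slice_tmul,
      map_smul, LinearEquiv.coe_coe]
    induction bosComul X y using TensorProduct.induction_on with
    | zero => simp
    | add a b ha hb => simp_all [TensorProduct.add_tmul]
    | tmul a b => simp
  have h₂ := ((IsColinear.id X.coact).tensor hξ).comp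
    (isColinear_comulMap X.toYDModule X.comul_hom isComodule_comul)
  have h₃ := expand_natural R h₂
  rw [← slice_bosComul] at h₃
  have h₄ := LinearMap.congr_fun (comulMap_coassoc X isComodule_comul) x
  have h₅ := LinearMap.congr_fun (comulMap_natural_right X.coact X.comul hξ)
  have h₁' := LinearMap.congr_fun h₁
  simp only [LinearMap.comp_apply] at h₁' h₄ h₅ ⊢
  rw [h₁', TensorProduct.map_map, LinearMap.id_comp,
    ← LinearMap.comp_apply (slice _ _) (bosComul X), slice_bosComul]
  conv_rhs => rw [bosComul, LinearMap.comp_apply, ← LinearMap.comp_apply, ← slice_bosComul, ← h₃,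
    LinearMap.comp_apply, slice_bosComul]
  rw [bosComul, LinearMap.comp_apply, LinearMap.comp_apply, h₅, ← h₄, TensorProduct.map_map]
  rfl

theorem bosCounit_expand (hL : IsComodule ρL) :
    TensorProduct.map (bosCounit X) LinearMap.id ∘ₗ expand R ρL =
      TensorProduct.map X.counit LinearMap.id := by
  refine TensorProduct.ext' fun r x => ?_
  have hx := LinearMap.congr_fun hL.counit x
  simp only [LinearMap.comp_apply, LinearMap.id_apply, LinearEquiv.coe_coe] at hx
  conv_rhs => rw [← hx]
  simp only [expand, LinearMap.comp_apply, TensorProduct.map_tmul, LinearEquiv.coe_coe,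
    LinearMap.id_apply]
  induction ρL x using TensorProduct.induction_on with
  | zero => simp
  | add a b ha hb => simp_all [TensorProduct.tmul_add]
  | tmul h y => simp [bosCounit, TensorProduct.smul_tmul']; ring_nf

theorem counit_bosComul : TensorProduct.map (bosCounit X) LinearMap.id ∘ₗ bosComul X =
    TensorProduct.mk k k _ 1 := by
  have h := counit_comulMap X (isComodule_comul (k := k) (E := H))
  rw [bosComul, ← LinearMap.comp_assoc, bosCounit_expand X (isComodule_bosCoact X)]
  refine LinearMap.ext fun x => (TensorProduct.lid k _).injective ?_
  simpa using LinearMap.congr_fun h x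

theorem bosComul_counit : TensorProduct.map LinearMap.id (bosCounit X) ∘ₗ bosComul X =
    (TensorProduct.mk k _ k).flip 1 := by
  have h := slice_bosComul X (bosCounit X)
  rw [coeffMap_bosCounit, bosProj, comulMap_counit X isComodule_comul] at h
  refine LinearMap.ext fun x => (TensorProduct.rid k _).injective ?_
  simpa [slice] using LinearMap.congr_fun h x

/-- The coalgebra `R # H`. -/
noncomputable abbrev bosCoalgebra : Coalgebra k (R ⊗[k] H) where
  comul := bosComul X
  counit := bosCounit X
  coassoc := bosComul_coassoc X
  rTensor_counit_comp_comul := counit_bosComul X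
  lTensor_counit_comp_comul := bosComul_counit X

end Coalgebra

/-! ### The multiplication of `R # H` -/

section Multiplication

open DualQuasiBialgebra

variable {k H R : Type*} [Field k] [AddCommGroup H] [Module k H] [DualQuasiBialgebra k H]
  [AddCommGroup R] [Module k R]
  {L M : Type*} [AddCommGroup L] [Module k L] [AddCommGroup M] [Module k M]
  {ρL : L →ₗ[k] H ⊗[k] L} {ρM : M →ₗ[k] H ⊗[k] M} (X : YDBialgebra k H R)

/-- The multiplication of `R # H`. -/
noncomputable def bosMul : (R ⊗[k] H) ⊗[k] (R ⊗[k] H) →ₗ[k] R ⊗[k] H :=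
  TensorProduct.map LinearMap.id (m (k := k) (H := H)).toLinearMap ∘ₗ
    mulMap X.toPreYD X.mul Coalgebra.comul Coalgebra.comul

theorem isColinear_m : IsColinear (tensorCoaction Coalgebra.comul Coalgebra.comul) Coalgebra.comul
    (m (k := k) (H := H)).toLinearMap := by
  refine (m (k := k) (H := H)).map_comp_comul.symm.trans ?_
  rw [tensorCoaction_eq, push, ← LinearMap.comp_assoc, ← TensorProduct.map_comp, LinearMap.id_comp,
    LinearMap.comp_id]
  rfl

theorem isColinear_bosMul :
    IsColinear (tensorCoaction (bosCoact X) (bosCoact X)) (bosCoact X) (bosMul X) :=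
  ((IsColinear.id X.coact).tensor isColinear_m).comp
    (isColinear_mulMap X.toYDModule X.mul_hom isComodule_comul isComodule_comul)

/-- `expand` respects products: after contraction with `ξ ⊗ η` this is naturality of `mulMap` along
the coefficient maps of `L` and `M`. -/
theorem expand_mulMap (hL : IsComodule ρL) (hM : IsComodule ρM) :
    expand R (tensorCoaction ρL ρM) ∘ₗ mulMap X.toPreYD X.mul ρL ρM =
      TensorProduct.map (bosMul X) LinearMap.id ∘ₗ
        (TensorProduct.tensorTensorTensorComm k (R ⊗[k] H) L (R ⊗[k] H) M).toLinearMap ∘ₗ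
        TensorProduct.map (expand R ρL) (expand R ρM) := by
  refine LinearMap.ext fun x => slice_ext₂ fun ξ η => ?_
  have h₁ := mulMap_natural_right X.toPreYD X.mul (isColinear_coeffMap hL ξ)
    (isColinear_coeffMap hM η)
  have h₂ : slice (R ⊗[k] H) (tensorDual ξ η) ∘ₗ TensorProduct.map (bosMul X) LinearMap.id ∘ₗ
        (TensorProduct.tensorTensorTensorComm k (R ⊗[k] H) L (R ⊗[k] H) M).toLinearMap =
      bosMul X ∘ₗ TensorProduct.map (slice (R ⊗[k] H) ξ) (slice (R ⊗[k] H) η) := by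
    refine TensorProduct.ext_fourfold' fun a x b y => ?_
    simp [TensorProduct.smul_tmul, TensorProduct.tmul_smul, smul_smul, mul_comm]
  have h₂' := LinearMap.congr_fun h₂
  simp only [LinearMap.comp_apply] at h₂' ⊢
  rw [h₂', slice_expand_apply, TensorProduct.map_map, slice_expand, slice_expand,
    tensorCoaction_eq, coeffMap_push, coeffMap_outer, bosMul, LinearMap.comp_apply,
    ← LinearMap.comp_apply (mulMap _ _ _ _) (TensorProduct.map _ _), h₁, LinearMap.comp_apply,
    TensorProduct.map_map, LinearMap.id_comp]

/-- `comulMap_mulMap` handles the comonad map, and `expand_mulMap` at `L = M = R ⊗ H` handles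
`expand`; naturality along `m` and `bosMul` joins them. -/
theorem bosComul_bosMul : bosComul X ∘ₗ bosMul X =
    TensorProduct.map (bosMul X) (bosMul X) ∘ₗ
      (TensorProduct.tensorTensorTensorComm k _ _ _ _).toLinearMap ∘ₗ
      TensorProduct.map (bosComul X) (bosComul X) := by
  have hH := isComodule_comul (k := k) (E := H)
  have h₁ := comulMap_mulMap X hH hH
  have h₂ := comulMap_natural_right X.coact X.comul (isColinear_m (k := k) (H := H))
  have h₃ := expand_natural R (isColinear_bosMul X)
  have h₄ := expand_mulMap X (isComodule_bosCoact X) (isComodule_bosCoact X)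
  have h₅ : comulMap X.coact X.comul Coalgebra.comul ∘ₗ bosMul X =
      TensorProduct.map LinearMap.id (bosMul X) ∘ₗ
      mulMap X.toPreYD X.mul (bosCoact X) (bosCoact X) ∘ₗ TensorProduct.map
        (comulMap X.coact X.comul Coalgebra.comul) (comulMap X.coact X.comul Coalgebra.comul) := by
    rw [bosMul, ← LinearMap.comp_assoc, h₂, LinearMap.comp_assoc, h₁, ← LinearMap.comp_assoc,
      ← LinearMap.comp_assoc, ← TensorProduct.map_comp, LinearMap.id_comp, LinearMap.comp_assoc]
  refine LinearMap.ext fun x => ?_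
  have h₃' := LinearMap.congr_fun h₃
  have h₄' := LinearMap.congr_fun h₄
  have h₅' := LinearMap.congr_fun h₅ x
  simp only [LinearMap.comp_apply] at h₃' h₄' h₅'
  rw [bosComul, TensorProduct.map_comp]
  simp only [LinearMap.comp_apply]
  rw [h₅', h₃', h₄', TensorProduct.map_map, LinearMap.id_comp, LinearMap.comp_id]

/-- For the trivial bialgebra `k`, every constraint in the interchange has a coinvariant argument,
and the braiding reduces to the flip. -/
theorem mulMap_unitYD (hL : IsComodule ρL) (hM : IsComodule ρM) (a b : k) (x : L) (y : M) :
    mulMap (unitYD k H) (LinearMap.mul' k k) ρL ρM ((a ⊗ₜ[k] x) ⊗ₜ[k] (b ⊗ₜ[k] y)) =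
      (a * b) ⊗ₜ[k] (x ⊗ₜ[k] y) := by
  have hk : IsComodule (unitYD k H).coact := isComodule_trivialCoact k
  have hb : braid ρL (unitYD k H).act (x ⊗ₜ[k] b) = b ⊗ₜ[k] x := by
    have hx := LinearMap.congr_fun hL.counit x
    simp only [LinearMap.comp_apply, LinearMap.id_apply, LinearEquiv.coe_coe] at hx
    conv_rhs => rw [← hx]
    simp only [braid, LinearMap.comp_apply, TensorProduct.map_tmul, LinearEquiv.coe_coe,
      LinearMap.id_apply]
    induction ρL x using TensorProduct.induction_on with
    | zero => simp
    | add a b ha hb => simp_all [TensorProduct.add_tmul, TensorProduct.tmul_add]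
    | tmul h y => simp [unitYD, TensorProduct.smul_tmul', mul_comm]
  simp only [mulMap, interchange, LinearMap.comp_apply]
  rw [assocC_of_assocCInv hk hL (hk.tensor hM) (assocCInv_of_left rfl hL (hk.tensor hM) _ _)]
  simp only [TensorProduct.map_tmul, LinearMap.id_apply]
  rw [assocCInv_of_mid rfl hL hM]
  simp only [TensorProduct.map_tmul, LinearMap.id_apply]
  rw [hb, assocC_of_assocCInv hk hL hM (assocCInv_of_left rfl hL hM _ _),
    assocCInv_of_left rfl hk (hL.tensor hM)]
  simp

/-- `ε_R : R ⟶ k` is a Yetter–Drinfeld morphism of algebras, so naturality of `mulMap` reduces the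
claim to `R = k`. -/
theorem bosProj_bosMul : bosProj X ∘ₗ bosMul X =
    (m (k := k) (H := H)).toLinearMap ∘ₗ TensorProduct.map (bosProj X) (bosProj X) := by
  have hH := isComodule_comul (k := k) (E := H)
  have h₁ := mulMap_natural X.counit_hom X.counit_mul.symm (IsColinear.id Coalgebra.comul)
    (IsColinear.id Coalgebra.comul)
  have h₂ : bosProj X ∘ₗ bosMul X = (m (k := k) (H := H)).toLinearMap ∘ₗ
      (TensorProduct.lid k (H ⊗[k] H)).toLinearMap ∘ₗ
      TensorProduct.map X.counit (TensorProduct.map LinearMap.id LinearMap.id) ∘ₗ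
      mulMap X.toPreYD X.mul Coalgebra.comul Coalgebra.comul := by
    rw [bosMul, ← LinearMap.comp_assoc, ← LinearMap.comp_assoc, ← LinearMap.comp_assoc]
    congr 1
    refine TensorProduct.ext' fun r x => ?_
    simp [bosProj]
  rw [h₂, ← h₁]
  refine TensorProduct.ext_fourfold' fun r h s l => ?_
  simp only [LinearMap.comp_apply, TensorProduct.map_tmul, LinearMap.id_apply]
  rw [mulMap_unitYD hH hH]
  simp [bosProj, TensorProduct.smul_tmul, TensorProduct.tmul_smul, smul_smul, mul_comm]

/-- The inclusion `h ↦ 1 ⊗ h`. -/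
noncomputable def bosIncl : H →ₗ[k] R ⊗[k] H := TensorProduct.mk k R H (X.unit 1)

theorem mul_unit_unit : X.mul ∘ₗ TensorProduct.map X.unit X.unit =
    X.unit ∘ₗ LinearMap.mul' k k := by
  refine TensorProduct.ext' fun a b => ?_
  have := LinearMap.congr_fun X.one_mul (a ⊗ₜ[k] X.unit b)
  refine Eq.trans ?_ (map_smul X.unit a b).symm
  simpa using this

/-- The same reduction to `k`, along `u_R : k ⟶ R`. -/
theorem bosMul_bosIncl (h l : H) :
    bosMul X (bosIncl X h ⊗ₜ[k] bosIncl X l) = bosIncl X (mulH k h l) := by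
  have hH := isComodule_comul (k := k) (E := H)
  have h₁ := LinearMap.congr_fun (mulMap_natural X.unit_hom (mul_unit_unit X)
    (IsColinear.id Coalgebra.comul) (IsColinear.id Coalgebra.comul))
    (((1 : k) ⊗ₜ[k] h) ⊗ₜ[k] ((1 : k) ⊗ₜ[k] l))
  simp only [LinearMap.comp_apply, TensorProduct.map_tmul, LinearMap.id_apply] at h₁
  rw [mulMap_unitYD hH hH, TensorProduct.map_id] at h₁
  rw [bosMul, LinearMap.comp_apply, bosIncl, TensorProduct.mk_apply, TensorProduct.mk_apply, h₁]
  simp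

theorem coact_unit : X.coact (X.unit 1) = oneH k H ⊗ₜ[k] X.unit 1 :=
  LinearMap.congr_fun X.unit_hom.colinear 1

theorem act_unit (h : H) : X.act (h ⊗ₜ[k] X.unit 1) = ε k h • X.unit 1 := by
  have := LinearMap.congr_fun X.unit_hom.linear (h ⊗ₜ[k] (1 : k))
  simp only [LinearMap.comp_apply, TensorProduct.map_tmul, LinearMap.id_apply] at this
  rw [← this]
  simp [unitYD, ← map_smul]

/-- Each constraint meets the coinvariant `1_R` or `1_H` and is trivial there; the braiding is
trivial by `one_act`. -/
theorem bosMul_one_left (x : R ⊗[k] H) : bosMul X ((X.unit 1 ⊗ₜ[k] oneH k H) ⊗ₜ[k] x) = x := by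
  have hH := isComodule_comul (k := k) (E := H)
  have hX := X.isComodule
  have h₁ := comul_oneH k H
  have hr := fun r => LinearMap.congr_fun X.one_mul ((1 : k) ⊗ₜ[k] r)
  simp only [LinearMap.comp_apply, TensorProduct.map_tmul, LinearMap.id_apply, LinearEquiv.coe_coe,
    TensorProduct.lid_tmul, one_smul] at hr
  induction x using TensorProduct.induction_on with
  | zero => simp
  | add a b ha hb => rw [TensorProduct.tmul_add, map_add, ha, hb]
  | tmul r h =>
    simp only [bosMul, mulMap, interchange, LinearMap.comp_apply]
    rw [assocC_of_assocCInv hX hH (hX.tensor hH)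
      (assocCInv_of_left (coact_unit X) hH (hX.tensor hH) _ _)]
    simp only [TensorProduct.map_tmul, LinearMap.id_apply]
    rw [assocCInv_of_left h₁ hX hH]
    simp only [TensorProduct.map_tmul, LinearMap.id_apply]
    rw [show braid Coalgebra.comul X.act (oneH k H ⊗ₜ[k] r) = r ⊗ₜ[k] oneH k H by
      simp [braid, h₁, X.one_act], assocC_of_assocCInv hX hH hH (assocCInv_of_mid h₁ hX hH _ _),
      assocCInv_of_left (coact_unit X) hX (hH.tensor hH)]
    simp only [TensorProduct.map_tmul, LinearMap.id_apply, hr]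
    exact congrArg (r ⊗ₜ[k] ·) (one_m h)

theorem bosMul_one_right (x : R ⊗[k] H) : bosMul X (x ⊗ₜ[k] (X.unit 1 ⊗ₜ[k] oneH k H)) = x := by
  have hH := isComodule_comul (k := k) (E := H)
  have hX := X.isComodule
  have h₁ := comul_oneH k H
  have hr := fun r => LinearMap.congr_fun X.mul_one (r ⊗ₜ[k] (1 : k))
  simp only [LinearMap.comp_apply, TensorProduct.map_tmul, LinearMap.id_apply, LinearEquiv.coe_coe,
    TensorProduct.rid_tmul, one_smul] at hr
  induction x using TensorProduct.induction_on with
  | zero => simp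
  | add a b ha hb => rw [TensorProduct.add_tmul, map_add, ha, hb]
  | tmul r h =>
    have hb : braid Coalgebra.comul X.act (h ⊗ₜ[k] X.unit 1) = X.unit 1 ⊗ₜ[k] h := by
      have hx := LinearMap.congr_fun hH.counit h
      simp only [LinearMap.comp_apply, LinearMap.id_apply, LinearEquiv.coe_coe] at hx
      conv_rhs => rw [← hx]
      simp only [braid, LinearMap.comp_apply, TensorProduct.map_tmul, LinearEquiv.coe_coe,
        LinearMap.id_apply]
      induction Coalgebra.comul (R := k) h using TensorProduct.induction_on with
      | zero => simp
      | add a b ha hb => simp_all [TensorProduct.add_tmul, TensorProduct.tmul_add]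
      | tmul h y => simp [act_unit, TensorProduct.smul_tmul]
    simp only [bosMul, mulMap, interchange, LinearMap.comp_apply]
    have h₂ : tensorCoaction X.coact Coalgebra.comul (X.unit 1 ⊗ₜ[k] oneH k H) =
        oneH k H ⊗ₜ[k] (X.unit 1 ⊗ₜ[k] oneH k H) := by
      simp [tensorCoaction, coact_unit, h₁, one_m]
    rw [assocC_of_assocCInv hX hH (hX.tensor hH) (assocCInv_of_right h₂ hX hH _ _)]
    simp only [TensorProduct.map_tmul, LinearMap.id_apply]
    rw [assocCInv_of_right h₁ hH hX]
    simp only [TensorProduct.map_tmul, LinearMap.id_apply]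
    rw [hb, assocC_of_assocCInv hX hH hH (assocCInv_of_left (coact_unit X) hH hH _ _),
      assocCInv_of_mid (coact_unit X) hX (hH.tensor hH)]
    simp only [TensorProduct.map_tmul, LinearMap.id_apply, hr]
    exact congrArg (r ⊗ₜ[k] ·) (m_one h)

end Multiplication

/-! ### Pulling back the reassociator -/

section Pullback

open DualQuasiBialgebra

/-- Precomposition with a coalgebra map preserves convolution, so the convolution identities for `ω`
can be pulled back along tensor powers of `π`. -/
theorem conv_comp {k C D A B E : Type*} [Field k] [AddCommMonoid C] [Module k C] [Coalgebra k C]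
    [AddCommMonoid D] [Module k D] [Coalgebra k D] [AddCommMonoid A] [Module k A]
    [AddCommMonoid B] [Module k B] [AddCommMonoid E] [Module k E] (p : A ⊗[k] B →ₗ[k] E)
    (f : D →ₗ[k] A) (g : D →ₗ[k] B) (α : C →ₗc[k] D) :
    conv p (f ∘ₗ α.toLinearMap) (g ∘ₗ α.toLinearMap) = conv p f g ∘ₗ α.toLinearMap := by
  rw [conv, conv, TensorProduct.map_comp, LinearMap.comp_assoc, α.map_comp_comul]
  rfl

variable {k H C : Type*} [Field k] [AddCommGroup H] [Module k H]
  [AddCommGroup C] [Module k C] [Coalgebra k C]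

/-- `φ(π ⊗ π ⊗ π)` -/
noncomputable def pullback₃ (φ : (H ⊗[k] H) ⊗[k] H →ₗ[k] k) (π : C →ₗ[k] H) :
    (C ⊗[k] C) ⊗[k] C →ₗ[k] k :=
  φ ∘ₗ TensorProduct.map (TensorProduct.map π π) π

variable [DualQuasiBialgebra k H] (π : C →ₗc[k] H)

theorem conv_pullback₃ (φ ψ : (H ⊗[k] H) ⊗[k] H →ₗ[k] k)
    (h : conv (LinearMap.mul' k k) φ ψ = Coalgebra.counit) :
    conv (LinearMap.mul' k k) (pullback₃ φ π.toLinearMap) (pullback₃ ψ π.toLinearMap) =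
      Coalgebra.counit := by
  have e := conv_comp (LinearMap.mul' k k) φ ψ
    (Coalgebra.TensorProduct.map (Coalgebra.TensorProduct.map π π) π)
  rw [h] at e
  exact e.trans (Coalgebra.TensorProduct.map (Coalgebra.TensorProduct.map π π) π).counit_comp

theorem cocycle_pullback₃ {mC : C ⊗[k] C →ₗ[k] C} (h : π.toLinearMap ∘ₗ mC =
      (m (k := k) (H := H)).toLinearMap ∘ₗ TensorProduct.map π.toLinearMap π.toLinearMap) :
    conv (LinearMap.mul' k k) (ωHHm (pullback₃ ω π.toLinearMap) mC)
      (ωmHH (pullback₃ ω π.toLinearMap) mC) =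
    conv (LinearMap.mul' k k)
      (conv (LinearMap.mul' k k) (εω Coalgebra.counit (pullback₃ ω π.toLinearMap))
        (ωHmH (pullback₃ ω π.toLinearMap) mC))
      (ωε Coalgebra.counit (pullback₃ ω π.toLinearMap)) := by
  have h' := LinearMap.congr_fun h
  have hε := LinearMap.congr_fun π.counit_comp
  obtain ⟨α, hα⟩ : ∃ α : ((C ⊗[k] C) ⊗[k] C) ⊗[k] C →ₗc[k] ((H ⊗[k] H) ⊗[k] H) ⊗[k] H,
      α.toLinearMap = TensorProduct.map (TensorProduct.map (TensorProduct.map π.toLinearMap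
        π.toLinearMap) π.toLinearMap) π.toLinearMap :=
    ⟨Coalgebra.TensorProduct.map (Coalgebra.TensorProduct.map
      (Coalgebra.TensorProduct.map π π) π) π, rfl⟩
  simp only [LinearMap.comp_apply] at h' hε
  have h₁ : ωHHm (pullback₃ ω π.toLinearMap) mC = ωHHm ω (m (k := k)).toLinearMap ∘ₗ
      α.toLinearMap := by
    rw [hα]
    refine TensorProduct.ext_fourfold fun a b c d => ?_
    simp only [ωHHm, pullback₃, LinearMap.comp_apply, TensorProduct.map_tmul, LinearEquiv.coe_coe,
      TensorProduct.assoc_tmul, LinearMap.id_apply, h']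
  have h₂ : ωmHH (pullback₃ ω π.toLinearMap) mC = ωmHH ω (m (k := k)).toLinearMap ∘ₗ
      α.toLinearMap := by
    rw [hα]
    refine TensorProduct.ext_fourfold fun a b c d => ?_
    simp only [ωmHH, pullback₃, LinearMap.comp_apply, TensorProduct.map_tmul,
      LinearMap.id_apply, h']
  have h₃ : ωHmH (pullback₃ ω π.toLinearMap) mC = ωHmH ω (m (k := k)).toLinearMap ∘ₗ
      α.toLinearMap := by
    rw [hα]
    refine TensorProduct.ext_fourfold fun a b c d => ?_
    simp only [ωHmH, pullback₃, LinearMap.comp_apply, TensorProduct.map_tmul, LinearEquiv.coe_coe,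
      TensorProduct.assoc_tmul, LinearMap.id_apply, h']
  have h₄ : εω Coalgebra.counit (pullback₃ ω π.toLinearMap) = εω Coalgebra.counit ω ∘ₗ
      α.toLinearMap := by
    rw [hα]
    refine TensorProduct.ext_fourfold fun a b c d => ?_
    simp only [εω, pullback₃, LinearMap.comp_apply, TensorProduct.map_tmul, LinearEquiv.coe_coe,
      TensorProduct.assoc_tmul, TensorProduct.assoc_symm_tmul, LinearMap.id_apply, hε]
  have h₅ : ωε Coalgebra.counit (pullback₃ ω π.toLinearMap) = ωε Coalgebra.counit ω ∘ₗ
      α.toLinearMap := by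
    rw [hα]
    refine TensorProduct.ext_fourfold fun a b c d => ?_
    simp only [ωε, pullback₃, LinearMap.comp_apply, TensorProduct.map_tmul, hε]
  rw [h₁, h₂, h₃, h₄, h₅, conv_comp, conv_comp, conv_comp, cocycle]

end Pullback

/-! ### Translations of a coalgebra -/

section Translations

variable {k E A : Type*} [Field k] [AddCommGroup E] [Module k E] [Coalgebra k E]
  [AddCommGroup A] [Module k A]

/-- Convolution with a functional on the right is precomposition with the translation `x ↦ x₁
φ(x₂)`; on the left, by `conv_lid`, with `x ↦ φ(x₁) x₂`. -/
theorem conv_rid (f : E →ₗ[k] A) (φ : E →ₗ[k] k) :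
    conv (TensorProduct.rid k A).toLinearMap f φ = f ∘ₗ coeffMap Coalgebra.comul φ := by
  rw [conv, ← LinearMap.comp_assoc, coeffMap, ← LinearMap.comp_assoc]
  congr 1
  ext; simp

theorem conv_lid (φ : E →ₗ[k] k) (f : E →ₗ[k] A) :
    conv (TensorProduct.lid k A).toLinearMap φ f = f ∘ₗ coactBy Coalgebra.comul φ := by
  rw [conv, ← LinearMap.comp_assoc, coactBy, ← LinearMap.comp_assoc, ← LinearMap.comp_assoc]
  congr 1
  ext; simp

theorem coeffMap_conv (φ ψ : E →ₗ[k] k) :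
    coeffMap (Coalgebra.comul : E →ₗ[k] E ⊗[k] E) (conv (LinearMap.mul' k k) φ ψ) =
      coeffMap Coalgebra.comul φ ∘ₗ coeffMap Coalgebra.comul ψ := by
  rw [coeffMap_comp (isColinear_coeffMap isComodule_comul ψ), ← conv_rid]
  congr 2
  ext; simp

theorem coeffMap_comul_counit_eq :
    coeffMap (Coalgebra.comul : E →ₗ[k] E ⊗[k] E) Coalgebra.counit = LinearMap.id := by
  refine LinearMap.ext fun x => ?_
  simp [coeffMap, slice, ← LinearMap.lTensor_def, Coalgebra.lTensor_counit_comul]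

/-- Left and right translations commute, because right translations are colinear. -/
theorem coactBy_coeffMap (φ ψ : E →ₗ[k] k) :
    coactBy Coalgebra.comul φ ∘ₗ coeffMap (Coalgebra.comul : E →ₗ[k] E ⊗[k] E) ψ =
      coeffMap Coalgebra.comul ψ ∘ₗ coactBy Coalgebra.comul φ :=
  coactBy_natural (isColinear_coeffMap isComodule_comul ψ) φ

/-- `g ∗ φ = φ ∗ f` if and only if `ψ ∗ g = f ∗ ψ`, for `ψ` the convolution inverse of `φ`. -/
theorem conv_conj_iff {f g : E →ₗ[k] A} {φ ψ : E →ₗ[k] k}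
    (h : conv (LinearMap.mul' k k) φ ψ = Coalgebra.counit)
    (h' : conv (LinearMap.mul' k k) ψ φ = Coalgebra.counit) :
    g ∘ₗ coeffMap Coalgebra.comul φ = f ∘ₗ coactBy Coalgebra.comul φ ↔
      g ∘ₗ coactBy Coalgebra.comul ψ = f ∘ₗ coeffMap Coalgebra.comul ψ := by
  have hE := isComodule_comul (k := k) (E := E)
  have c₁ := coeffMap_conv φ ψ
  have c₂ := coeffMap_conv ψ φ
  have a₁ := hE.coactBy_conv φ ψ
  have a₂ := hE.coactBy_conv ψ φ
  rw [h, coeffMap_comul_counit_eq] at c₁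
  rw [h', coeffMap_comul_counit_eq] at c₂
  rw [h, hE.coactBy_counit] at a₁
  rw [h', hE.coactBy_counit] at a₂
  constructor
  · intro e
    calc g ∘ₗ coactBy Coalgebra.comul ψ
        -- Two mutually inverse right translations are inserted. The hypothesis then trades the one
        -- by `φ` for a left translation, which cancels against the one by `ψ`.
        = g ∘ₗ (coeffMap Coalgebra.comul φ ∘ₗ coeffMap Coalgebra.comul ψ) ∘ₗ
            coactBy Coalgebra.comul ψ := by rw [← c₁, LinearMap.id_comp]
      _ = (g ∘ₗ coeffMap Coalgebra.comul φ) ∘ₗ coactBy Coalgebra.comul ψ ∘ₗ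
            coeffMap Coalgebra.comul ψ := by rw [coactBy_coeffMap]; rfl
      _ = f ∘ₗ (coactBy Coalgebra.comul φ ∘ₗ coactBy Coalgebra.comul ψ) ∘ₗ
            coeffMap Coalgebra.comul ψ := by rw [e]; rfl
      _ = _ := by rw [← a₂, LinearMap.id_comp]
  · intro e
    calc g ∘ₗ coeffMap Coalgebra.comul φ
        = g ∘ₗ (coactBy Coalgebra.comul ψ ∘ₗ coactBy Coalgebra.comul φ) ∘ₗ
            coeffMap Coalgebra.comul φ := by rw [← a₁, LinearMap.id_comp]
      _ = (g ∘ₗ coactBy Coalgebra.comul ψ) ∘ₗ coeffMap Coalgebra.comul φ ∘ₗ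
            coactBy Coalgebra.comul φ := by rw [← coactBy_coeffMap]; rfl
      _ = f ∘ₗ (coeffMap Coalgebra.comul ψ ∘ₗ coeffMap Coalgebra.comul φ) ∘ₗ
            coactBy Coalgebra.comul φ := by rw [e]; rfl
      _ = _ := by rw [← c₂, LinearMap.id_comp]

end Translations

/-! ### The dual quasi-bialgebra `R # H` -/

section Bosonization

open DualQuasiBialgebra

variable {k H R : Type*} [Field k] [AddCommGroup H] [Module k H] [DualQuasiBialgebra k H]
  [AddCommGroup R] [Module k R] {L : Type*} [AddCommGroup L] [Module k L]
  {ρL : L →ₗ[k] H ⊗[k] L} (X : YDBialgebra k H R)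

theorem bosProj_expand (ρL : L →ₗ[k] H ⊗[k] L) :
    TensorProduct.map (bosProj X) LinearMap.id ∘ₗ expand R ρL =
      ρL ∘ₗ (TensorProduct.lid k L).toLinearMap ∘ₗ TensorProduct.map X.counit LinearMap.id := by
  refine TensorProduct.ext' fun r x => ?_
  simp only [expand, LinearMap.comp_apply, TensorProduct.map_tmul, LinearEquiv.coe_coe,
    LinearMap.id_apply, TensorProduct.lid_tmul, map_smul]
  induction ρL x using TensorProduct.induction_on with
  | zero => simp
  | add a b ha hb => simp_all [TensorProduct.tmul_add]
  | tmul h y => simp [bosProj, TensorProduct.smul_tmul']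

/-- The coaction of `H` on `R # H` induced by `π` is the diagonal one. Hence `π` is a coalgebra map,
and left translations by pulled-back functionals are the constraints of comodules. -/
theorem push_bosProj_bosComul : push (bosProj X) (bosComul X) = bosCoact X := by
  rw [push, bosComul, ← LinearMap.comp_assoc, bosProj_expand, LinearMap.comp_assoc,
    counit_comulMap X isComodule_comul, LinearMap.comp_id]

theorem isColinear_bosProj : IsColinear (bosCoact X) Coalgebra.comul (bosProj X) := by
  rw [← coeffMap_bosCounit]
  exact isColinear_coeffMap (isComodule_bosCoact X) _

/-- Right translation of `R # H` by a functional factoring through `π` affects only the factor `H`.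
-/
theorem coeffMap_bosComul (φ : H →ₗ[k] k) : coeffMap (bosComul X) (φ ∘ₗ bosProj X) =
    TensorProduct.map LinearMap.id (coeffMap Coalgebra.comul φ) := by
  have h := comulMap_counit X (isComodule_comul (k := k) (E := H))
  rw [coeffMap, slice_bosComul, ← coeffMap_comp (isColinear_bosProj X),
    ← LinearMap.id_comp (LinearMap.id : R →ₗ[k] R), TensorProduct.map_comp, LinearMap.comp_assoc]
  rw [bosProj, h, LinearMap.comp_id, LinearMap.id_comp]

/-- The projection as a morphism of coalgebras. -/
noncomputable def bosProjHom : letI := bosCoalgebra X; R ⊗[k] H →ₗc[k] H :=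
  letI := bosCoalgebra X
  { bosProj X with
    counit_comp := by
      change Coalgebra.counit ∘ₗ bosProj X = bosCounit X
      refine TensorProduct.ext' fun r h => ?_
      simp [bosProj, bosCounit]
    map_comp_comul := by
      have h := isColinear_bosProj X
      unfold IsColinear at h
      refine Eq.trans ?_ h.symm
      rw [← push_bosProj_bosComul, push, ← LinearMap.comp_assoc, ← TensorProduct.map_comp]
      rfl }

theorem isColinear_bosIncl : IsColinear Coalgebra.comul (bosCoact X) (bosIncl X) := by
  refine LinearMap.ext fun h => ?_
  simp only [bosIncl, bosCoact, tensorCoaction, LinearMap.comp_apply, TensorProduct.mk_apply,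
    TensorProduct.map_tmul, coact_unit, LinearEquiv.coe_coe]
  induction Coalgebra.comul (R := k) h using TensorProduct.induction_on with
  | zero => simp
  | add a b ha hb => simp_all [TensorProduct.tmul_add]
  | tmul h y => simp [one_m]

theorem comulMap_bosIncl (h : H) : comulMap X.coact X.comul Coalgebra.comul (bosIncl X h) =
    X.unit 1 ⊗ₜ[k] bosIncl X h := by
  have hu := LinearMap.congr_fun X.comul_unit 1
  simp only [LinearMap.comp_apply, LinearEquiv.coe_coe, TensorProduct.lid_symm_apply,
    TensorProduct.map_tmul] at hu
  simp only [comulMap, bosIncl, LinearMap.comp_apply, TensorProduct.mk_apply,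
    TensorProduct.map_tmul, hu, LinearMap.id_apply]
  exact assocC_of_assocCInv X.isComodule X.isComodule isComodule_comul
    (assocCInv_of_left (coact_unit X) X.isComodule isComodule_comul _ _)

/-- The inclusion as a morphism of coalgebras. -/
noncomputable def bosInclHom : letI := bosCoalgebra X; H →ₗc[k] R ⊗[k] H :=
  letI := bosCoalgebra X
  { bosIncl X with
    counit_comp := by
      have hu : X.counit (X.unit 1) = 1 := LinearMap.congr_fun X.counit_unit 1
      change bosCounit X ∘ₗ bosIncl X = Coalgebra.counit
      refine LinearMap.ext fun h => ?_
      simp [bosIncl, bosCounit, hu]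
    map_comp_comul := by
      refine LinearMap.ext fun h => slice_ext fun ξ => ?_
      have h₁ := LinearMap.congr_fun (slice_bosComul X ξ) (bosIncl X h)
      have h₂ := LinearMap.congr_fun (coeffMap_comp (isColinear_bosIncl X) ξ) h
      simp only [LinearMap.comp_apply] at h₁ h₂
      refine Eq.trans ?_ h₁.symm
      rw [comulMap_bosIncl, TensorProduct.map_tmul, h₂, LinearMap.comp_apply, slice_map_apply]
      rfl }

/-- The multiplication as a morphism of coalgebras. -/
noncomputable def bosMulHom :
    letI := bosCoalgebra X; (R ⊗[k] H) ⊗[k] (R ⊗[k] H) →ₗc[k] R ⊗[k] H :=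
  letI := bosCoalgebra X
  { bosMul X with
    counit_comp := by
      have h₁ : bosCounit X = Coalgebra.counit ∘ₗ bosProj X := (bosProjHom X).counit_comp.symm
      have h₂ := LinearMap.congr_fun (bosProj_bosMul X)
      have h₃ := LinearMap.congr_fun (m (k := k) (H := H)).counit_comp
      simp only [LinearMap.comp_apply] at h₂ h₃
      refine TensorProduct.ext' fun x y => ?_
      change bosCounit X (bosMul X (x ⊗ₜ[k] y)) = Coalgebra.counit (R := k) (x ⊗ₜ[k] y)
      rw [TensorProduct.counit_tmul, h₁, LinearMap.comp_apply, h₂, h₃, TensorProduct.map_tmul,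
        TensorProduct.counit_tmul]
      change _ = bosCounit X y • bosCounit X x
      rw [h₁]
      rfl
    map_comp_comul := (bosComul_bosMul X).symm }

/-- Naturality along `m` postpones both multiplications in `H` to the end, separating the part to
which `mulMap_assoc` applies. -/
theorem bosMul_left : mL (bosMul X) =
    TensorProduct.map LinearMap.id (mL (m (k := k) (H := H)).toLinearMap) ∘ₗ
      mulMap X.toPreYD X.mul (tensorCoaction Coalgebra.comul Coalgebra.comul) Coalgebra.comul ∘ₗ
      TensorProduct.map (mulMap X.toPreYD X.mul Coalgebra.comul Coalgebra.comul)
        LinearMap.id := by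
  have h := mulMap_natural_right X.toPreYD X.mul (isColinear_m (k := k) (H := H))
    (IsColinear.id Coalgebra.comul)
  rw [TensorProduct.map_id] at h
  refine LinearMap.ext fun x => ?_
  have h' := LinearMap.congr_fun h
  simp only [LinearMap.comp_apply] at h'
  rw [mL, mL, bosMul, ← LinearMap.id_comp (LinearMap.id : R ⊗[k] H →ₗ[k] R ⊗[k] H),
    TensorProduct.map_comp]
  simp only [LinearMap.comp_apply]
  rw [h', TensorProduct.map_map, LinearMap.id_comp, LinearMap.id_comp]

theorem bosMul_right : bosMul X ∘ₗ TensorProduct.map LinearMap.id (bosMul X) =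
    TensorProduct.map LinearMap.id ((m (k := k) (H := H)).toLinearMap ∘ₗ
      TensorProduct.map LinearMap.id (m (k := k) (H := H)).toLinearMap) ∘ₗ
      mulMap X.toPreYD X.mul Coalgebra.comul (tensorCoaction Coalgebra.comul Coalgebra.comul) ∘ₗ
      TensorProduct.map LinearMap.id
        (mulMap X.toPreYD X.mul Coalgebra.comul Coalgebra.comul) := by
  have h := mulMap_natural_right X.toPreYD X.mul (IsColinear.id Coalgebra.comul)
    (isColinear_m (k := k) (H := H))
  rw [TensorProduct.map_id] at h
  refine LinearMap.ext fun x => ?_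
  have h' := LinearMap.congr_fun h
  simp only [LinearMap.comp_apply] at h'
  rw [bosMul, ← LinearMap.id_comp (LinearMap.id : R ⊗[k] H →ₗ[k] R ⊗[k] H),
    TensorProduct.map_comp]
  simp only [LinearMap.comp_apply]
  rw [h', TensorProduct.map_map, LinearMap.id_comp, LinearMap.id_comp]

/-- The threefold product commutes with the right translations. -/
theorem mulMap_translate (φ : (H ⊗[k] H) ⊗[k] H →ₗ[k] k) :
    TensorProduct.map LinearMap.id (coeffMap Coalgebra.comul φ) ∘ₗ
      mulMap X.toPreYD X.mul (tensorCoaction Coalgebra.comul Coalgebra.comul) Coalgebra.comul ∘ₗ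
      TensorProduct.map (mulMap X.toPreYD X.mul Coalgebra.comul Coalgebra.comul) LinearMap.id =
    (mulMap X.toPreYD X.mul (tensorCoaction Coalgebra.comul Coalgebra.comul) Coalgebra.comul ∘ₗ
      TensorProduct.map (mulMap X.toPreYD X.mul Coalgebra.comul Coalgebra.comul) LinearMap.id) ∘ₗ
      coeffMap (outer (outer (bosComul X) (bosComul X)) (bosComul X))
        (pullback₃ φ (bosProj X)) := by
  obtain ⟨N, hN⟩ : ∃ N, N =
    mulMap X.toPreYD X.mul (tensorCoaction Coalgebra.comul Coalgebra.comul) Coalgebra.comul ∘ₗ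
      TensorProduct.map (mulMap X.toPreYD X.mul Coalgebra.comul Coalgebra.comul) LinearMap.id :=
    ⟨_, rfl⟩
  rw [← hN]
  have hs := slice_map_apply (k := k) (U := ((R ⊗[k] H) ⊗[k] (R ⊗[k] H)) ⊗[k] (R ⊗[k] H))
    (V := R ⊗[k] ((H ⊗[k] H) ⊗[k] H)) (W := ((R ⊗[k] H) ⊗[k] (R ⊗[k] H)) ⊗[k] (R ⊗[k] H))
    (X := (H ⊗[k] H) ⊗[k] H)
  -- A general `φ` on `H ⊗ H ⊗ H` is not a product functional, so its translation is not a tensor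
  -- product of comodule maps. The identity is therefore proved before contraction, by testing on
  -- products `a ⊗ b ⊗ c`, where naturality applies; `φ` is applied only afterwards.
  have key : expand R Coalgebra.comul ∘ₗ N =
      TensorProduct.map N (TensorProduct.map (TensorProduct.map (bosProj X) (bosProj X))
        (bosProj X)) ∘ₗ outer (outer (bosComul X) (bosComul X)) (bosComul X) := by
    refine LinearMap.ext fun x => slice_ext₃ fun a b c => ?_
    have ha := isColinear_coeffMap (isComodule_comul (k := k) (E := H)) a
    have hb := isColinear_coeffMap (isComodule_comul (k := k) (E := H)) b
    have hc := isColinear_coeffMap (isComodule_comul (k := k) (E := H)) c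
    have h₁ := square_comp (mulMap_natural_right X.toPreYD X.mul (ha.tensor hb) hc)
      (square_rTensor (mulMap_natural_right X.toPreYD X.mul ha hb)
        (TensorProduct.map LinearMap.id (coeffMap Coalgebra.comul c)))
    rw [← hN] at h₁
    have h₂ : coeffMap (Coalgebra.comul (R := k) (A := (H ⊗[k] H) ⊗[k] H))
        (tensorDual (tensorDual a b) c) =
        TensorProduct.map (TensorProduct.map (coeffMap Coalgebra.comul a)
          (coeffMap Coalgebra.comul b)) (coeffMap Coalgebra.comul c) := by
      rw [← coeffMap_outer, ← coeffMap_outer]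
      rfl
    have h₃ : coeffMap (outer (outer (bosComul X) (bosComul X)) (bosComul X))
        (tensorDual (tensorDual a b) c ∘ₗ TensorProduct.map
          (TensorProduct.map (bosProj X) (bosProj X)) (bosProj X)) =
        TensorProduct.map (TensorProduct.map
          (TensorProduct.map LinearMap.id (coeffMap Coalgebra.comul a))
          (TensorProduct.map LinearMap.id (coeffMap Coalgebra.comul b)))
          (TensorProduct.map LinearMap.id (coeffMap Coalgebra.comul c)) := by
      rw [tensorDual_comp, tensorDual_comp, coeffMap_outer, coeffMap_outer, coeffMap_bosComul,
        coeffMap_bosComul, coeffMap_bosComul]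
    have h₁' := LinearMap.congr_fun h₁ x
    have h₃' := LinearMap.congr_fun h₃ x
    simp only [LinearMap.comp_apply] at h₁'
    rw [LinearMap.comp_apply, LinearMap.comp_apply, slice_expand_apply, h₂, hs]
    exact h₁'.symm.trans (congrArg N h₃'.symm)
  refine LinearMap.ext fun x => ?_
  have h := congrArg (slice _ φ) (LinearMap.congr_fun key x)
  rw [LinearMap.comp_apply, LinearMap.comp_apply, slice_expand_apply,
    hs] at h
  exact h

theorem coactBy_pullback₃ (φ : (H ⊗[k] H) ⊗[k] H →ₗ[k] k) :
    coactBy (outer (outer (bosComul X) (bosComul X)) (bosComul X)) (pullback₃ φ (bosProj X)) =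
      twist φ (bosCoact X) (bosCoact X) (bosCoact X) := by
  have h := isColinearAlong_push (bosProj X) (bosComul X)
  have h' := coactBy_comp ((h.outer h).outer h) φ
  rw [TensorProduct.map_id, TensorProduct.map_id, LinearMap.comp_id, LinearMap.id_comp] at h'
  rw [twist_eq, ← push_bosProj_bosComul]
  exact h'.symm

-- By `conv_conj_iff` it is enough to treat the form with `ω⁻¹`. There left translation is the twist
-- in the associativity constraint, `mulMap_assoc` moves the constraint onto the factor `H`,
-- quasi-associativity of `H` makes it a right translation, and `mulMap_translate` returns it to `R
-- # H`.
set_option maxRecDepth 10000 in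
theorem bosMul_quasi_assoc : letI := bosCoalgebra X;
    conv (TensorProduct.rid k (R ⊗[k] H)).toLinearMap (mR (bosMul X))
      (pullback₃ ω (bosProj X)) =
    conv (TensorProduct.lid k (R ⊗[k] H)).toLinearMap (pullback₃ ω (bosProj X))
      (mL (bosMul X)) := by
  let := bosCoalgebra X
  have hH := isComodule_comul (k := k) (E := H)
  have hH₁ : mR (m (k := k) (H := H)).toLinearMap ∘ₗ twist ωInv Coalgebra.comul Coalgebra.comul
      Coalgebra.comul = mL (m (k := k) (H := H)).toLinearMap ∘ₗ coeffMap Coalgebra.comul ωInv := by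
    have h := quasi_assoc (k := k) (H := H)
    rw [conv_rid, conv_lid] at h
    exact (conv_conj_iff ω_conv_ωInv ωInv_conv_ω).1 h
  rw [conv_rid (E := ((R ⊗[k] H) ⊗[k] (R ⊗[k] H)) ⊗[k] (R ⊗[k] H)),
    conv_lid (E := ((R ⊗[k] H) ⊗[k] (R ⊗[k] H)) ⊗[k] (R ⊗[k] H))]
  refine (conv_conj_iff (ψ := pullback₃ ωInv (bosProj X))
    (conv_pullback₃ (bosProjHom X) ω ωInv ω_conv_ωInv)
    (conv_pullback₃ (bosProjHom X) ωInv ω ωInv_conv_ω)).2 ?_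
  refine (congrArg (mR (bosMul X) ∘ₗ ·) (coactBy_pullback₃ X ωInv)).trans ?_
  have h₁ := mulMap_assoc X hH hH hH
  have h₂ := mulMap_translate X ωInv
  have h₃ : mR (bosMul X) ∘ₗ twist ωInv (bosCoact X) (bosCoact X) (bosCoact X) =
      (bosMul X ∘ₗ TensorProduct.map LinearMap.id (bosMul X)) ∘ₗ
        assocC (bosCoact X) (bosCoact X) (bosCoact X) := by
    rw [mR, assocC]
    simp only [LinearMap.comp_assoc]
  rw [h₃, bosMul_right, LinearMap.comp_assoc, ← h₁, LinearMap.comp_assoc,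
    ← LinearMap.comp_assoc, ← TensorProduct.map_comp, LinearMap.id_comp]
  have h₄ : ((m (k := k) (H := H)).toLinearMap ∘ₗ
      TensorProduct.map LinearMap.id (m (k := k) (H := H)).toLinearMap) ∘ₗ
      assocC Coalgebra.comul Coalgebra.comul Coalgebra.comul =
      mL (m (k := k) (H := H)).toLinearMap ∘ₗ coeffMap Coalgebra.comul ωInv := hH₁
  rw [h₄, ← LinearMap.id_comp (LinearMap.id : R →ₗ[k] R), TensorProduct.map_comp,
    LinearMap.comp_assoc, h₂, bosMul_left]
  rfl

theorem bosProj_bosIncl (h : H) : bosProj X (bosIncl X h) = h := by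
  have hu : X.counit (X.unit 1) = 1 := LinearMap.congr_fun X.counit_unit 1
  simp [bosProj, bosIncl, hu]

theorem bosProj_one : bosProj X (X.unit 1 ⊗ₜ[k] oneH k H) = oneH k H := bosProj_bosIncl X _

/-- The bosonization `R # H`. -/
noncomputable abbrev bosonization : DualQuasiBialgebra k (R ⊗[k] H) :=
  letI := bosCoalgebra X
  { bosCoalgebra X with
    m := bosMulHom X
    u := (bosInclHom X).comp u
    ω := pullback₃ ω (bosProj X)
    ωInv := pullback₃ ωInv (bosProj X)
    ω_conv_ωInv := conv_pullback₃ (bosProjHom X) ω ωInv ω_conv_ωInv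
    ωInv_conv_ω := conv_pullback₃ (bosProjHom X) ωInv ω ωInv_conv_ω
    cocycle := cocycle_pullback₃ (bosProjHom X) (bosProj_bosMul X)
    ω_one_left := fun x y => by
      have h := LinearMap.congr_fun (bosProjHom X).counit_comp
      refine (congrArg (fun z => ω ((z ⊗ₜ[k] bosProj X x) ⊗ₜ[k] bosProj X y))
        (bosProj_one X)).trans ((ω_one_left _ _).trans (congrArg₂ (· * ·) (h x) (h y)))
    ω_one_mid := fun x y => by
      have h := LinearMap.congr_fun (bosProjHom X).counit_comp
      refine (congrArg (fun z => ω ((bosProj X x ⊗ₜ[k] z) ⊗ₜ[k] bosProj X y))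
        (bosProj_one X)).trans ((ω_one_mid _ _).trans (congrArg₂ (· * ·) (h x) (h y)))
    ω_one_right := fun x y => by
      have h := LinearMap.congr_fun (bosProjHom X).counit_comp
      refine (congrArg (fun z => ω ((bosProj X x ⊗ₜ[k] bosProj X y) ⊗ₜ[k] z))
        (bosProj_one X)).trans ((ω_one_right _ _).trans (congrArg₂ (· * ·) (h x) (h y)))
    quasi_assoc := bosMul_quasi_assoc X
    one_m := bosMul_one_left X
    m_one := bosMul_one_right X }

end Bosonization

/-! ### Explicit formulas -/

section Formulas

variable {k H : Type*} [Field k] [AddCommGroup H] [Module k H]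

/-- Brings a nested independent sum to the outside; iterated to permute long Sweedler expressions.
-/
theorem sw_pull {A B C D F : Type*} [AddCommGroup A] [Module k A] [AddCommGroup B] [Module k B]
    [AddCommGroup C] [Module k C] [AddCommGroup D] [Module k D] [AddCommGroup F]
    {t : A ⊗[k] B} {s : C ⊗[k] D} {f : A → B → F} {g : A → B → C → D → F}
    (h : ∀ a b, f a b = sw s (g a b)) : sw t f = sw s fun c d => sw t fun a b => g a b c d :=
  (sw_congr h).trans (sw_comm _ _ _)

variable [DualQuasiBialgebra k H] {U V W Y R : Type*}
  [AddCommGroup U] [Module k U] [AddCommGroup V] [Module k V] [AddCommGroup W] [Module k W]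
  [AddCommGroup Y] [Module k Y] [AddCommGroup R] [Module k R]

/-- The presentation chosen by `sw` for a diagonal coaction need not be the evident one, but the
body is bilinear, so the sum may be computed from presentations of the two factors. -/
theorem sw_tensorCoaction {A : Type*} [AddCommGroup A] [Module k A] (ρW : W →ₗ[k] H ⊗[k] W)
    (ρY : Y →ₗ[k] H ⊗[k] Y) (φ : H →ₗ[k] k) (f : W ⊗[k] Y →ₗ[k] A) (z : W) (w : Y) :
    (sw (tensorCoaction ρW ρY (z ⊗ₜ[k] w)) fun a b => φ a • f b) =
      sw (ρW z) fun z₁ z₀ => sw (ρY w) fun w₁ w₀ => φ (mulH k z₁ w₁) • f (z₀ ⊗ₜ[k] w₀) := by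
  have h := map_eq_sw ((TensorProduct.lid k A).toLinearMap ∘ₗ TensorProduct.map φ f)
    (tensorCoaction ρW ρY (z ⊗ₜ[k] w))
  simp only [LinearMap.comp_apply, TensorProduct.map_tmul, LinearEquiv.coe_coe,
    TensorProduct.lid_tmul] at h
  rw [← h, tensorCoaction_tmul]
  simp only [map_sw, TensorProduct.map_tmul, TensorProduct.lid_tmul]

theorem assocC_tensor_tmul (ρU : U →ₗ[k] H ⊗[k] U) (ρV : V →ₗ[k] H ⊗[k] V)
    (ρW : W →ₗ[k] H ⊗[k] W) (ρY : Y →ₗ[k] H ⊗[k] Y) (x : U) (y : V) (z : W) (w : Y) :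
    assocC ρU ρV (tensorCoaction ρW ρY) ((x ⊗ₜ[k] y) ⊗ₜ[k] (z ⊗ₜ[k] w)) =
      sw (ρU x) fun x₁ x₀ => sw (ρV y) fun y₁ y₀ => sw (ρW z) fun z₁ z₀ => sw (ρY w) fun w₁ w₀ =>
        omInv k x₁ y₁ (mulH k z₁ w₁) • (x₀ ⊗ₜ[k] (y₀ ⊗ₜ[k] (z₀ ⊗ₜ[k] w₀))) := by
  rw [assocC_tmul]
  exact sw_congr fun x₁ x₀ => sw_congr fun y₁ y₀ => sw_tensorCoaction ρW ρY
    (DualQuasiBialgebra.ωInv ∘ₗ TensorProduct.mk k (H ⊗[k] H) H (x₁ ⊗ₜ[k] y₁))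
    (TensorProduct.mk k U _ x₀ ∘ₗ TensorProduct.mk k V _ y₀) z w

theorem assocCInv_tensor_tmul (ρU : U →ₗ[k] H ⊗[k] U) (ρV : V →ₗ[k] H ⊗[k] V)
    (ρW : W →ₗ[k] H ⊗[k] W) (ρY : Y →ₗ[k] H ⊗[k] Y) (x : U) (y : V) (z : W) (w : Y) :
    assocCInv ρU ρV (tensorCoaction ρW ρY) (x ⊗ₜ[k] (y ⊗ₜ[k] (z ⊗ₜ[k] w))) =
      sw (ρU x) fun x₁ x₀ => sw (ρV y) fun y₁ y₀ => sw (ρW z) fun z₁ z₀ => sw (ρY w) fun w₁ w₀ =>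
        om k x₁ y₁ (mulH k z₁ w₁) • ((x₀ ⊗ₜ[k] y₀) ⊗ₜ[k] (z₀ ⊗ₜ[k] w₀)) := by
  rw [assocCInv_tmul]
  exact sw_congr fun x₁ x₀ => sw_congr fun y₁ y₀ => sw_tensorCoaction ρW ρY
    (DualQuasiBialgebra.ω ∘ₗ TensorProduct.mk k (H ⊗[k] H) H (x₁ ⊗ₜ[k] y₁))
    (TensorProduct.mk k (U ⊗[k] V) _ (x₀ ⊗ₜ[k] y₀)) z w

variable (X : YDBialgebra k H R)

theorem bosComul_tmul (r : R) (h : H) : bosComul X (r ⊗ₜ[k] h) =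
    sw (X.comul r) fun ra rb =>
    sw (X.coact ra) fun a₁ a₀ =>
    sw (X.coact rb) fun b₂ b' => sw (X.coact b') fun b₁ b₀ =>
    sw (Δ k h) fun h₁ h' => sw (Δ k h') fun h₂ h₃ =>
      omInv k a₁ b₂ h₁ • ((a₀ ⊗ₜ[k] mulH k b₁ h₂) ⊗ₜ[k] (b₀ ⊗ₜ[k] h₃)) := by
  have hr : X.comul r ⊗ₜ[k] h = sw (X.comul r) fun ra rb => (ra ⊗ₜ[k] rb) ⊗ₜ[k] h := by
    conv_lhs => rw [eq_sw (X.comul r)]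
    rw [sw_tmul]
  simp only [bosComul, comulMap, expand, LinearMap.comp_apply, TensorProduct.map_tmul,
    LinearMap.id_apply, hr, map_sw, assocC_tmul, map_smul, tensorCoaction_tmul, tmul_sw, smul_sw,
    LinearEquiv.coe_coe, TensorProduct.assoc_symm_tmul]
  exact sw_congr fun _ _ => sw_congr fun _ _ => sw_congr fun _ _ => sw_comm _ _ _

theorem bosMul_tmul (r s : R) (h l : H) :
    bosMul X ((r ⊗ₜ[k] h) ⊗ₜ[k] (s ⊗ₜ[k] l)) =
      sw (X.coact r) fun r₂ r' => sw (X.coact r') fun r₁ r₀ =>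
      sw (X.coact s) fun s₂ s' => sw (X.coact s') fun s₁ s₀ =>
      sw (Δ k h) fun h₁ h' => sw (Δ k h') fun h₂ h' => sw (Δ k h') fun h₃ h' =>
      sw (Δ k h') fun h₄ h' => sw (Δ k h') fun h₅ h₆ =>
      sw (Δ k l) fun l₁ l' => sw (Δ k l') fun l₂ l' => sw (Δ k l') fun l₃ l' =>
      sw (Δ k l') fun l₄ l₅ =>
      sw (X.coact (X.act (h₃ ⊗ₜ[k] s₀))) fun x₂ x' => sw (X.coact x') fun x₁ x₀ =>
        (omInv k r₂ h₁ (mulH k s₂ l₁) * om k h₂ s₁ l₂ *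
          omInv k x₂ h₄ l₃ * om k r₁ x₁ (mulH k h₅ l₄)) •
          (X.mul (r₀ ⊗ₜ[k] x₀) ⊗ₜ[k] mulH k h₆ l₅) := by
  simp only [bosMul, mulMap, interchange, LinearMap.comp_apply, assocC_tensor_tmul, map_sw,
    map_smul]
  simp only [TensorProduct.map_tmul, LinearMap.id_apply,
    assocCInv_tmul Coalgebra.comul X.coact Coalgebra.comul, tmul_sw, map_sw, map_smul,
    TensorProduct.tmul_smul, braid_tmul, sw_tmul, assocC_tmul,
    assocCInv_tensor_tmul X.coact X.coact Coalgebra.comul Coalgebra.comul, smul_sw, smul_smul]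
  -- Expansion leaves the sums in the order in which the maps are composed. One variable at a time
  -- is now brought to the front and fixed, in the order of the stated formula.
  refine sw_congr fun r₂ r' => ?_
  refine (sw_pull fun _ _ => sw_pull fun _ _ => sw_pull fun _ _ => sw_pull fun _ _ => sw_pull
    fun _ _ => sw_pull fun _ _ => sw_pull fun _ _ => sw_pull fun _ _ => sw_pull fun _ _ =>
    sw_comm _ _ _).trans ?_
  refine sw_congr fun r₁ r₀ => ?_
  refine (sw_comm _ _ _).trans ?_
  refine sw_congr fun s₂ s' => ?_
  refine (sw_pull fun _ _ => sw_pull fun _ _ => sw_comm _ _ _).trans ?_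
  refine sw_congr fun s₁ s₀ => ?_
  refine sw_congr fun h₁ h' => ?_
  refine (sw_comm _ _ _).trans ?_
  refine sw_congr fun h₂ h' => ?_
  refine (sw_pull fun _ _ => sw_comm _ _ _).trans ?_
  refine sw_congr fun h₃ h' => ?_
  refine (sw_pull fun _ _ => sw_pull fun _ _ => sw_comm _ _ _).trans ?_
  refine sw_congr fun h₄ h' => ?_
  refine (sw_pull fun _ _ => sw_pull fun _ _ => sw_pull fun _ _ => sw_pull fun _ _ => sw_comm _
    _ _).trans ?_
  refine sw_congr fun h₅ h₆ => ?_
  refine sw_congr fun l₁ l' => ?_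
  refine sw_congr fun l₂ l' => ?_
  refine (sw_comm _ _ _).trans ?_
  refine sw_congr fun l₃ l' => ?_
  refine (sw_pull fun _ _ => sw_comm _ _ _).trans ?_
  refine sw_congr fun l₄ l₅ => ?_
  refine sw_congr fun x₂ x' => sw_congr fun x₁ x₀ => ?_
  exact congrArg (· • (X.mul (r₀ ⊗ₜ[k] x₀) ⊗ₜ[k] mulH k h₆ l₅)) (by ring)

end Formulas

end DQB

open DQB

theorem mainTheorem1 {k H R : Type*} [Field k]
    [AddCommGroup H] [Module k H] [DualQuasiBialgebra k H]
    [AddCommGroup R] [Module k R] (X : YDBialgebra k H R) :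
    ∃ B : DualQuasiBialgebra k (R ⊗[k] H),
      -- the multiplication of `R # H`
      (∀ (r s : R) (h l : H), B.m ((r ⊗ₜ[k] h) ⊗ₜ[k] (s ⊗ₜ[k] l)) =
        sw (X.coact r) fun r₂ r' => sw (X.coact r') fun r₁ r₀ =>
        sw (X.coact s) fun s₂ s' => sw (X.coact s') fun s₁ s₀ =>
        sw (Δ k h) fun h₁ h' => sw (Δ k h') fun h₂ h' => sw (Δ k h') fun h₃ h' =>
        sw (Δ k h') fun h₄ h' => sw (Δ k h') fun h₅ h₆ =>
        sw (Δ k l) fun l₁ l' => sw (Δ k l') fun l₂ l' => sw (Δ k l') fun l₃ l' =>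
        sw (Δ k l') fun l₄ l₅ =>
        sw (X.coact (X.act (h₃ ⊗ₜ[k] s₀))) fun x₂ x' => sw (X.coact x') fun x₁ x₀ =>
          (omInv k r₂ h₁ (mulH k s₂ l₁) * om k h₂ s₁ l₂ *
            omInv k x₂ h₄ l₃ * om k r₁ x₁ (mulH k h₅ l₄)) •
            (X.mul (r₀ ⊗ₜ[k] x₀) ⊗ₜ[k] mulH k h₆ l₅)) ∧
      -- the unit
      (∀ c : k, B.u c = (c • X.unit 1) ⊗ₜ[k] oneH k H) ∧
      -- the comultiplication
      (∀ (r : R) (h : H), B.comul (r ⊗ₜ[k] h) =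
        sw (X.comul r) fun ra rb =>
        sw (X.coact ra) fun a₁ a₀ =>
        sw (X.coact rb) fun b₂ b' => sw (X.coact b') fun b₁ b₀ =>
        sw (Δ k h) fun h₁ h' => sw (Δ k h') fun h₂ h₃ =>
          omInv k a₁ b₂ h₁ • ((a₀ ⊗ₜ[k] mulH k b₁ h₂) ⊗ₜ[k] (b₀ ⊗ₜ[k] h₃))) ∧
      -- the counit
      (∀ (r : R) (h : H), B.counit (r ⊗ₜ[k] h) = X.counit r * ε k h) ∧
      -- the reassociator
      (∀ (r s t : R) (h l j : H),
        B.ω (((r ⊗ₜ[k] h) ⊗ₜ[k] (s ⊗ₜ[k] l)) ⊗ₜ[k] (t ⊗ₜ[k] j)) =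
          X.counit r * X.counit s * X.counit t * om k h l j) ∧
      -- the projection onto `H`
      ∃ (σ : DualQuasiBialgebraHom k H (R ⊗[k] H)) (π : DualQuasiBialgebraHom k (R ⊗[k] H) H),
        (∀ h : H, σ.toCoalgHom h = X.unit 1 ⊗ₜ[k] h) ∧
        (∀ (r : R) (h : H), π.toCoalgHom (r ⊗ₜ[k] h) = X.counit r • h) ∧
        (∀ h : H, π.toCoalgHom (σ.toCoalgHom h) = h) := by
  let B := bosonization X
  let σ : DualQuasiBialgebraHom k H (R ⊗[k] H) :=
    { bosInclHom X with
      map_m := fun h l => (bosMul_bosIncl X h l).symm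
      map_u := fun c => rfl
      -- The reassociator of `R # H` factors through `π`, and `πσ = id`.
      map_ω := fun h l j => congrArg DualQuasiBialgebra.ω
        (congrArg₂ (· ⊗ₜ[k] ·) (congrArg₂ (· ⊗ₜ[k] ·) (bosProj_bosIncl X h) (bosProj_bosIncl X l))
          (bosProj_bosIncl X j)) }
  let π : DualQuasiBialgebraHom k (R ⊗[k] H) H :=
    { bosProjHom X with
      map_m := fun x y => LinearMap.congr_fun (bosProj_bosMul X) (x ⊗ₜ[k] y)
      map_u := fun c => bosProj_bosIncl X (DualQuasiBialgebra.u c)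
      map_ω := fun x y z => rfl }
  refine ⟨B, bosMul_tmul X, fun c => ?_, bosComul_tmul X, fun r h => ?_, fun r s t h l j => ?_,
    σ, π, fun h => rfl, fun r h => ?_, bosProj_bosIncl X⟩
  · change X.unit 1 ⊗ₜ[k] DualQuasiBialgebra.u c = _
    rw [TensorProduct.smul_tmul, oneH, ← map_smul, smul_eq_mul, mul_one]
  · change bosCounit X (r ⊗ₜ[k] h) = _
    simp [bosCounit]
  · change DualQuasiBialgebra.ω ((bosProj X (r ⊗ₜ[k] h) ⊗ₜ[k] bosProj X (s ⊗ₜ[k] l)) ⊗ₜ[k]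
      bosProj X (t ⊗ₜ[k] j)) = _
    simp only [bosProj, LinearMap.comp_apply, TensorProduct.map_tmul, LinearMap.id_apply,
      LinearEquiv.coe_coe, TensorProduct.lid_tmul, ← TensorProduct.smul_tmul',
      TensorProduct.tmul_smul, map_smul, smul_eq_mul]
    ring
  · change bosProj X (r ⊗ₜ[k] h) = _
    simp [bosProj]
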